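/- **Conventions.** All C*-algebras are over $\mathbb C$. For a unital C*-algebra $\mathfrak A$, $\mathfrak{sa}(\mathfrak A)$ is the real space of its self-adjoint elements and $\mathscr S(\mathfrak A)$ its state space; put $a\circ b=\tfrac12(ab+ba)$ and $\{a,b\}=\tfrac1{2i}(ab-ba)$. A function $F:[0,\infty)^4\to[0,\infty)$ is *permissible* if it is nondecreasing in each variable and $x\,l_y+y\,l_x\le F(x,y,l_x,l_y)$ for all arguments. For $C\ge 1$, $D\ge 0$ put $F_{C,D}(x,y,l_x,l_y)=C(x\,l_y+y\,l_x)+D\,l_xl_y$. **Quantum compact metric spaces.** An *$F$-quasi-Leibniz quantum compact metric space*, for a permissible $F$, is a pair $(\mathfrak A,\mathsf L)$ of a unital C*-algebra $\mathfrak A$ and a seminorm $\mathsf L$ on a dense real subspace $\mathrm{dom}(\mathsf L)$ of $\mathfrak{sa}(\mathfrak A)$ closed under $\circ$ and $\{\cdot,\cdot\}$ (extended by $\mathsf L=\infty$ off $\mathrm{dom}(\mathsf L)$) such that: $\{a:\mathsf L(a)=0\}=\mathbb R1_{\mathfrak A}$; $\{a\in\mathfrak{sa}(\mathfrak A):\mathsf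 L(a)\le1\}$ is norm closed; $\mathsf{mk}_{\mathsf L}(\varphi,\psi)=\sup\{|\varphi(a)-\psi(a)|:a\in\mathrm{dom}(\mathsf L),\ \mathsf L(a)\le1\}$ is a (finite) metric on $\mathscr S(\mathfrak A)$ inducing the weak* topology; and both $\mathsf L(a\circ b)$ and $\mathsf L(\{a,b\})$ are at most $F(\|a\|,\|b\|,\mathsf L(a),\mathsf L(b))$ for $a,b\in\mathrm{dom}(\mathsf L)$. It is *$(C,D)$-quasi-Leibniz* if this holds with $F=F_{C,D}$, and *Leibniz* if it holds with $F(x,y,l_x,l_y)=x\,l_y+y\,l_x$. It is *finite dimensional* if $\mathfrak A$ is. **Dual propinquity.** An *$F$-tunnel* from $(\mathfrak A_1,\mathsf L_1)$ to $(\mathfrak A_2,\mathsf L_2)$ is an $F$-quasi-Leibniz quantum compact metric space $(\mathfrak D,\mathsf L_{\mathfrak D})$ with surjective *-homomorphisms $\pi_j:\mathfrak D\to\mathfrak A_j$, $j=1,2$, such that $\mathsf L_j(a)=\inf\{\mathsf L_{\mathfrak D}(d):d\in\mathfrak{sa}(\mathfrak D),\ \pi_j(d)=a\}$ for all $a\in\mathfrak{sa}(\mathfrak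 A_j)$. Its *extent* is the maximum over $j\in\{1,2\}$ of the Hausdorff distance, for $\mathsf{mk}_{\mathsf L_{\mathfrak D}}$, between $\mathscr S(\mathfrak D)$ and $\{\varphi\circ\pi_j:\varphi\in\mathscr S(\mathfrak A_j)\}$. The *$(C,D)$-dual propinquity* $\Lambda_{C,D}$ between two $(C,D)$-quasi-Leibniz quantum compact metric spaces is the infimum of the extents of all $F_{C,D}$-tunnels between them. **Algebras.** A unital C*-algebra $\mathfrak A$ is *pseudo-diagonal* if for every $\varepsilon>0$ and every finite $\mathfrak F\subseteq\mathfrak A$ there are a finite dimensional C*-algebra $\mathfrak B$ and positive unital linear maps $\varphi:\mathfrak B\to\mathfrak A$, $\psi:\mathfrak A\to\mathfrak B$ with $\|a-\varphi(\psi(a))\|\le\varepsilon$, $\|\psi(a\circ b)-\psi(a)\circ\psi(b)\|\le\varepsilon$ and $\|\psi(\{a,b\})-\{\psi(a),\psi(b)\}\|\le\varepsilon$ for all $a,b\in\mathfrak F$. It is *nuclear* if for every $\varepsilon>0$ and finite $\mathfrak F\subseteq\mathfrak A$ there are $n$ and contractive completely positive maps $\psi:\mathfrak A\to M_n(\mathbb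 C)$, $\varphi:M_n(\mathbb C)\to\mathfrak A$ with $\|a-\varphi(\psi(a))\|\le\varepsilon$ for $a\in\mathfrak F$. It is *quasi-diagonal* if for every $\varepsilon>0$ and finite $\mathfrak F\subseteq\mathfrak A$ there are $n$ and a contractive completely positive map $\psi:\mathfrak A\to M_n(\mathbb C)$ with $\|\psi(ab)-\psi(a)\psi(b)\|\le\varepsilon$ and $\|a\|\le\|\psi(a)\|+\varepsilon$ for all $a,b\in\mathfrak F$. **Theorem.** Let $C\ge1$, $D\ge0$, and let $(\mathfrak A,\mathsf L)$ be a $(C,D)$-quasi-Leibniz quantum compact metric space. 1. If $\mathfrak A$ is pseudo-diagonal, then for every $\varepsilon>0$, $(\mathfrak A,\mathsf L)$ is a $(C(1+\varepsilon),D+\varepsilon)$-quasi-Leibniz quantum compact metric space and there is a sequence $(\mathfrak B_n,\mathsf L_n)_{n\in\mathbb N}$ of finite dimensional $(C(1+\varepsilon),D+\varepsilon)$-quasi-Leibniz quantum compact metric spaces with $\lim_{n\to\infty}\Lambda_{C(1+\varepsilon),\,D+\varepsilon}\big((\mathfrak A,\mathsf L),(\mathfrak B_n,\mathsf L_n)\big)=0$.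 2. The same conclusion holds if $\mathfrak A$ is nuclear and quasi-diagonal. In particular, if $(\mathfrak A,\mathsf L)$ is a Leibniz quantum compact metric space with $\mathfrak A$ nuclear and quasi-diagonal, then for every $\varepsilon>0$ it is a limit, for $\Lambda_{1+\varepsilon,\,\varepsilon}$, of a sequence of finite dimensional $(1+\varepsilon,\varepsilon)$-quasi-Leibniz quantum compact metric spaces. -/

import Mathlib

open Filter Topology
open scoped NNReal ENNReal

universe u

noncomputable section

namespace QuantumMetric

open scoped CStarAlgebra ComplexOrder

/-! ### Jordan and Lie products -/

section Products

variable {A : Type u} [CStarAlgebra A]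

/-- The Jordan product `(ab + ba) / 2`. -/
def jordan (a b : A) : A := (2⁻¹ : ℂ) • (a * b + b * a)

/-- The Lie product `(ab - ba) / (2i)`. -/
def lie (a b : A) : A := ((2 * Complex.I)⁻¹ : ℂ) • (a * b - b * a)

lemma jordan_mem (a b : selfAdjoint A) : jordan (a : A) (b : A) ∈ selfAdjoint A := by
  rw [selfAdjoint.mem_iff]
  simp [jordan, star_smul, a.2.star_eq, b.2.star_eq, add_comm]

lemma lie_mem (a b : selfAdjoint A) : lie (a : A) (b : A) ∈ selfAdjoint A := by
  rw [selfAdjoint.mem_iff]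
  simp only [lie, star_smul, star_sub, star_mul, a.2.star_eq, b.2.star_eq]
  rw [← neg_sub ((a : A) * b), smul_neg, ← neg_smul]
  congr 1
  simp

/-- The Jordan product of two self-adjoint elements, as a self-adjoint element. -/
def saJordan (a b : selfAdjoint A) : selfAdjoint A := ⟨jordan (a : A) (b : A), jordan_mem a b⟩

/-- The Lie product of two self-adjoint elements, as a self-adjoint element. -/
def saLie (a b : selfAdjoint A) : selfAdjoint A := ⟨lie (a : A) (b : A), lie_mem a b⟩

end Products

/-! ### States and the Monge-Kantorovich metric -/

/-- The set of states of a unital C*-algebra: positive unital continuous linear functionals. -/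
def stateSet (A : Type u) [CStarAlgebra A] : Set (WeakDual ℂ A) :=
  {φ | φ 1 = 1 ∧ ∀ a : A, 0 ≤ φ (star a * a)}

/-- The state space of a unital C*-algebra; its topology as a subtype is the weak* topology. -/
abbrev State (A : Type u) [CStarAlgebra A] : Type u := stateSet A

/-- The pullback `φ ↦ φ ∘ π` of states along a unital *-homomorphism. -/
def State.pullback {A B : Type u} [CStarAlgebra A] [CStarAlgebra B] (π : A →⋆ₐ[ℂ] B)
    (φ : State B) : State A :=
  ⟨StrongDual.toWeakDual ((WeakDual.toStrongDual φ.1).comp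
      (⟨π.toAlgHom.toLinearMap, map_continuous π⟩ : A →L[ℂ] B)), by
    constructor
    · change φ.1 (π 1) = 1
      rw [map_one]; exact φ.2.1
    · intro a
      change 0 ≤ φ.1 (π (star a * a))
      rw [map_mul, map_star]; exact φ.2.2 (π a)⟩

@[simp] lemma State.pullback_apply {A B : Type u} [CStarAlgebra A] [CStarAlgebra B]
    (π : A →⋆ₐ[ℂ] B) (φ : State B) (a : A) : (State.pullback π φ).1 a = φ.1 (π a) := rfl

/-- The Monge-Kantorovich distance `sup {|φ(a) - ψ(a)| : L(a) ≤ 1}` of two states. -/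
def mkDist {A : Type u} [CStarAlgebra A] (L : selfAdjoint A → ℝ≥0∞) (φ ψ : State A) : ℝ≥0∞ :=
  ⨆ (a : selfAdjoint A) (_ : L a ≤ 1), ENNReal.ofReal ‖φ.1 (a : A) - ψ.1 (a : A)‖

/-- The Monge-Kantorovich distance as an extended pseudo-metric (with its own topology) on the
state space. -/
@[reducible] def mkMetric {A : Type u} [CStarAlgebra A] (L : selfAdjoint A → ℝ≥0∞) :
    PseudoEMetricSpace (State A) where
  edist := mkDist L
  edist_self φ := by simp [mkDist]
  edist_comm φ ψ := by simp only [mkDist, norm_sub_rev]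
  edist_triangle φ ψ χ := by
    refine iSup₂_le fun a ha => ?_
    refine le_trans ?_ (add_le_add
      (le_iSup₂ (f := fun (a : selfAdjoint A) (_ : L a ≤ 1) =>
        ENNReal.ofReal ‖φ.1 (a : A) - ψ.1 (a : A)‖) a ha)
      (le_iSup₂ (f := fun (a : selfAdjoint A) (_ : L a ≤ 1) =>
        ENNReal.ofReal ‖ψ.1 (a : A) - χ.1 (a : A)‖) a ha))
    rw [← ENNReal.ofReal_add (norm_nonneg _) (norm_nonneg _)]
    exact ENNReal.ofReal_le_ofReal (norm_sub_le_norm_sub_add_norm_sub _ _ _)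

/-- The Hausdorff distance, for the Monge-Kantorovich metric of `L`, of two sets of states. -/
def mkHausdorff {A : Type u} [CStarAlgebra A] (L : selfAdjoint A → ℝ≥0∞)
    (s t : Set (State A)) : ℝ≥0∞ :=
  @Metric.hausdorffEDist (State A) (mkMetric L) s t

/-! ### Quasi-Leibniz quantum compact metric spaces -/

/-- Permissible functions `[0,∞)⁴ → [0,∞)`. -/
structure IsPermissible (F : ℝ≥0 → ℝ≥0 → ℝ≥0 → ℝ≥0 → ℝ≥0) : Prop where
  mono : ∀ ⦃x x' y y' lx lx' ly ly' : ℝ≥0⦄, x ≤ x' → y ≤ y' → lx ≤ lx' → ly ≤ ly' →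
    F x y lx ly ≤ F x' y' lx' ly'
  leibniz_le : ∀ x y lx ly : ℝ≥0, x * ly + y * lx ≤ F x y lx ly

/-- The function `C (x l_y + y l_x) + D l_x l_y`. -/
def cdFun (C D : ℝ≥0) : ℝ≥0 → ℝ≥0 → ℝ≥0 → ℝ≥0 → ℝ≥0 :=
  fun x y lx ly => C * (x * ly + y * lx) + D * lx * ly

/-- The function `x l_y + y l_x`. -/
def leibnizFun : ℝ≥0 → ℝ≥0 → ℝ≥0 → ℝ≥0 → ℝ≥0 :=
  fun x y lx ly => x * ly + y * lx

/-- A pair of a unital C*-algebra and a function `[0,∞]`-valued on its self-adjoint part (meant as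
a seminorm on the subspace where it is finite, extended by `∞`). -/
structure CStarPair : Type (u + 1) where
  carrier : Type u
  [cstar : CStarAlgebra carrier]
  lip : selfAdjoint carrier → ℝ≥0∞

attribute [instance] CStarPair.cstar

instance : CoeSort CStarPair.{u} (Type u) := ⟨CStarPair.carrier⟩

/-- `X` is an `F`-quasi-Leibniz quantum compact metric space. The domain of the seminorm is
`{a | X.lip a < ∞}`; it is a real subspace by the first two clauses, and it is closed under the
Jordan and Lie products by the last two. -/
structure IsQuasiLeibnizQCMS (F : ℝ≥0 → ℝ≥0 → ℝ≥0 → ℝ≥0 → ℝ≥0) (X : CStarPair.{u}) :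
    Prop where
  permissible : IsPermissible F
  lip_add : ∀ a b : selfAdjoint X, X.lip (a + b) ≤ X.lip a + X.lip b
  lip_smul : ∀ (r : ℝ) (a : selfAdjoint X), X.lip (r • a) = ENNReal.ofReal |r| * X.lip a
  dense_domain : Dense {a : selfAdjoint X | X.lip a < ∞}
  lip_eq_zero : ∀ a : selfAdjoint X, X.lip a = 0 ↔ ∃ r : ℝ, a = r • (1 : selfAdjoint X)
  closed_ball : IsClosed {a : selfAdjoint X | X.lip a ≤ 1}
  mk_finite : ∀ φ ψ : State X, mkDist X.lip φ ψ < ∞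
  mk_topology : (mkMetric X.lip).toUniformSpace.toTopologicalSpace =
    (instTopologicalSpaceSubtype : TopologicalSpace (State X))
  lip_jordan : ∀ a b : selfAdjoint X, X.lip a < ∞ → X.lip b < ∞ →
    X.lip (saJordan a b) ≤ F ‖(a : X)‖₊ ‖(b : X)‖₊ (X.lip a).toNNReal (X.lip b).toNNReal
  lip_lie : ∀ a b : selfAdjoint X, X.lip a < ∞ → X.lip b < ∞ →
    X.lip (saLie a b) ≤ F ‖(a : X)‖₊ ‖(b : X)‖₊ (X.lip a).toNNReal (X.lip b).toNNReal

/-- `(C,D)`-quasi-Leibniz quantum compact metric spaces. -/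
abbrev IsCDQuasiLeibnizQCMS (C D : ℝ≥0) (X : CStarPair.{u}) : Prop :=
  IsQuasiLeibnizQCMS (cdFun C D) X

/-- Leibniz quantum compact metric spaces. -/
abbrev IsLeibnizQCMS (X : CStarPair.{u}) : Prop := IsQuasiLeibnizQCMS leibnizFun X

/-! ### Tunnels and the dual propinquity -/

/-- An `F`-tunnel from `X` to `Y`. -/
structure Tunnel (F : ℝ≥0 → ℝ≥0 → ℝ≥0 → ℝ≥0 → ℝ≥0) (X Y : CStarPair.{u}) :
    Type (u + 1) where
  space : CStarPair.{u}
  isQCMS : IsQuasiLeibnizQCMS F space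
  left : space →⋆ₐ[ℂ] X
  right : space →⋆ₐ[ℂ] Y
  left_surjective : Function.Surjective left
  right_surjective : Function.Surjective right
  left_quotient : ∀ a : selfAdjoint X,
    X.lip a = ⨅ (d : selfAdjoint space) (_ : left (d : space) = (a : X)), space.lip d
  right_quotient : ∀ b : selfAdjoint Y,
    Y.lip b = ⨅ (d : selfAdjoint space) (_ : right (d : space) = (b : Y)), space.lip d

/-- The extent of a tunnel. -/
def Tunnel.extent {F : ℝ≥0 → ℝ≥0 → ℝ≥0 → ℝ≥0 → ℝ≥0} {X Y : CStarPair.{u}}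
    (τ : Tunnel F X Y) : ℝ≥0∞ :=
  max (mkHausdorff τ.space.lip Set.univ (Set.range (State.pullback τ.left)))
    (mkHausdorff τ.space.lip Set.univ (Set.range (State.pullback τ.right)))

/-- The dual propinquity, for the class of all `F`-tunnels, between two `F`-quasi-Leibniz quantum
compact metric spaces: the infimum of the extents of the `F`-tunnels between them. -/
def propinquity (F : ℝ≥0 → ℝ≥0 → ℝ≥0 → ℝ≥0 → ℝ≥0) (X Y : CStarPair.{u}) : ℝ≥0∞ :=
  ⨅ τ : Tunnel F X Y, τ.extent

/-- Among the `(C,D)`-quasi-Leibniz quantum compact metric spaces, with the `(C,D)`-dual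
propinquity, `X` is the limit of a sequence of finite dimensional ones. -/
def IsLimitOfFiniteDimensional (C D : ℝ≥0) (X : CStarPair.{u}) : Prop :=
  IsCDQuasiLeibnizQCMS C D X ∧
  ∃ Y : ℕ → CStarPair.{u},
    (∀ n, IsCDQuasiLeibnizQCMS C D (Y n) ∧ FiniteDimensional ℂ (Y n)) ∧
    Tendsto (fun n => propinquity (cdFun C D) X (Y n)) atTop (𝓝 0)

/-! ### Pseudo-diagonal, nuclear and quasi-diagonal C*-algebras -/

/-- Positive linear maps; the positive elements of a C*-algebra are those of the form `b* b`. -/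
def IsPositiveMap {A B : Type*} [CStarAlgebra A] [CStarAlgebra B] (φ : A →ₗ[ℂ] B) : Prop :=
  ∀ a : A, ∃ b : B, φ (star a * a) = star b * b

/-- Completely positive linear maps: all the entrywise extensions to matrices are positive. -/
def IsCompletelyPositive {A B : Type*} [CStarAlgebra A] [CStarAlgebra B]
    (φ : A →ₗ[ℂ] B) : Prop :=
  ∀ (k : ℕ) (M : CStarMatrix (Fin k) (Fin k) A), ∃ N : CStarMatrix (Fin k) (Fin k) B,
    (star M * M).map φ = star N * N

/-- Contractive completely positive linear maps. -/
def IsCCP {A B : Type*} [CStarAlgebra A] [CStarAlgebra B] (φ : A →ₗ[ℂ] B) : Prop :=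
  IsCompletelyPositive φ ∧ ∀ a : A, ‖φ a‖ ≤ ‖a‖

/-- Pseudo-diagonal unital C*-algebras. -/
def IsPseudoDiagonal (A : Type u) [CStarAlgebra A] : Prop :=
  ∀ ε : ℝ, 0 < ε → ∀ S : Finset A,
    ∃ (B : Type u) (_ : CStarAlgebra B) (_ : FiniteDimensional ℂ B)
      (φ : B →ₗ[ℂ] A) (ψ : A →ₗ[ℂ] B),
      IsPositiveMap φ ∧ φ 1 = 1 ∧ IsPositiveMap ψ ∧ ψ 1 = 1 ∧
      (∀ a ∈ S, ‖a - φ (ψ a)‖ ≤ ε) ∧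
      (∀ a ∈ S, ∀ b ∈ S, ‖ψ (jordan a b) - jordan (ψ a) (ψ b)‖ ≤ ε) ∧
      (∀ a ∈ S, ∀ b ∈ S, ‖ψ (lie a b) - lie (ψ a) (ψ b)‖ ≤ ε)

/-- Nuclear C*-algebras: the identity map is a point-norm limit of contractive completely
positive maps that factor, through contractive completely positive maps, through full matrix
algebras. -/
def IsNuclear (A : Type u) [CStarAlgebra A] : Prop :=
  ∀ ε : ℝ, 0 < ε → ∀ S : Finset A,
    ∃ (n : ℕ) (ψ : A →ₗ[ℂ] CStarMatrix (Fin n) (Fin n) ℂ)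
      (φ : CStarMatrix (Fin n) (Fin n) ℂ →ₗ[ℂ] A),
      IsCCP ψ ∧ IsCCP φ ∧ ∀ a ∈ S, ‖a - φ (ψ a)‖ ≤ ε

/-- Quasi-diagonal C*-algebras: there are contractive completely positive maps into full matrix
algebras that are asymptotically multiplicative and asymptotically isometric. -/
def IsQuasiDiagonal (A : Type u) [CStarAlgebra A] : Prop :=
  ∀ ε : ℝ, 0 < ε → ∀ S : Finset A,
    ∃ (n : ℕ) (ψ : A →ₗ[ℂ] CStarMatrix (Fin n) (Fin n) ℂ),
      IsCCP ψ ∧ (∀ a ∈ S, ∀ b ∈ S, ‖ψ (a * b) - ψ a * ψ b‖ ≤ ε) ∧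
      ∀ a ∈ S, ‖a‖ ≤ ‖ψ a‖ + ε

end QuantumMetric

end

open QuantumMetric

/-! The statement has two halves: finite dimensional approximation from pseudo-diagonality, and
pseudo-diagonality from nuclearity and quasi-diagonality.

For the first half, the Lipschitz ball modulo scalars is totally bounded
(`totallyBounded_lip_ball`). A pair of unital positive maps `ψ : X → B`, `φ : B → X` that works on a
finite net therefore works on the whole ball, with errors measured by `L` alone
(`exists_isApproxFactorization`). Put `max (L a) (δ⁻¹ ‖ψ a - b‖)` on `X × B` and its quotient on
`B`. If the Jordan and Lie defects of `ψ` are at most `η δ L(a) L(b)`, dividing by `δ` leaves `η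
L(a) L(b)`, which only raises `D` (`isCD_tunnel`). A lift of `b` of seminorm at most `l` has norm at
most `‖b‖ + 2δl`, so the quotient loses only `4Cδ` more in `D` (`isCD_quotient`). The extent is at
most `2δ` (`tunnel_extent_le`), and `δ`, `η` are arbitrarily small.

For the second half, nuclearity gives `α : A → M_k` and `β : M_k → A` with `β ∘ α` near the identity
but without multiplicativity, while quasi-diagonality gives almost multiplicative maps `τ` without a
way back. The two are joined by a positive `γ` with `γ ∘ τ` near `α`
(`eventually_exists_isPositiveMap`); then `β ∘ γ ∘ τ` is near the identity. To find `γ`, encode `α`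
as a positive functional on `M_k(A)` by the Choi correspondence. Amplifications of `τ` are
asymptotically isometric on self-adjoint matrices, and a Hahn-Banach separation argument shows that
states almost factor through almost isometric maps (`State.exists_near_of_almost_isometric`).
Unitality is restored at both ends by adding a small positive multiple of a state. -/

noncomputable section

namespace QuantumMetric

open scoped CStarAlgebra ComplexOrder ComplexStarModule

/-! ### Positive maps between C*-algebras. -/

section Order

variable {A B : Type*} [CStarAlgebra A] [CStarAlgebra B]

lemma norm_le_of_mem_Icc_algebraMap [PartialOrder A] [StarOrderedRing A] {a : A} {r : ℝ}
    (hr : 0 ≤ r) (ha : IsSelfAdjoint a) (h₁ : -algebraMap ℝ A r ≤ a) (h₂ : a ≤ algebraMap ℝ A r) :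
    ‖a‖ ≤ r := by
  rcases subsingleton_or_nontrivial A with _ | _
  · simpa [Subsingleton.elim a 0] using hr
  rcases CStarAlgebra.norm_or_neg_norm_mem_spectrum ha with h | h
  · exact (le_algebraMap_iff_spectrum_le ha).1 h₂ _ h
  · rw [← map_neg] at h₁
    have := (algebraMap_le_iff_le_spectrum ha).1 h₁ _ h
    linarith

variable [PartialOrder A] [StarOrderedRing A] [PartialOrder B] [StarOrderedRing B]

lemma isPositiveMap_iff {φ : A →ₗ[ℂ] B} : IsPositiveMap φ ↔ ∀ a, 0 ≤ a → 0 ≤ φ a := by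
  constructor
  · intro h a ha
    obtain ⟨b, rfl⟩ := CStarAlgebra.nonneg_iff_eq_star_mul_self.1 ha
    exact CStarAlgebra.nonneg_iff_eq_star_mul_self.2 (h b)
  · intro h a
    exact CStarAlgebra.nonneg_iff_eq_star_mul_self.1 (h _ (star_mul_self_nonneg a))

end Order

namespace IsPositiveMap

variable {A B C : Type*} [CStarAlgebra A] [CStarAlgebra B] [CStarAlgebra C]

lemma comp {φ : B →ₗ[ℂ] C} {ψ : A →ₗ[ℂ] B} (hφ : IsPositiveMap φ) (hψ : IsPositiveMap ψ) :
    IsPositiveMap (φ ∘ₗ ψ) := by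
  intro a
  obtain ⟨b, hb⟩ := hψ a
  obtain ⟨c, hc⟩ := hφ b
  exact ⟨c, by rw [LinearMap.comp_apply, hb, hc]⟩

lemma add {φ ψ : A →ₗ[ℂ] B} (hφ : IsPositiveMap φ) (hψ : IsPositiveMap ψ) :
    IsPositiveMap (φ + ψ) := by
  let _ := CStarAlgebra.spectralOrder A
  have _ := CStarAlgebra.spectralOrderedRing A
  let _ := CStarAlgebra.spectralOrder B
  have _ := CStarAlgebra.spectralOrderedRing B
  rw [isPositiveMap_iff] at *
  exact fun a ha => add_nonneg (hφ a ha) (hψ a ha)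

variable {φ : A →ₗ[ℂ] B}

lemma smul (hφ : IsPositiveMap φ) {r : ℝ} (hr : 0 ≤ r) : IsPositiveMap ((r : ℂ) • φ) := by
  intro a
  obtain ⟨b, hb⟩ := hφ a
  refine ⟨((√r : ℝ) : ℂ) • b, ?_⟩
  rw [LinearMap.smul_apply, hb, star_smul, smul_mul_smul_comm, Complex.star_def,
    Complex.conj_ofReal, ← Complex.ofReal_mul, Real.mul_self_sqrt hr]

lemma isSelfAdjoint_map (hφ : IsPositiveMap φ) {a : A} (ha : IsSelfAdjoint a) :
    IsSelfAdjoint (φ a) := by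
  let _ := CStarAlgebra.spectralOrder A
  have _ := CStarAlgebra.spectralOrderedRing A
  let _ := CStarAlgebra.spectralOrder B
  have _ := CStarAlgebra.spectralOrderedRing B
  exact ha.map' (PositiveLinearMap.mk₀ φ (isPositiveMap_iff.1 hφ))

lemma map_star (hφ : IsPositiveMap φ) (a : A) : φ (star a) = star (φ a) := by
  have h := realPart_add_I_smul_imaginaryPart a
  have h₁ := hφ.isSelfAdjoint_map (ℜ a).2
  have h₂ := hφ.isSelfAdjoint_map (ℑ a).2
  rw [← h]
  simp only [star_add, star_smul, map_add, map_smul, h₁.star_eq, h₂.star_eq,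
    (ℜ a).2.star_eq, (ℑ a).2.star_eq]

/-- Positivity preserves `-‖a‖ ≤ a ≤ ‖a‖`, and `φ 1 ≤ ‖φ 1‖`. -/
lemma norm_le (hφ : IsPositiveMap φ) {a : A} (ha : IsSelfAdjoint a) :
    ‖φ a‖ ≤ ‖φ 1‖ * ‖a‖ := by
  let _ := CStarAlgebra.spectralOrder A
  have _ := CStarAlgebra.spectralOrderedRing A
  let _ := CStarAlgebra.spectralOrder B
  have _ := CStarAlgebra.spectralOrderedRing B
  have hmono : ∀ x y : A, x ≤ y → φ x ≤ φ y := fun x y hxy => by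
    rw [← sub_nonneg, ← map_sub]; exact isPositiveMap_iff.1 hφ _ (sub_nonneg.2 hxy)
  have key : ∀ r : ℝ, φ (algebraMap ℝ A r) = r • φ 1 := fun r => by
    rw [Algebra.algebraMap_eq_smul_one, ← Complex.coe_smul, map_smul, Complex.coe_smul]
  have h1 : φ 1 ≤ algebraMap ℝ B ‖φ 1‖ :=
    IsSelfAdjoint.le_algebraMap_norm_self (hφ.isSelfAdjoint_map (.one A))
  have hle : ‖a‖ • φ 1 ≤ algebraMap ℝ B (‖φ 1‖ * ‖a‖) := by
    rw [mul_comm, map_mul, ← Algebra.smul_def]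
    exact smul_le_smul_of_nonneg_left h1 (norm_nonneg _)
  refine norm_le_of_mem_Icc_algebraMap (by positivity) (hφ.isSelfAdjoint_map ha) ?_ ?_
  · have := hmono _ _ ha.neg_algebraMap_norm_le_self
    rw [map_neg, key] at this
    exact (neg_le_neg hle).trans this
  · have := hmono _ _ ha.le_algebraMap_norm_self
    rw [key] at this
    exact this.trans hle

/-- Splitting into real and imaginary parts costs a factor `2`, which is harmless below and avoids
the Russo-Dye theorem. -/
lemma norm_le_two (hφ : IsPositiveMap φ) (a : A) : ‖φ a‖ ≤ 2 * ‖φ 1‖ * ‖a‖ := by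
  have h := realPart_add_I_smul_imaginaryPart a
  have h₁ := hφ.norm_le (ℜ a).2
  have h₂ := hφ.norm_le (ℑ a).2
  have h₃ : ‖(ℜ a : A)‖ ≤ ‖a‖ := by exact realPart.norm_le a
  have h₄ : ‖(ℑ a : A)‖ ≤ ‖a‖ := by exact imaginaryPart.norm_le a
  calc ‖φ a‖ = ‖φ (ℜ a) + Complex.I • φ (ℑ a)‖ := by rw [← map_smul, ← map_add, h]
    _ ≤ ‖φ (ℜ a)‖ + ‖φ (ℑ a)‖ := (norm_add_le _ _).trans (by simp [norm_smul])
    _ ≤ ‖φ 1‖ * ‖a‖ + ‖φ 1‖ * ‖a‖ := by gcongr <;> [exact h₁.trans (by gcongr); exact h₂.trans (by gcongr)]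
    _ = _ := by ring

lemma continuous (hφ : IsPositiveMap φ) : Continuous φ :=
  (LinearMap.mkContinuous φ _ hφ.norm_le_two).continuous

/-- Unital positive maps are contractive on self-adjoint elements. -/
lemma norm_le_of_map_one (hφ : IsPositiveMap φ) (h1 : φ 1 = 1) {a : A} (ha : IsSelfAdjoint a) :
    ‖φ a‖ ≤ ‖a‖ := by
  nontriviality B
  simpa [h1] using hφ.norm_le ha

end IsPositiveMap

lemma isPositiveMap_complex_iff {A : Type*} [CStarAlgebra A] {f : A →ₗ[ℂ] ℂ} :
    IsPositiveMap f ↔ ∀ a, 0 ≤ f (star a * a) :=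
  forall_congr' fun _ => CStarAlgebra.nonneg_iff_eq_star_mul_self.symm

/-! ### Existence of states by the Riesz extension theorem. -/

section Functional

/-- A real linear functional on a C*-algebra that is nonnegative on elements with positive real
part, in the form of a positive complex functional. -/
lemma exists_positive_extension {A : Type*} [CStarAlgebra A] [PartialOrder A] [StarOrderedRing A]
    (g : A →ₗ[ℝ] ℝ) (hg : ∀ x : A, 0 ≤ (ℜ x : A) → 0 ≤ g x) :
    ∃ f : A →ₗ[ℂ] ℂ, IsPositiveMap f ∧ ∀ x : A, IsSelfAdjoint x → f x = g x := by
  -- Both `x` and `-x` satisfy the positivity hypothesis. Hence the term `g (i x)` in the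
  -- complexification of `g` vanishes for self-adjoint `x`.
  have hskew : ∀ x : A, (ℜ x : A) = 0 → g x = 0 := by
    intro x hx
    refine le_antisymm ?_ (hg x hx.ge)
    have := hg (-x) (by rw [map_neg]; simp [hx])
    rwa [map_neg, neg_nonneg] at this
  have hsa : ∀ x : A, IsSelfAdjoint x → Module.Dual.extendRCLike (𝕜 := ℂ) g x = g x := by
    intro x hx
    have h0 : (ℜ (Complex.I • x) : A) = 0 := by
      rw [realPart_I_smul]
      simp [hx.imaginaryPart]
    rw [Module.Dual.extendRCLike_apply]
    have := hskew _ h0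
    simp only [Complex.coe_algebraMap, RCLike.I_to_complex, this]
    simp
  refine ⟨Module.Dual.extendRCLike (𝕜 := ℂ) g, isPositiveMap_complex_iff.2 fun a => ?_, hsa⟩
  rw [hsa _ (.star_mul_self a)]
  have : 0 ≤ g (star a * a) := hg _ (by
    rw [(IsSelfAdjoint.star_mul_self a).coe_realPart]; exact star_mul_self_nonneg a)
  exact_mod_cast this

/-- On the span of `1` and `a`, the functional `α + β a ↦ α + β l` is positive because `α + β l`
lies in the spectrum of `α + β a`; Riesz extension then extends it. Keeping `(α, β)` as formal
coordinates in `(ℝ × ℝ) × A` makes this well defined even when `a` is a scalar. -/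
lemma exists_positive_functional_of_mem_spectrum {A : Type*} [CStarAlgebra A] [Nontrivial A]
    {a : A} (ha : IsSelfAdjoint a) {l : ℝ} (hl : l ∈ spectrum ℝ a) :
    ∃ f : A →ₗ[ℂ] ℂ, IsPositiveMap f ∧ f 1 = 1 ∧ f a = l := by
  let _ := CStarAlgebra.spectralOrder A
  have _ := CStarAlgebra.spectralOrderedRing A
  let Φ : (ℝ × ℝ) × A →ₗ[ℝ] A :=
    { toFun := fun v => v.1.1 • (1 : A) + v.1.2 • a + v.2
      map_add' := fun v w => by simp [add_smul]; abel
      map_smul' := fun r v => by simp [mul_smul] }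
  let e : (ℝ × ℝ) × A →ₗ[ℝ] ℝ :=
    { toFun := fun v => v.1.1 + v.1.2 * l
      map_add' := fun v w => by simp; ring
      map_smul' := fun r v => by simp; ring }
  let s : PointedCone ℝ ((ℝ × ℝ) × A) :=
    { carrier := {v | 0 ≤ (ℜ (Φ v) : A)}
      add_mem' := fun {v w} hv hw => by
        change 0 ≤ (ℜ (Φ (v + w)) : A)
        rw [map_add, map_add]
        exact add_nonneg hv hw
      zero_mem' := by simp
      smul_mem' := fun r v hv => by
        change 0 ≤ (ℜ (Φ ((r : ℝ) • v)) : A)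
        rw [map_smul, map_smul]
        exact smul_nonneg r.2 hv }
  let f : ((ℝ × ℝ) × A) →ₗ.[ℝ] ℝ := ⟨Submodule.prod ⊤ ⊥, e ∘ₗ Submodule.subtype _⟩
  have hf : ∀ x : f.domain, (x : (ℝ × ℝ) × A) ∈ s → 0 ≤ f x := by
    rintro ⟨⟨⟨α, β⟩, x⟩, hx⟩ h
    obtain rfl : x = 0 := by simpa [f] using hx
    have h' : 0 ≤ α • (1 : A) + β • a := by
      have : 0 ≤ (ℜ (α • (1 : A) + β • a + 0) : A) := h
      rwa [add_zero, IsSelfAdjoint.coe_realPart] at this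
      exact .add (.smul (.all _) (.one A)) (.smul (.all _) ha)
    have hmem : α + β * l ∈ spectrum ℝ (α • (1 : A) + β • a) := by
      have := spectrum.subset_polynomial_aeval a (Polynomial.C α + Polynomial.C β * Polynomial.X)
        ⟨l, hl, rfl⟩
      simpa [Algebra.algebraMap_eq_smul_one] using this
    exact spectrum_nonneg_of_nonneg h' hmem
  -- Adding the scalar `‖ℜ (Φ y)‖` makes the real part nonnegative.
  have hd : ∀ y, ∃ x : f.domain, (x : (ℝ × ℝ) × A) + y ∈ s := by
    intro y
    refine ⟨⟨((‖(ℜ (Φ y) : A)‖, 0), 0), by simp [f]⟩, ?_⟩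
    change 0 ≤ (ℜ (Φ (_ + y)) : A)
    have h1 : Φ ((‖(ℜ (Φ y) : A)‖, 0), 0) = algebraMap ℝ A ‖(ℜ (Φ y) : A)‖ := by
      simp [Φ, Algebra.algebraMap_eq_smul_one]
    rw [map_add, map_add, h1, AddSubgroup.coe_add, IsSelfAdjoint.coe_realPart (.algebraMap _ (.all _))]
    have := IsSelfAdjoint.neg_algebraMap_norm_le_self (ℜ (Φ y)).2
    exact neg_le_iff_add_nonneg'.1 this
  obtain ⟨g, hg, hg0⟩ := riesz_extension s f hf hd
  -- The kernel of `Φ` is a subspace inside the cone, so `g` vanishes on it; this identifies the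
  -- formal coordinates with the elements of `A` that they name.
  have hgs : ∀ v, Φ v = 0 → g v = 0 := by
    intro v hv
    refine le_antisymm ?_ (hg0 v (by change 0 ≤ (ℜ (Φ v) : A); simp [hv]))
    have := hg0 (-v) (by change 0 ≤ (ℜ (Φ (-v)) : A); simp [hv])
    rwa [map_neg, neg_nonneg] at this
  have hval : ∀ α β : ℝ, g ((0, 0), α • 1 + β • a) = α + β * l := by
    intro α β
    have h1 := hgs ((-α, -β), α • 1 + β • a) (by simp [Φ]; abel)
    have h2 : g ((α, β), 0) = α + β * l := hg ⟨((α, β), 0), by simp [f]⟩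
    have h3 : (((0, 0), α • 1 + β • a) : (ℝ × ℝ) × A) = ((-α, -β), α • 1 + β • a) + ((α, β), 0) := by
      simp
    rw [h3, map_add, h1, h2, zero_add]
  obtain ⟨F, hF, hFg⟩ := exists_positive_extension (g ∘ₗ LinearMap.inr ℝ (ℝ × ℝ) A)
    (fun x hx => hg0 _ (by change 0 ≤ (ℜ (Φ _) : A); simpa [Φ] using hx))
  refine ⟨F, hF, ?_, ?_⟩
  · rw [hFg _ (.one A)]
    have := hval 1 0
    simp only [one_smul, zero_smul, add_zero, zero_mul] at this
    change ((g ((0, 0), 1) : ℝ) : ℂ) = 1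
    rw [this, Complex.ofReal_one]
  · rw [hFg _ ha]
    have := hval 0 1
    simp only [one_smul, zero_smul, zero_add, one_mul] at this
    change ((g ((0, 0), a) : ℝ) : ℂ) = l
    rw [this]

end Functional

namespace State

variable {A : Type u} [CStarAlgebra A]

/-- The state given by a unital positive linear functional. -/
def ofPositive (f : A →ₗ[ℂ] ℂ) (hf : IsPositiveMap f) (h1 : f 1 = 1) : State A :=
  ⟨StrongDual.toWeakDual ⟨f, hf.continuous⟩, h1, isPositiveMap_complex_iff.1 hf⟩

@[simp] lemma ofPositive_apply (f : A →ₗ[ℂ] ℂ) (hf : IsPositiveMap f) (h1 : f 1 = 1) (a : A) :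
    (ofPositive f hf h1).1 a = f a := rfl

/-- The positive linear functional underlying a state. -/
def toLinearMap (φ : State A) : A →ₗ[ℂ] ℂ := (WeakDual.toStrongDual φ.1).toLinearMap

@[simp] lemma toLinearMap_apply (φ : State A) (a : A) : φ.toLinearMap a = φ.1 a := rfl

lemma isPositiveMap (φ : State A) : IsPositiveMap φ.toLinearMap :=
  isPositiveMap_complex_iff.2 φ.2.2

lemma map_one (φ : State A) : φ.1 1 = 1 := φ.2.1

lemma norm_apply_le (φ : State A) {a : A} (ha : IsSelfAdjoint a) : ‖φ.1 a‖ ≤ ‖a‖ :=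
  φ.isPositiveMap.norm_le_of_map_one φ.2.1 ha

lemma norm_apply_le_two (φ : State A) (a : A) : ‖φ.1 a‖ ≤ 2 * ‖a‖ := by
  simpa [φ.map_one] using φ.isPositiveMap.norm_le_two a

lemma coe_re_apply (φ : State A) {a : A} (ha : IsSelfAdjoint a) : ((φ.1 a).re : ℂ) = φ.1 a :=
  Complex.conj_eq_iff_re.1 (φ.isPositiveMap.isSelfAdjoint_map ha)

lemma exists_apply_eq_of_mem_spectrum [Nontrivial A] {a : A} (ha : IsSelfAdjoint a) {l : ℝ}
    (hl : l ∈ spectrum ℝ a) : ∃ φ : State A, φ.1 a = l := by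
  obtain ⟨f, hf, h1, h2⟩ := exists_positive_functional_of_mem_spectrum ha hl
  exact ⟨ofPositive f hf h1, h2⟩

lemma exists_norm_apply_eq [Nontrivial A] {a : A} (ha : IsSelfAdjoint a) :
    ∃ φ : State A, ‖φ.1 a‖ = ‖a‖ := by
  rcases CStarAlgebra.norm_or_neg_norm_mem_spectrum ha with h | h
  all_goals
    obtain ⟨φ, hφ⟩ := exists_apply_eq_of_mem_spectrum ha h
    exact ⟨φ, by simp [hφ]⟩

instance [Nontrivial A] : Nonempty (State A) :=
  ⟨(exists_norm_apply_eq (.one A)).choose⟩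

/-- Banach-Alaoglu in the ball of radius `2`, the radius coming from `norm_apply_le_two`. -/
lemma isCompact_stateSet : IsCompact (stateSet A) := by
  refine (WeakDual.isCompact_closedBall (𝕜 := ℂ) (E := A) 0 2).of_isClosed_subset ?_ ?_
  · have : stateSet A = {φ : WeakDual ℂ A | φ 1 = 1} ∩ ⋂ a : A, {φ | 0 ≤ φ (star a * a)} := by
      ext; simp [stateSet]
    rw [this]
    exact (isClosed_eq (WeakDual.eval_continuous _) continuous_const).inter
      (isClosed_iInter fun a => isClosed_le continuous_const (WeakDual.eval_continuous _))
  · intro φ hφ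
    simp only [Set.mem_preimage, Metric.mem_closedBall, dist_zero_right]
    exact ContinuousLinearMap.opNorm_le_bound _ zero_le_two (norm_apply_le_two ⟨φ, hφ⟩)

instance : CompactSpace (State A) := isCompact_iff_compactSpace.1 isCompact_stateSet

end State

/-- A bounded image in `ℂ^m` has a finite `δ/2`-net, and points sharing a net point are `ε`-close in
`s`. No continuity of `f` is required. -/
lemma totallyBounded_of_forall_exists_map {α : Type*} [PseudoMetricSpace α] {s : Set α}
    (h : ∀ ε > 0, ∃ (m : ℕ) (f : α → Fin m → ℂ), Bornology.IsBounded (f '' s) ∧ ∃ δ > 0,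
      ∀ x ∈ s, ∀ y ∈ s, dist (f x) (f y) < δ → dist x y < ε) : TotallyBounded s := by
  refine Metric.totallyBounded_of_finite_discretization fun ε hε => ?_
  obtain ⟨m, f, hb, δ, hδ, hf⟩ := h ε hε
  obtain ⟨t, ht, hst⟩ := Metric.totallyBounded_iff.1 (hb.isCompact_closure.totallyBounded.subset subset_closure) (δ / 2) (half_pos hδ)
  have hmem : ∀ x : s, ∃ y ∈ t, dist (f x) y < δ / 2 := fun x => by
    simpa using hst ⟨x, x.2, rfl⟩
  choose c hc hcd using hmem
  refine ⟨ULift t, @ULift.fintype _ ht.fintype, fun x => ⟨⟨c x, hc x⟩⟩, fun x y hxy => hf x x.2 y y.2 ?_⟩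
  have hxy' : c x = c y := congrArg (fun z : ULift t => (z.down : Fin m → ℂ)) hxy
  calc dist (f x) (f y) ≤ dist (f x) (c x) + dist (f y) (c x) := dist_triangle_right _ _ _
    _ < δ / 2 + δ / 2 := add_lt_add (hcd x) (hxy' ▸ hcd y)
    _ = δ := add_halves δ

/-! ### Rieffel's criterion: total boundedness of the Lipschitz ball and the weak* topology. -/

section MongeKantorovich

variable {A : Type u} [CStarAlgebra A]

lemma ofReal_norm_sub_le_mkDist {L : selfAdjoint A → ℝ≥0∞} (φ ψ : State A) {a : selfAdjoint A}
    (ha : L a ≤ 1) : ENNReal.ofReal ‖φ.1 (a : A) - ψ.1 (a : A)‖ ≤ mkDist L φ ψ :=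
  le_iSup₂ (f := fun (a : selfAdjoint A) (_ : L a ≤ 1) =>
    ENNReal.ofReal ‖φ.1 (a : A) - ψ.1 (a : A)‖) a ha

lemma mkDist_le_ofReal {L : selfAdjoint A → ℝ≥0∞} {φ ψ : State A} {r : ℝ}
    (h : ∀ a, L a ≤ 1 → ‖φ.1 (a : A) - ψ.1 (a : A)‖ ≤ r) : mkDist L φ ψ ≤ ENNReal.ofReal r :=
  iSup₂_le fun a ha => ENNReal.ofReal_le_ofReal (h a ha)

lemma State.apply_smul_one (φ : State A) (r : ℝ) :
    φ.1 ((r • (1 : selfAdjoint A) : selfAdjoint A) : A) = r := by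
  rw [selfAdjoint.val_smul, selfAdjoint.val_one, ← Complex.coe_smul, map_smul, φ.map_one]
  simp

/-- If the Monge-Kantorovich metric is finite and induces the weak* topology, then the elements
of the Lipschitz ball on which a given state vanishes form a totally bounded set. -/
theorem totallyBounded_lip_ball {L : selfAdjoint A → ℝ≥0∞}
    (hfin : ∀ φ ψ : State A, mkDist L φ ψ < ∞)
    (htop : (mkMetric L).toUniformSpace.toTopologicalSpace =
      (instTopologicalSpaceSubtype : TopologicalSpace (State A))) (μ : State A) :
    TotallyBounded {a : selfAdjoint A | L a ≤ 1 ∧ μ.1 (a : A) = 0} := by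
  rcases subsingleton_or_nontrivial A with _ | _
  · exact (Set.subsingleton_of_subsingleton).finite.totallyBounded
  refine totallyBounded_of_forall_exists_map fun ε hε => ?_
  -- By weak* compactness finitely many such balls cover the state space. Evaluation at their
  -- centers is the map to `ℂ^m`.
  have hU : ∀ φ : State A, {ψ | mkDist L ψ φ < ENNReal.ofReal (ε / 4)} ∈ 𝓝 φ := by
    intro φ
    rw [← htop]
    exact @Metric.eball_mem_nhds _ (mkMetric L) φ _ (by simpa using hε)
  obtain ⟨t, ht⟩ := CompactSpace.elim_nhds_subcover _ hU
  let e := t.equivFin.symm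
  refine ⟨t.card, fun a i => (e i : State A).1 (a : A), ?_, ε / 4, by positivity, ?_⟩
  -- Since `μ` vanishes on `a`, each coordinate is bounded by the finite distance from a center to
  -- `μ`.
  · rw [isBounded_iff_forall_norm_le]
    refine ⟨∑ i, (mkDist L (e i) μ).toReal, ?_⟩
    rintro _ ⟨a, ⟨ha, ha0⟩, rfl⟩
    refine (pi_norm_le_iff_of_nonneg (by positivity)).2 fun i => ?_
    have h1 := ofReal_norm_sub_le_mkDist (e i : State A) μ ha
    rw [ha0, sub_zero] at h1
    exact ((ENNReal.ofReal_le_iff_le_toReal (hfin _ _).ne).1 h1).trans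
      (Finset.single_le_sum (f := fun i => (mkDist L (e i : State A) μ).toReal)
        (fun i _ => ENNReal.toReal_nonneg) (Finset.mem_univ i))
  · rintro a ⟨ha, -⟩ b ⟨hb, -⟩ hab
    have hclose : ∀ {c : selfAdjoint A}, L c ≤ 1 → ∀ {φ ψ : State A},
        mkDist L φ ψ < ENNReal.ofReal (ε / 4) → ‖φ.1 (c : A) - ψ.1 (c : A)‖ < ε / 4 :=
      fun hc _ _ h => (ENNReal.ofReal_lt_ofReal_iff (by positivity)).1
        ((ofReal_norm_sub_le_mkDist _ _ hc).trans_lt h)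
    -- The norm of `a - b` is attained at a state `φ`; replacing `φ` by a nearby center costs `ε /
    -- 4` for each of `a` and `b`.
    obtain ⟨φ, hφ⟩ := State.exists_norm_apply_eq (a - b).2
    rw [dist_eq_norm]
    change ‖((a - b : selfAdjoint A) : A)‖ < ε
    rw [← hφ, AddSubgroup.coe_sub, map_sub]
    obtain ⟨χ, hχ, hφχ⟩ : ∃ χ ∈ t, mkDist L φ χ < ENNReal.ofReal (ε / 4) := by
      have : φ ∈ (⊤ : Set (State A)) := trivial
      rw [← ht] at this
      simpa using this
    have h1 := hclose ha hφχ
    have h2 := hclose hb hφχ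
    have h3 : ‖χ.1 (a : A) - χ.1 (b : A)‖ < ε / 4 := by
      have := (dist_pi_lt_iff (by positivity)).1 hab (t.equivFin ⟨χ, hχ⟩)
      simpa [e, dist_eq_norm] using this
    calc ‖φ.1 (a : A) - φ.1 (b : A)‖
        = ‖(φ.1 (a : A) - χ.1 (a : A)) + (χ.1 (a : A) - χ.1 (b : A))
            - (φ.1 (b : A) - χ.1 (b : A))‖ := by congr 1; ring
      _ ≤ ‖φ.1 (a : A) - χ.1 (a : A)‖ + ‖χ.1 (a : A) - χ.1 (b : A)‖
            + ‖φ.1 (b : A) - χ.1 (b : A)‖ := norm_sub_le_of_le (norm_add_le _ _) le_rfl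
      _ < ε := by linarith

variable {L : selfAdjoint A → ℝ≥0∞} {E : Set (selfAdjoint A)}

/-- If the Lipschitz ball is totally bounded modulo scalars, then the Monge-Kantorovich metric is
finite. -/
theorem mkDist_lt_top_of_totallyBounded (hE : TotallyBounded E)
    (hLE : ∀ a, L a ≤ 1 → ∃ r : ℝ, a - r • (1 : selfAdjoint A) ∈ E) (φ ψ : State A) :
    mkDist L φ ψ < ∞ := by
  obtain ⟨M, hM⟩ := isBounded_iff_forall_norm_le.1 hE.isBounded
  refine (mkDist_le_ofReal (r := M + M) fun a ha => ?_).trans_lt ENNReal.ofReal_lt_top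
  obtain ⟨r, hr⟩ := hLE a ha
  set e := a - r • (1 : selfAdjoint A) with he
  have ha' : a = r • (1 : selfAdjoint A) + e := by rw [he]; abel
  rw [ha', AddSubgroup.coe_add, map_add, map_add, φ.apply_smul_one, ψ.apply_smul_one,
    add_sub_add_left_eq_sub]
  exact (norm_sub_le _ _).trans
    (add_le_add ((φ.norm_apply_le e.2).trans (hM e hr)) ((ψ.norm_apply_le e.2).trans (hM e hr)))

/-- Scalars cancel in differences of states, so weak* closeness on a finite `ε/3`-net of `E`
controls the supremum over the whole Lipschitz ball. -/
lemma eventually_mkDist_le (hE : TotallyBounded E)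
    (hLE : ∀ a, L a ≤ 1 → ∃ r : ℝ, a - r • (1 : selfAdjoint A) ∈ E) (φ : State A) {ε : ℝ}
    (hε : 0 < ε) : ∀ᶠ ψ in 𝓝 φ, mkDist L ψ φ ≤ ENNReal.ofReal ε := by
  obtain ⟨t, ht, hEt⟩ := Metric.totallyBounded_iff.1 hE (ε / 3) (by positivity)
  have h : ∀ᶠ ψ : State A in 𝓝 φ, ∀ c ∈ t, ‖ψ.1 (c : A) - φ.1 (c : A)‖ < ε / 3 := by
    rw [eventually_all_finite ht]
    intro c _
    have hc : Continuous fun ψ : State A => ψ.1 (c : A) :=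
      (WeakDual.eval_continuous _).comp continuous_subtype_val
    have := Metric.tendsto_nhds.1 (hc.tendsto φ) (ε / 3) (by positivity)
    simpa [dist_eq_norm] using this
  filter_upwards [h] with ψ hψ
  refine mkDist_le_ofReal fun a ha => ?_
  obtain ⟨r, hr⟩ := hLE a ha
  set e := a - r • (1 : selfAdjoint A) with he
  have ha' : a = r • (1 : selfAdjoint A) + e := by rw [he]; abel
  rw [ha', AddSubgroup.coe_add, map_add, map_add, φ.apply_smul_one, ψ.apply_smul_one,
    add_sub_add_left_eq_sub]
  obtain ⟨c, hc, hec⟩ : ∃ c ∈ t, dist e c < ε / 3 := by simpa using hEt hr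
  rw [dist_eq_norm] at hec
  change ‖((e - c : selfAdjoint A) : A)‖ < _ at hec
  have h1 := (ψ.norm_apply_le (e - c).2).trans hec.le
  have h2 := (φ.norm_apply_le (e - c).2).trans hec.le
  have h3 := hψ c hc
  rw [AddSubgroup.coe_sub, map_sub] at h1 h2
  calc ‖ψ.1 (e : A) - φ.1 (e : A)‖
      = ‖(ψ.1 (e : A) - ψ.1 (c : A)) + (ψ.1 (c : A) - φ.1 (c : A))
          - (φ.1 (e : A) - φ.1 (c : A))‖ := by congr 1; ring
    _ ≤ ε / 3 + ε / 3 + ε / 3 := norm_sub_le_of_le (norm_add_le_of_le h1 h3.le) h2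
    _ = ε := by ring

/-- If the domain of the seminorm is dense and the Lipschitz ball is totally bounded modulo
scalars, then the Monge-Kantorovich metric induces the weak* topology. -/
theorem mkMetric_topology_of_totallyBounded
    (hsmul : ∀ (r : ℝ) a, L (r • a) = ENNReal.ofReal |r| * L a)
    (hdense : Dense {a | L a < ∞}) (hE : TotallyBounded E)
    (hLE : ∀ a, L a ≤ 1 → ∃ r : ℝ, a - r • (1 : selfAdjoint A) ∈ E) :
    (mkMetric L).toUniformSpace.toTopologicalSpace =
      (instTopologicalSpaceSubtype : TopologicalSpace (State A)) := by
  refine TopologicalSpace.ext_nhds fun φ => le_antisymm ?_ ?_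
  · rw [← tendsto_id']
    rw [nhds_subtype_eq_comap, tendsto_comap_iff]
    refine WeakBilin.tendsto_iff_forall_eval_tendsto _ ?_ |>.2 ?_
    · exact ContinuousLinearMap.coe_injective
    have hLip : ∀ b : selfAdjoint A, L b < ∞ → ∀ ε : ℝ, 0 < ε →
        ∀ᶠ ψ in @nhds _ (mkMetric L).toUniformSpace.toTopologicalSpace φ,
          ‖ψ.1 (b : A) - φ.1 (b : A)‖ < ε := by
      intro b hb ε hε
      -- Adding `1` keeps the rescaling meaningful when `L b = 0`.
      set l : ℝ := (L b).toReal + 1 with hl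
      have hl0 : 0 < l := by positivity
      filter_upwards [@Metric.eball_mem_nhds _ (mkMetric L) φ (ENNReal.ofReal (l⁻¹ * ε))
        (by simpa using by positivity)] with ψ hψ
      have hψ' : mkDist L ψ φ < ENNReal.ofReal (l⁻¹ * ε) := hψ
      have h1 : L (l⁻¹ • b) ≤ 1 := by
        rw [hsmul, abs_of_pos (by positivity), ENNReal.ofReal_inv_of_pos hl0, mul_comm,
          ← div_eq_mul_inv]
        refine ENNReal.div_le_of_le_mul ?_
        rw [one_mul, ← ENNReal.ofReal_toReal hb.ne]
        exact ENNReal.ofReal_le_ofReal (by linarith)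
      have h2 := (ENNReal.ofReal_lt_ofReal_iff (by positivity)).1
        ((ofReal_norm_sub_le_mkDist ψ φ h1).trans_lt hψ')
      rw [selfAdjoint.val_smul, ← Complex.coe_smul, map_smul, map_smul, ← smul_sub, norm_smul,
        Complex.norm_real, Real.norm_of_nonneg (by positivity)] at h2
      exact lt_of_mul_lt_mul_left h2 (by positivity)
    -- States are contractive on self-adjoint elements, so convergence passes from the dense domain
    -- to all of them.
    have hsa : ∀ a : selfAdjoint A, Tendsto (fun ψ : State A => ψ.1 (a : A))
        (@nhds _ (mkMetric L).toUniformSpace.toTopologicalSpace φ) (𝓝 (φ.1 (a : A))) := by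
      intro a
      rw [Metric.tendsto_nhds]
      intro ε hε
      obtain ⟨b, hab, hb⟩ := Metric.dense_iff.1 hdense a (ε / 3) (by positivity)
      filter_upwards [hLip b hb (ε / 3) (by positivity)] with ψ hψ
      rw [Metric.mem_ball, dist_eq_norm] at hab
      rw [dist_eq_norm]
      change ‖((b - a : selfAdjoint A) : A)‖ < _ at hab
      have h1 := (ψ.norm_apply_le (b - a).2).trans_lt hab
      have h2 := (φ.norm_apply_le (b - a).2).trans_lt hab
      rw [AddSubgroup.coe_sub, map_sub] at h1 h2
      calc ‖ψ.1 (a : A) - φ.1 (a : A)‖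
          = ‖(ψ.1 (b : A) - φ.1 (b : A)) - (ψ.1 (b : A) - ψ.1 (a : A))
              + (φ.1 (b : A) - φ.1 (a : A))‖ := by congr 1; ring
        _ ≤ _ := norm_add_le_of_le (norm_sub_le _ _) le_rfl
        _ < ε := by linarith
    intro a
    have := (hsa (ℜ a)).add ((hsa (ℑ a)).const_mul Complex.I)
    have hdec : ∀ ψ : State A, ψ.1 a = ψ.1 (ℜ a : A) + Complex.I * ψ.1 (ℑ a : A) := fun ψ => by
      conv_lhs => rw [← realPart_add_I_smul_imaginaryPart a, map_add, map_smul, smul_eq_mul]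
    simp only [← hdec] at this
    exact this
  · rw [(@Metric.nhds_basis_eball _ (mkMetric L) φ).ge_iff]
    intro δ hδ
    obtain ⟨ε, hε, hεδ⟩ : ∃ ε : ℝ, 0 < ε ∧ ENNReal.ofReal ε < δ := by
      obtain ⟨r, hr, hrδ⟩ := ENNReal.lt_iff_exists_nnreal_btwn.1 hδ
      exact ⟨r, by exact_mod_cast hr, by simpa using hrδ⟩
    filter_upwards [eventually_mkDist_le hE hLE φ hε] with ψ hψ
    exact hψ.trans_lt hεδ

end MongeKantorovich

/-! ### Perturbation and defect of the Jordan and Lie products. -/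

section Products

variable {A : Type u} [CStarAlgebra A]

/-- The factor `1/2` absorbs the two orders of multiplication, so the estimate has exact Leibniz
form with constant `1`; this is why `C` is not enlarged later. -/
lemma norm_jordan_sub_le (u v u' v' : A) :
    ‖jordan u v - jordan u' v'‖ ≤ ‖u‖ * ‖v - v'‖ + ‖u - u'‖ * ‖v'‖ := by
  have h : jordan u v - jordan u' v' = (2⁻¹ : ℂ) •
      ((u * (v - v') + (u - u') * v') + (v' * (u - u') + (v - v') * u)) := by
    rw [jordan, jordan, ← smul_sub]; congr 1; noncomm_ring
  rw [h, norm_smul]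
  have h1 := norm_add_le_of_le (norm_mul_le u (v - v')) (norm_mul_le (u - u') v')
  have h2 := norm_add_le_of_le (norm_mul_le v' (u - u')) (norm_mul_le (v - v') u)
  have h3 := norm_add_le_of_le h1 h2
  rw [norm_inv, Complex.norm_ofNat]
  linarith

lemma norm_lie_sub_le (u v u' v' : A) :
    ‖lie u v - lie u' v'‖ ≤ ‖u‖ * ‖v - v'‖ + ‖u - u'‖ * ‖v'‖ := by
  have h : lie u v - lie u' v' = ((2 * Complex.I)⁻¹ : ℂ) •
      ((u * (v - v') + (u - u') * v') - (v' * (u - u') + (v - v') * u)) := by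
    rw [lie, lie, ← smul_sub]; congr 1; noncomm_ring
  rw [h, norm_smul]
  have h1 := norm_add_le_of_le (norm_mul_le u (v - v')) (norm_mul_le (u - u') v')
  have h2 := norm_add_le_of_le (norm_mul_le v' (u - u')) (norm_mul_le (v - v') u)
  have h3 := norm_sub_le_of_le h1 h2
  rw [norm_inv, norm_mul, Complex.norm_ofNat, Complex.norm_I]
  linarith

variable {B : Type u} [CStarAlgebra B] (ψ : A →ₗ[ℂ] B)

/-- A unital linear map respects products with scalars, so only the Lipschitz parts contribute. The
defect is thus controlled by `L(a) L(b)` with no norms, as the `D` term requires. -/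
lemma jordan_defect (h1 : ψ 1 = 1) (r s l m : ℝ) (e f : A) :
    ψ (jordan (r • 1 + l • e) (s • 1 + m • f)) - jordan (ψ (r • 1 + l • e)) (ψ (s • 1 + m • f)) =
      (l * m) • (ψ (jordan e f) - jordan (ψ e) (ψ f)) := by
  simp only [jordan, map_add, map_smul, LinearMap.map_smul_of_tower, h1, mul_add, add_mul,
    smul_mul_assoc, mul_smul_comm, one_mul, mul_one, smul_add]
  module

lemma lie_defect (h1 : ψ 1 = 1) (r s l m : ℝ) (e f : A) :
    ψ (lie (r • 1 + l • e) (s • 1 + m • f)) - lie (ψ (r • 1 + l • e)) (ψ (s • 1 + m • f)) =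
      (l * m) • (ψ (lie e f) - lie (ψ e) (ψ f)) := by
  simp only [lie, map_add, map_sub, map_smul, LinearMap.map_smul_of_tower, h1, mul_add, add_mul,
    smul_mul_assoc, mul_smul_comm, one_mul, mul_one, smul_add, smul_sub]
  module

end Products

/-! ### Monotonicity in the constants and normalization modulo scalars. -/

section General

lemma isPermissible_cdFun {C : ℝ≥0} (hC : 1 ≤ C) (D : ℝ≥0) : IsPermissible (cdFun C D) where
  mono x x' y y' lx lx' ly ly' hx hy hlx hly := by unfold cdFun; gcongr
  leibniz_le x y lx ly := by
    unfold cdFun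
    calc x * ly + y * lx ≤ C * (x * ly + y * lx) := le_mul_of_one_le_left zero_le hC
      _ ≤ _ := le_self_add

lemma cdFun_le_cdFun {C C' D D' : ℝ≥0} (hC : C ≤ C') (hD : D ≤ D') (x y lx ly : ℝ≥0) :
    cdFun C D x y lx ly ≤ cdFun C' D' x y lx ly := by
  unfold cdFun; gcongr

lemma leibnizFun_eq_cdFun : leibnizFun = cdFun 1 0 := by
  funext x y lx ly; simp [leibnizFun, cdFun]

lemma IsQuasiLeibnizQCMS.mono {F G : ℝ≥0 → ℝ≥0 → ℝ≥0 → ℝ≥0 → ℝ≥0} {X : CStarPair.{u}}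
    (h : IsQuasiLeibnizQCMS F X) (hG : IsPermissible G)
    (hFG : ∀ x y lx ly, F x y lx ly ≤ G x y lx ly) : IsQuasiLeibnizQCMS G X :=
  { h with
    permissible := hG
    lip_jordan := fun a b ha hb => (h.lip_jordan a b ha hb).trans (by exact_mod_cast hFG _ _ _ _)
    lip_lie := fun a b ha hb => (h.lip_lie a b ha hb).trans (by exact_mod_cast hFG _ _ _ _) }

lemma IsCDQuasiLeibnizQCMS.mono {C C' D D' : ℝ≥0} {X : CStarPair.{u}} (hC : 1 ≤ C)
    (h : IsCDQuasiLeibnizQCMS C D X) (hC' : C ≤ C') (hD : D ≤ D') :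
    IsCDQuasiLeibnizQCMS C' D' X :=
  IsQuasiLeibnizQCMS.mono h (isPermissible_cdFun (hC.trans hC') D') (cdFun_le_cdFun hC' hD)

namespace IsQuasiLeibnizQCMS

variable {F : ℝ≥0 → ℝ≥0 → ℝ≥0 → ℝ≥0 → ℝ≥0} {X : CStarPair.{u}}

lemma lip_zero (h : IsQuasiLeibnizQCMS F X) : X.lip 0 = 0 :=
  (h.lip_eq_zero 0).2 ⟨0, by simp⟩

lemma lip_smul_one (h : IsQuasiLeibnizQCMS F X) (r : ℝ) :
    X.lip (r • (1 : selfAdjoint X)) = 0 :=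
  (h.lip_eq_zero _).2 ⟨r, rfl⟩

/-- Every element of the domain is, up to a scalar, a multiple of an element of the Lipschitz ball
on which a given state vanishes. -/
lemma exists_eq_smul_one_add (h : IsQuasiLeibnizQCMS F X) (μ : State X) {a : selfAdjoint X}
    (ha : X.lip a < ∞) : ∃ (r : ℝ) (e : selfAdjoint X), (X.lip e ≤ 1 ∧ μ.1 (e : X) = 0) ∧
      a = r • (1 : selfAdjoint X) + (X.lip a).toReal • e := by
  rcases eq_or_ne (X.lip a) 0 with h0 | h0
  · obtain ⟨r, hr⟩ := (h.lip_eq_zero a).1 h0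
    exact ⟨r, 0, ⟨by simp [h.lip_zero], by simp⟩, by simpa using hr⟩
  · have hl : 0 < (X.lip a).toReal := ENNReal.toReal_pos h0 ha.ne
    refine ⟨(μ.1 (a : X)).re,
      (X.lip a).toReal⁻¹ • (a + (-(μ.1 (a : X)).re) • (1 : selfAdjoint X)), ⟨?_, ?_⟩, ?_⟩
    · rw [h.lip_smul, abs_of_pos (by positivity), ENNReal.ofReal_inv_of_pos hl,
        ENNReal.ofReal_toReal ha.ne]
      calc (X.lip a)⁻¹ * X.lip (a + (-(μ.1 (a : X)).re) • (1 : selfAdjoint X))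
          ≤ (X.lip a)⁻¹ * (X.lip a + 0) := by
            gcongr
            exact (h.lip_add _ _).trans (by rw [h.lip_smul_one])
        _ ≤ 1 := by rw [add_zero, ENNReal.inv_mul_cancel h0 ha.ne]
    · rw [selfAdjoint.val_smul, ← Complex.coe_smul, map_smul, AddSubgroup.coe_add, map_add,
        μ.apply_smul_one]
      push_cast
      rw [μ.coe_re_apply a.2]
      simp
    · rw [smul_inv_smul₀ hl.ne', neg_smul]; abel

end IsQuasiLeibnizQCMS

end General

/-! ### The seminorm on the product `X × B`. -/

section SelfAdjointProd

variable {A B : Type u} [CStarAlgebra A] [CStarAlgebra B]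

/-- The first component of a self-adjoint element of a product. -/
def saFst (d : selfAdjoint (A × B)) : selfAdjoint A := ⟨d.1.1, congrArg Prod.fst d.2⟩

/-- The second component of a self-adjoint element of a product. -/
def saSnd (d : selfAdjoint (A × B)) : selfAdjoint B := ⟨d.1.2, congrArg Prod.snd d.2⟩

/-- The self-adjoint element of a product with given components. -/
def saPair (a : selfAdjoint A) (b : selfAdjoint B) : selfAdjoint (A × B) :=
  ⟨(a, b), Prod.ext a.2 b.2⟩

@[simp] lemma saFst_pair (a : selfAdjoint A) (b : selfAdjoint B) : saFst (saPair a b) = a := rfl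
@[simp] lemma saSnd_pair (a : selfAdjoint A) (b : selfAdjoint B) : saSnd (saPair a b) = b := rfl
@[simp] lemma saPair_eta (d : selfAdjoint (A × B)) : saPair (saFst d) (saSnd d) = d := rfl
lemma saFst_add (d e : selfAdjoint (A × B)) : saFst (d + e) = saFst d + saFst e := rfl
lemma saSnd_add (d e : selfAdjoint (A × B)) : saSnd (d + e) = saSnd d + saSnd e := rfl
lemma saFst_smul (r : ℝ) (d : selfAdjoint (A × B)) : saFst (r • d) = r • saFst d := rfl
lemma saSnd_smul (r : ℝ) (d : selfAdjoint (A × B)) : saSnd (r • d) = r • saSnd d := rfl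
lemma saFst_one : saFst (1 : selfAdjoint (A × B)) = 1 := rfl
lemma saSnd_one : saSnd (1 : selfAdjoint (A × B)) = 1 := rfl

lemma nnnorm_saFst_le (d : selfAdjoint (A × B)) : ‖(saFst d : A)‖₊ ≤ ‖(d : A × B)‖₊ :=
  norm_fst_le (d : A × B)

lemma nnnorm_saSnd_le (d : selfAdjoint (A × B)) : ‖(saSnd d : B)‖₊ ≤ ‖(d : A × B)‖₊ :=
  norm_snd_le (d : A × B)

lemma continuous_saFst : Continuous (saFst : selfAdjoint (A × B) → selfAdjoint A) :=
  (continuous_fst.comp continuous_subtype_val).subtype_mk _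

lemma continuous_saSnd : Continuous (saSnd : selfAdjoint (A × B) → selfAdjoint B) :=
  (continuous_snd.comp continuous_subtype_val).subtype_mk _

lemma isometry_saPair :
    Isometry fun p : selfAdjoint A × selfAdjoint B => saPair p.1 p.2 :=
  Isometry.of_dist_eq fun _ _ => rfl

end SelfAdjointProd

section TunnelSeminorm

variable {A B : Type u} [CStarAlgebra A] [CStarAlgebra B]

/-- The seminorm `max (L a) (δ⁻¹ ‖ψ a - b‖)` on the self-adjoint part of `A × B`. -/
def tunnelLip (L : selfAdjoint A → ℝ≥0∞) (ψ : A →ₗ[ℂ] B) (δ : ℝ) (d : selfAdjoint (A × B)) :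
    ℝ≥0∞ :=
  max (L (saFst d)) (ENNReal.ofReal (δ⁻¹ * ‖ψ (saFst d : A) - (saSnd d : B)‖))

/-- The quotient seminorm of `tunnelLip` on the second factor. -/
def quotientLip (L : selfAdjoint A → ℝ≥0∞) (ψ : A →ₗ[ℂ] B) (δ : ℝ) (b : selfAdjoint B) : ℝ≥0∞ :=
  ⨅ (d : selfAdjoint (A × B)) (_ : (d : A × B).2 = (b : B)), tunnelLip L ψ δ d

variable {L : selfAdjoint A → ℝ≥0∞} {ψ : A →ₗ[ℂ] B} {δ : ℝ}

lemma tunnelLip_le_iff (hδ : 0 < δ) {d : selfAdjoint (A × B)} {l : ℝ≥0} :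
    tunnelLip L ψ δ d ≤ l ↔ L (saFst d) ≤ l ∧ ‖ψ (saFst d : A) - (saSnd d : B)‖ ≤ δ * l := by
  rw [tunnelLip, max_le_iff, ENNReal.ofReal_le_iff_le_toReal ENNReal.coe_ne_top, inv_mul_le_iff₀ hδ,
    ENNReal.coe_toReal]

lemma lip_le_tunnelLip (d : selfAdjoint (A × B)) : L (saFst d) ≤ tunnelLip L ψ δ d :=
  le_max_left _ _

lemma tunnelLip_lt_top_iff {d : selfAdjoint (A × B)} :
    tunnelLip L ψ δ d < ∞ ↔ L (saFst d) < ∞ := by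
  simp [tunnelLip]

lemma norm_sub_le_tunnelLip (hδ : 0 < δ) {d : selfAdjoint (A × B)} (hd : tunnelLip L ψ δ d < ∞) :
    ‖ψ (saFst d : A) - (saSnd d : B)‖ ≤ δ * (tunnelLip L ψ δ d).toReal :=
  ((tunnelLip_le_iff (l := (tunnelLip L ψ δ d).toNNReal) hδ).1 (ENNReal.coe_toNNReal hd.ne).ge).2

lemma tunnelLip_add (hδ : 0 < δ) (hL : ∀ a b, L (a + b) ≤ L a + L b) (d e : selfAdjoint (A × B)) :
    tunnelLip L ψ δ (d + e) ≤ tunnelLip L ψ δ d + tunnelLip L ψ δ e := by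
  refine max_le ((hL _ _).trans (add_le_add (le_max_left _ _) (le_max_left _ _)))
    (le_trans ?_ (add_le_add (le_max_right _ _) (le_max_right _ _)))
  rw [← ENNReal.ofReal_add (by positivity) (by positivity), ← mul_add]
  refine ENNReal.ofReal_le_ofReal (mul_le_mul_of_nonneg_left ?_ (by positivity))
  rw [saFst_add, saSnd_add, AddSubgroup.coe_add, AddSubgroup.coe_add, map_add, add_sub_add_comm]
  exact norm_add_le _ _

lemma tunnelLip_smul (hL : ∀ (r : ℝ) a, L (r • a) = ENNReal.ofReal |r| * L a) (r : ℝ)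
    (d : selfAdjoint (A × B)) :
    tunnelLip L ψ δ (r • d) = ENNReal.ofReal |r| * tunnelLip L ψ δ d := by
  rw [tunnelLip, tunnelLip, saFst_smul, saSnd_smul, hL, selfAdjoint.val_smul, selfAdjoint.val_smul,
    LinearMap.map_smul_of_tower, ← smul_sub, norm_smul, Real.norm_eq_abs, mul_left_comm,
    ENNReal.ofReal_mul (abs_nonneg r), mul_max]

lemma isClosed_tunnelLip_ball (hδ : 0 < δ) (hψ : Continuous ψ) (hL : IsClosed {a | L a ≤ 1}) :
    IsClosed {d : selfAdjoint (A × B) | tunnelLip L ψ δ d ≤ 1} := by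
  have : {d : selfAdjoint (A × B) | tunnelLip L ψ δ d ≤ 1} = saFst ⁻¹' {a | L a ≤ 1} ∩
      {d | ‖ψ (saFst d : A) - (saSnd d : B)‖ ≤ δ} := by
    ext d
    have := tunnelLip_le_iff (L := L) (ψ := ψ) hδ (d := d) (l := 1)
    simpa using this
  rw [this]
  refine (hL.preimage continuous_saFst).inter (isClosed_le ?_ continuous_const)
  exact ((hψ.comp (continuous_subtype_val.comp continuous_saFst)).sub
    (continuous_subtype_val.comp continuous_saSnd)).norm

lemma dense_tunnelLip_lt_top (hL : Dense {a | L a < ∞}) :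
    Dense {d : selfAdjoint (A × B) | tunnelLip L ψ δ d < ∞} := by
  rw [Metric.dense_iff]
  intro d r hr
  obtain ⟨a, ha, haL⟩ := Metric.dense_iff.1 hL (saFst d) r hr
  refine ⟨saPair a (saSnd d), ?_, tunnelLip_lt_top_iff.2 haL⟩
  have : dist (saPair a (saSnd d)) d = max (dist a (saFst d)) (dist (saSnd d) (saSnd d)) := rfl
  rw [Metric.mem_ball, this, dist_self]
  exact max_lt ha hr

lemma tunnelLip_eq_zero_iff (hδ : 0 < δ) (hψ1 : ψ 1 = 1)
    (hL : ∀ a, L a = 0 ↔ ∃ r : ℝ, a = r • (1 : selfAdjoint A)) (d : selfAdjoint (A × B)) :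
    tunnelLip L ψ δ d = 0 ↔ ∃ r : ℝ, d = r • (1 : selfAdjoint (A × B)) := by
  have h := tunnelLip_le_iff (L := L) (ψ := ψ) hδ (d := d) (l := 0)
  simp only [ENNReal.coe_zero, nonpos_iff_eq_zero, NNReal.coe_zero, mul_zero, norm_le_zero_iff,
    sub_eq_zero] at h
  rw [h]
  constructor
  · rintro ⟨h1, h2⟩
    obtain ⟨r, hr⟩ := (hL _).1 h1
    refine ⟨r, ?_⟩
    rw [← saPair_eta d]
    refine Subtype.ext (Prod.ext (congrArg Subtype.val hr) ?_)
    change (saSnd d : B) = _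
    rw [← h2, hr, selfAdjoint.val_smul, selfAdjoint.val_one, LinearMap.map_smul_of_tower, hψ1]
    rfl
  · rintro ⟨r, rfl⟩
    refine ⟨(hL _).2 ⟨r, rfl⟩, ?_⟩
    rw [saFst_smul, saSnd_smul, saFst_one, saSnd_one, selfAdjoint.val_smul, selfAdjoint.val_smul,
      selfAdjoint.val_one, selfAdjoint.val_one, LinearMap.map_smul_of_tower, hψ1]

/-- The estimate behind the quasi-Leibniz inequality for `tunnelLip`. -/
lemma norm_sub_le_cdFun {x y z : B} {C D η : ℝ≥0} (hC : 1 ≤ C) (hδ : 0 < δ)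
    {na npa nb' e e' : ℝ} {X Y l l' m m' : ℝ≥0}
    (hxy : ‖x - y‖ ≤ η * δ * m * m') (hyz : ‖y - z‖ ≤ npa * e' + e * nb')
    (hm : m ≤ l) (hm' : m' ≤ l') (he : e ≤ δ * l) (he' : e' ≤ δ * l') (hpa : npa ≤ na)
    (hpa0 : 0 ≤ npa) (hb0 : 0 ≤ nb') (ha : na ≤ X) (hb' : nb' ≤ Y) :
    ‖x - z‖ ≤ δ * (cdFun C (D + η) X Y l l' : ℝ≥0) := by
  -- In use, `x` is `ψ` of a product, `y` the product of the images under `ψ`, and `z` the product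
  -- of the second components. The gap from `x` to `y` produces `η`, the gap from `y` to `z` the
  -- Leibniz term.
  have h1 : npa * e' ≤ X * (δ * l') := by
    calc npa * e' ≤ npa * (δ * l') := by gcongr
      _ ≤ X * (δ * l') := by gcongr; linarith
  have h2 : e * nb' ≤ δ * l * Y := by
    calc e * nb' ≤ δ * l * nb' := by gcongr
      _ ≤ _ := by gcongr
  have h3 : (η : ℝ) * δ * m * m' ≤ η * δ * l * l' := by gcongr
  have h4 : (X : ℝ) * l' + Y * l ≤ C * (X * l' + Y * l) :=
    le_mul_of_one_le_left (by positivity) (by exact_mod_cast hC)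
  have h5 : (0 : ℝ) ≤ D * l * l' := by positivity
  have h6 : ‖x - z‖ ≤ ‖x - y‖ + ‖y - z‖ := norm_sub_le_norm_sub_add_norm_sub _ _ _
  unfold cdFun
  push_cast
  have h7 : δ * ((X : ℝ) * l' + Y * l) ≤ δ * (C * (X * l' + Y * l)) := by gcongr
  have h8 : 0 ≤ δ * ((D : ℝ) * l * l') := by positivity
  nlinarith

end TunnelSeminorm

/-- Unital positive maps `ψ : X → B`, `φ : B → X` with `φ ∘ ψ` close to the identity and `ψ` close to
a Jordan-Lie morphism, relative to the seminorm of `X`. -/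
structure IsApproxFactorization (X : CStarPair.{u}) {B : Type u} [CStarAlgebra B]
    (φ : B →ₗ[ℂ] X) (ψ : X →ₗ[ℂ] B) (δ : ℝ) (η : ℝ≥0) : Prop where
  pos_left : IsPositiveMap φ
  one_left : φ 1 = 1
  pos_right : IsPositiveMap ψ
  one_right : ψ 1 = 1
  norm_sub_le : ∀ a : selfAdjoint X, X.lip a < ∞ → ‖(a : X) - φ (ψ a)‖ ≤ δ * (X.lip a).toReal
  jordan_le : ∀ a b : selfAdjoint X, X.lip a < ∞ → X.lip b < ∞ →
    ‖ψ (jordan (a : X) b) - jordan (ψ a) (ψ b)‖ ≤ η * δ * (X.lip a).toReal * (X.lip b).toReal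
  lie_le : ∀ a b : selfAdjoint X, X.lip a < ∞ → X.lip b < ∞ →
    ‖ψ (lie (a : X) b) - lie (ψ a) (ψ b)‖ ≤ η * δ * (X.lip a).toReal * (X.lip b).toReal

lemma totallyBounded_prod {α β : Type*} [PseudoMetricSpace α] [PseudoMetricSpace β] {s : Set α}
    {t : Set β} (hs : TotallyBounded s) (ht : TotallyBounded t) : TotallyBounded (s ×ˢ t) := by
  rw [Metric.totallyBounded_iff] at *
  intro ε hε
  obtain ⟨u, hu, hsu⟩ := hs ε hε
  obtain ⟨v, hv, htv⟩ := ht ε hε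
  refine ⟨u ×ˢ v, hu.prod hv, fun p hp => ?_⟩
  obtain ⟨x, hx, hpx⟩ := Set.mem_iUnion₂.1 (hsu hp.1)
  obtain ⟨y, hy, hpy⟩ := Set.mem_iUnion₂.1 (htv hp.2)
  exact Set.mem_iUnion₂.2 ⟨(x, y), ⟨hx, hy⟩, Metric.mem_ball.2 (max_lt hpx hpy)⟩

namespace IsApproxFactorization

variable {X : CStarPair.{u}} {B : Type u} [CStarAlgebra B] {φ : B →ₗ[ℂ] X} {ψ : X →ₗ[ℂ] B}
  {δ : ℝ} {η : ℝ≥0} {C D : ℝ≥0}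

lemma totallyBounded_closedBall [FiniteDimensional ℂ B] (R : ℝ) :
    TotallyBounded (Metric.closedBall (0 : selfAdjoint B) R) := by
  have : ProperSpace B := FiniteDimensional.proper ℂ B
  have h := (isCompact_closedBall (0 : B) R).totallyBounded
  exact totallyBounded_preimage (f := ((↑) : selfAdjoint B → B))
    isUniformEmbedding_subtype_val.isUniformInducing h

lemma exists_norm_le (hX : IsCDQuasiLeibnizQCMS C D X) (μ : State X) :
    ∃ M : ℝ, 0 ≤ M ∧ ∀ e : selfAdjoint X, X.lip e ≤ 1 ∧ μ.1 (e : X) = 0 → ‖e‖ ≤ M := by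
  obtain ⟨M, hM⟩ := isBounded_iff_forall_norm_le.1
    (totallyBounded_lip_ball hX.mk_finite hX.mk_topology μ).isBounded
  exact ⟨M, (norm_nonneg _).trans (hM 0 ⟨by simp [hX.lip_zero], by simp⟩), fun e he => hM e he⟩

/-- An element with `L a < l` is, up to a scalar, of norm at most `M l`. -/
lemma exists_norm_sub_smul_one_le (hX : IsCDQuasiLeibnizQCMS C D X) (μ : State X) :
    ∃ M : ℝ, 0 ≤ M ∧ ∀ (a : selfAdjoint X) (l : ℝ≥0), X.lip a ≤ l →
      ∃ r : ℝ, ‖a - r • (1 : selfAdjoint X)‖ ≤ M * l := by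
  obtain ⟨M, hM0, hM⟩ := exists_norm_le hX μ
  refine ⟨M, hM0, fun a l hl => ?_⟩
  have hlt : X.lip a < ∞ := hl.trans_lt ENNReal.coe_lt_top
  obtain ⟨r, e, he, hae⟩ := hX.exists_eq_smul_one_add μ hlt
  refine ⟨r, ?_⟩
  have h1 : a - r • (1 : selfAdjoint X) = (X.lip a).toReal • e := by
    nth_rw 1 [hae]; abel
  rw [h1, norm_smul, Real.norm_of_nonneg ENNReal.toReal_nonneg, mul_comm]
  have h2 : (X.lip a).toReal ≤ l := ENNReal.toReal_le_coe_of_le_coe hl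
  gcongr
  exact hM e he

variable [FiniteDimensional ℂ B]

/-- The weight `δ⁻¹` turns the defect `η δ l l'` of `ψ` into `η l l'`, so only `D` grows. For the
topology, the Lipschitz ball modulo scalars lies in the product of a totally bounded set with a ball
of the finite dimensional `B`. -/
lemma isCD_tunnel (h : IsApproxFactorization X φ ψ δ η) (hδ : 0 < δ) (hC : 1 ≤ C)
    (hX : IsCDQuasiLeibnizQCMS C D X) (μ : State X) :
    IsCDQuasiLeibnizQCMS C (D + η) ⟨X × B, tunnelLip X.lip ψ δ⟩ := by
  have hadd := tunnelLip_add (ψ := ψ) hδ hX.lip_add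
  have hsmul := tunnelLip_smul (ψ := ψ) (δ := δ) hX.lip_smul
  have hdense := dense_tunnelLip_lt_top (ψ := ψ) (δ := δ) hX.dense_domain
  obtain ⟨M, hM0, hM⟩ := exists_norm_le hX μ
  have hE := TotallyBounded.image
    (totallyBounded_prod (totallyBounded_lip_ball hX.mk_finite hX.mk_topology μ)
      (totallyBounded_closedBall (B := B) (M + δ))) isometry_saPair.uniformContinuous
  have hLE : ∀ d : selfAdjoint (X × B), tunnelLip X.lip ψ δ d ≤ 1 →
      ∃ r : ℝ, d - r • (1 : selfAdjoint (X × B)) ∈ (fun p : selfAdjoint X × selfAdjoint B =>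
        saPair p.1 p.2) '' ({a : selfAdjoint X | X.lip a ≤ 1 ∧ μ.1 (a : X) = 0} ×ˢ
          Metric.closedBall (0 : selfAdjoint B) (M + δ)) := by
    intro d hd
    have hd' := (tunnelLip_le_iff (l := 1) hδ).1 (by simpa using hd)
    have ha1 : X.lip (saFst d) ≤ 1 := by simpa using hd'.1
    set r : ℝ := (μ.1 (saFst d : X)).re with hr
    have hmem : saFst d - r • 1 ∈ {a : selfAdjoint X | X.lip a ≤ 1 ∧ μ.1 (a : X) = 0} := by
      refine ⟨?_, ?_⟩
      · rw [sub_eq_add_neg, ← neg_smul]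
        refine (hX.lip_add _ _).trans ?_
        rwa [hX.lip_smul_one, add_zero]
      · rw [AddSubgroup.coe_sub, map_sub, μ.apply_smul_one, hr, μ.coe_re_apply (saFst d).2, sub_self]
    refine ⟨r, (saFst d - r • 1, saSnd d - r • 1), ⟨hmem, ?_⟩, rfl⟩
    -- The radius `M + δ`: `ψ (a - r)` has norm at most `M`, and `b - r` is within `δ` of it.
    rw [mem_closedBall_zero_iff]
    have h1 := h.pos_right.norm_le_of_map_one h.one_right (saFst d - r • 1).2
    have h2 := hd'.2
    have h3 : ((saSnd d - r • 1 : selfAdjoint B) : B) =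
        ψ ((saFst d - r • 1 : selfAdjoint X) : X) - (ψ (saFst d : X) - (saSnd d : B)) := by
      change (saSnd d : B) - r • (1 : B) = ψ ((saFst d : X) - r • (1 : X)) - _
      rw [map_sub, LinearMap.map_smul_of_tower, h.one_right]
      abel
    change ‖((saSnd d - r • 1 : selfAdjoint B) : B)‖ ≤ _
    rw [h3]
    refine norm_sub_le_of_le (h1.trans (hM _ hmem)) ?_
    simpa using h2
  -- Common to both products: `a` and `b` are the componentwise products, and `p` is the product of
  -- the images under `ψ` of the first components.
  have key : ∀ d d' : selfAdjoint (X × B), tunnelLip X.lip ψ δ d < ∞ → tunnelLip X.lip ψ δ d' < ∞ →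
      ∀ (a : selfAdjoint X) (b : selfAdjoint B) (p : B),
      X.lip a ≤ cdFun C D ‖(saFst d : X)‖₊ ‖(saFst d' : X)‖₊ (X.lip (saFst d)).toNNReal
        (X.lip (saFst d')).toNNReal →
      ‖ψ a - p‖ ≤ η * δ * (X.lip (saFst d)).toReal * (X.lip (saFst d')).toReal →
      ‖p - b‖ ≤ ‖ψ (saFst d : X)‖ * ‖ψ (saFst d' : X) - (saSnd d' : B)‖ +
        ‖ψ (saFst d : X) - (saSnd d : B)‖ * ‖(saSnd d' : B)‖ →
      tunnelLip X.lip ψ δ (saPair a b) ≤ cdFun C (D + η) ‖(d : X × B)‖₊ ‖(d' : X × B)‖₊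
        (tunnelLip X.lip ψ δ d).toNNReal (tunnelLip X.lip ψ δ d').toNNReal := by
    intro d d' hd hd' a b p h1 h2 h3
    have hl : (X.lip (saFst d)).toNNReal ≤ (tunnelLip X.lip ψ δ d).toNNReal :=
      ENNReal.toNNReal_mono hd.ne (lip_le_tunnelLip d)
    have hl' : (X.lip (saFst d')).toNNReal ≤ (tunnelLip X.lip ψ δ d').toNNReal :=
      ENNReal.toNNReal_mono hd'.ne (lip_le_tunnelLip d')
    have hn := nnnorm_saFst_le d
    have hn' := nnnorm_saFst_le d'
    have hs := nnnorm_saSnd_le d'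
    refine (tunnelLip_le_iff hδ).2 ⟨h1.trans ?_, ?_⟩
    · exact ENNReal.coe_le_coe.2 (((isPermissible_cdFun hC D).mono hn hn'
        hl hl').trans (cdFun_le_cdFun le_rfl le_self_add _ _ _ _))
    · exact norm_sub_le_cdFun hC hδ h2 h3 hl hl' (norm_sub_le_tunnelLip hδ hd)
        (norm_sub_le_tunnelLip hδ hd') (h.pos_right.norm_le_of_map_one h.one_right (saFst d).2)
        (norm_nonneg _) (norm_nonneg _) hn hs
  have hlt : ∀ {d : selfAdjoint (X × B)}, tunnelLip X.lip ψ δ d < ∞ → X.lip (saFst d) < ∞ :=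
    tunnelLip_lt_top_iff.1
  exact
    { permissible := isPermissible_cdFun hC _
      lip_add := hadd
      lip_smul := hsmul
      dense_domain := hdense
      lip_eq_zero := tunnelLip_eq_zero_iff hδ h.one_right hX.lip_eq_zero
      closed_ball := isClosed_tunnelLip_ball hδ h.pos_right.continuous hX.closed_ball
      mk_finite := mkDist_lt_top_of_totallyBounded hE hLE
      mk_topology := mkMetric_topology_of_totallyBounded hsmul hdense hE hLE
      lip_jordan := fun d d' hd hd' => key d d' hd hd' (saJordan (saFst d) (saFst d'))
        (saJordan (saSnd d) (saSnd d')) _ (hX.lip_jordan _ _ (hlt hd) (hlt hd'))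
        (h.jordan_le _ _ (hlt hd) (hlt hd')) (norm_jordan_sub_le _ _ _ _)
      lip_lie := fun d d' hd hd' => key d d' hd hd' (saLie (saFst d) (saFst d'))
        (saLie (saSnd d) (saSnd d')) _ (hX.lip_lie _ _ (hlt hd) (hlt hd'))
        (h.lie_le _ _ (hlt hd) (hlt hd')) (norm_lie_sub_le _ _ _ _) }

end IsApproxFactorization

/-! ### The quotient seminorm on the finite dimensional algebra. -/

section QuotientSeminorm

variable {A B : Type u} [CStarAlgebra A] [CStarAlgebra B] {L : selfAdjoint A → ℝ≥0∞}
  {ψ : A →ₗ[ℂ] B} {δ : ℝ}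

lemma quotientLip_le (a : selfAdjoint A) (b : selfAdjoint B) :
    quotientLip L ψ δ b ≤ tunnelLip L ψ δ (saPair a b) :=
  iInf₂_le (f := fun (d : selfAdjoint (A × B)) (_ : (d : A × B).2 = (b : B)) =>
    tunnelLip L ψ δ d) (saPair a b) rfl

lemma exists_tunnelLip_lt {b : selfAdjoint B} {l : ℝ≥0∞} (h : quotientLip L ψ δ b < l) :
    ∃ a : selfAdjoint A, tunnelLip L ψ δ (saPair a b) < l := by
  obtain ⟨d, hd, hl⟩ := by simpa only [quotientLip, iInf_lt_iff] using h
  refine ⟨saFst d, ?_⟩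
  have : saSnd d = b := Subtype.ext hd
  rwa [← this, saPair_eta]

/-- The lift `(0, b)` suffices. The quotient seminorm is therefore finite everywhere and norm
continuous, whence its closed unit ball. -/
lemma quotientLip_le_norm (hL : L 0 = 0) (b : selfAdjoint B) :
    quotientLip L ψ δ b ≤ ENNReal.ofReal (δ⁻¹ * ‖b‖) := by
  refine (quotientLip_le 0 b).trans (max_le (by simp [hL]) ?_)
  simp

lemma quotientLip_lt_top (hL : L 0 = 0) (b : selfAdjoint B) : quotientLip L ψ δ b < ∞ :=
  (quotientLip_le_norm hL b).trans_lt ENNReal.ofReal_lt_top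

lemma exists_tunnelLip_le_add (hL : L 0 = 0) (b : selfAdjoint B) {ε : ℝ≥0} (hε : 0 < ε) :
    ∃ a : selfAdjoint A, tunnelLip L ψ δ (saPair a b) ≤ quotientLip L ψ δ b + ε := by
  obtain ⟨a, ha⟩ := exists_tunnelLip_lt
    (ENNReal.lt_add_right (quotientLip_lt_top (ψ := ψ) (δ := δ) hL b).ne
      (ENNReal.coe_ne_zero.2 hε.ne'))
  exact ⟨a, ha.le⟩

lemma quotientLip_add (hδ : 0 < δ) (hL0 : L 0 = 0) (hL : ∀ a b, L (a + b) ≤ L a + L b)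
    (b c : selfAdjoint B) :
    quotientLip L ψ δ (b + c) ≤ quotientLip L ψ δ b + quotientLip L ψ δ c := by
  refine ENNReal.le_of_forall_pos_le_add fun ε hε _ => ?_
  obtain ⟨a, ha⟩ := exists_tunnelLip_le_add (ψ := ψ) (δ := δ) hL0 b (half_pos hε)
  obtain ⟨a', ha'⟩ := exists_tunnelLip_le_add (ψ := ψ) (δ := δ) hL0 c (half_pos hε)
  calc quotientLip L ψ δ (b + c) ≤ tunnelLip L ψ δ (saPair (a + a') (b + c)) := quotientLip_le _ _
    _ ≤ tunnelLip L ψ δ (saPair a b) + tunnelLip L ψ δ (saPair a' c) := tunnelLip_add hδ hL _ _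
    _ ≤ (quotientLip L ψ δ b + (ε / 2 : ℝ≥0)) + (quotientLip L ψ δ c + (ε / 2 : ℝ≥0)) :=
        add_le_add ha ha'
    _ = quotientLip L ψ δ b + quotientLip L ψ δ c + ((ε / 2 + ε / 2 : ℝ≥0) : ℝ≥0∞) := by
        push_cast; ring
    _ = _ := by rw [add_halves]

lemma quotientLip_smul (hL0 : L 0 = 0) (hL : ∀ (r : ℝ) a, L (r • a) = ENNReal.ofReal |r| * L a)
    (r : ℝ) (b : selfAdjoint B) :
    quotientLip L ψ δ (r • b) = ENNReal.ofReal |r| * quotientLip L ψ δ b := by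
  have hle : ∀ (r : ℝ) (b : selfAdjoint B), r ≠ 0 →
      quotientLip L ψ δ (r • b) ≤ ENNReal.ofReal |r| * quotientLip L ψ δ b := by
    intro r b hr
    have hr0 : ENNReal.ofReal |r| ≠ 0 := by simpa using hr
    rw [mul_comm, ← ENNReal.div_le_iff hr0 ENNReal.ofReal_ne_top]
    refine le_of_forall_gt fun l hl => ?_
    obtain ⟨a, ha⟩ := exists_tunnelLip_lt hl
    refine lt_of_le_of_lt ?_ ha
    rw [ENNReal.div_le_iff hr0 ENNReal.ofReal_ne_top, mul_comm, ← tunnelLip_smul hL]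
    exact quotientLip_le (r • a) (r • b)
  rcases eq_or_ne r 0 with rfl | hr
  · have := quotientLip_le_norm (ψ := ψ) (δ := δ) hL0 (0 : selfAdjoint B)
    simpa using this
  · refine le_antisymm (hle r b hr) ?_
    have := hle r⁻¹ (r • b) (inv_ne_zero hr)
    rw [inv_smul_smul₀ hr, abs_inv, ENNReal.ofReal_inv_of_pos (abs_pos.2 hr)] at this
    calc ENNReal.ofReal |r| * quotientLip L ψ δ b
        ≤ ENNReal.ofReal |r| * ((ENNReal.ofReal |r|)⁻¹ * quotientLip L ψ δ (r • b)) := by gcongr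
      _ = quotientLip L ψ δ (r • b) := by
        rw [← mul_assoc, ENNReal.mul_inv_cancel (by simpa using hr) ENNReal.ofReal_ne_top, one_mul]

lemma isClosed_quotientLip_ball (hδ : 0 < δ) (hL0 : L 0 = 0)
    (hL : ∀ a b, L (a + b) ≤ L a + L b) :
    IsClosed {b : selfAdjoint B | quotientLip L ψ δ b ≤ 1} := by
  refine isClosed_of_closure_subset fun b hb => ?_
  refine ENNReal.le_of_forall_pos_le_add fun ε hε _ => ?_
  obtain ⟨c, hc, hbc⟩ := Metric.mem_closure_iff.1 hb (δ * ε) (by positivity)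
  calc quotientLip L ψ δ b = quotientLip L ψ δ (c + (b - c)) := by rw [add_sub_cancel]
    _ ≤ quotientLip L ψ δ c + quotientLip L ψ δ (b - c) := quotientLip_add hδ hL0 hL _ _
    _ ≤ 1 + ENNReal.ofReal (δ⁻¹ * ‖b - c‖) := add_le_add hc (quotientLip_le_norm hL0 _)
    _ ≤ 1 + ε := by
      gcongr
      rw [ENNReal.ofReal_le_iff_le_toReal ENNReal.coe_ne_top, ENNReal.coe_toReal,
        inv_mul_le_iff₀ hδ, ← dist_eq_norm]
      exact hbc.le

end QuotientSeminorm

namespace IsApproxFactorization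

variable {X : CStarPair.{u}} {B : Type u} [CStarAlgebra B] {φ : B →ₗ[ℂ] X} {ψ : X →ₗ[ℂ] B}
  {δ : ℝ} {η : ℝ≥0} {C D : ℝ≥0}

/-- Write `a - φ b = (a - φ (ψ a)) + φ (ψ a - b)`; each summand costs `δ l`. -/
lemma norm_sub_le' (h : IsApproxFactorization X φ ψ δ η) (hδ : 0 < δ) {d : selfAdjoint (X × B)}
    {l : ℝ≥0} (hd : tunnelLip X.lip ψ δ d ≤ l) :
    ‖(saFst d : X) - φ (saSnd d : B)‖ ≤ 2 * δ * l := by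
  obtain ⟨h1, h2⟩ := (tunnelLip_le_iff hδ).1 hd
  have h3 := h.norm_sub_le (saFst d) (h1.trans_lt ENNReal.coe_lt_top)
  have h4 := h.pos_left.norm_le_of_map_one h.one_left
    ((h.pos_right.isSelfAdjoint_map (saFst d).2).sub (saSnd d).2)
  rw [map_sub] at h4
  have h5 : (X.lip (saFst d)).toReal ≤ l := ENNReal.toReal_le_coe_of_le_coe h1
  have h6 : δ * (X.lip (saFst d)).toReal ≤ δ * l := by gcongr
  have := norm_sub_le_norm_sub_add_norm_sub (saFst d : X) (φ (ψ (saFst d : X))) (φ (saSnd d : B))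
  linarith

/-- Lifts with controlled seminorm have controlled norm, because `a` is near `φ b`. This is what
lets the quasi-Leibniz inequality descend to the quotient. -/
lemma nnnorm_le (h : IsApproxFactorization X φ ψ δ η) (hδ : 0 < δ) {a : selfAdjoint X}
    {b : selfAdjoint B} {l : ℝ≥0} (hd : tunnelLip X.lip ψ δ (saPair a b) ≤ l) :
    ‖((saPair a b : selfAdjoint (X × B)) : X × B)‖ ≤ ‖(b : B)‖ + 2 * δ * l := by
  have h1 := h.norm_sub_le' hδ hd
  rw [saFst_pair, saSnd_pair] at h1
  have h2 := h.pos_left.norm_le_of_map_one h.one_left b.2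
  have h3 := norm_le_norm_add_norm_sub' (a : X) (φ b)
  have h4 : 0 ≤ 2 * δ * l := by positivity
  refine max_le ?_ ?_
  · change ‖(a : X)‖ ≤ _
    linarith
  · change ‖(b : B)‖ ≤ _
    linarith

/-- For a lift `a` of `b`, `b - r = ψ (a - r) - (ψ a - b)`. The bound yields both total boundedness
modulo scalars and the kernel of the quotient seminorm. -/
lemma exists_norm_sub_smul_one_le_quotientLip (h : IsApproxFactorization X φ ψ δ η) (hδ : 0 < δ)
    (hX : IsCDQuasiLeibnizQCMS C D X) (μ : State X) :
    ∃ M : ℝ, 0 ≤ M ∧ ∀ (b : selfAdjoint B) (l : ℝ≥0), quotientLip X.lip ψ δ b < l →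
      ∃ r : ℝ, ‖b - r • (1 : selfAdjoint B)‖ ≤ M * l := by
  obtain ⟨M, hM0, hM⟩ := exists_norm_sub_smul_one_le hX μ
  refine ⟨M + δ, by positivity, fun b l hl => ?_⟩
  obtain ⟨a, ha⟩ := exists_tunnelLip_lt hl
  obtain ⟨h1, h2⟩ := (tunnelLip_le_iff hδ).1 ha.le
  obtain ⟨r, hr⟩ := hM a l h1
  refine ⟨r, ?_⟩
  have h3 := h.pos_right.norm_le_of_map_one h.one_right (a - r • 1).2
  have h4 : ((b - r • 1 : selfAdjoint B) : B) =
      ψ ((a - r • 1 : selfAdjoint X) : X) - (ψ (a : X) - (b : B)) := by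
    change (b : B) - r • (1 : B) = ψ ((a : X) - r • (1 : X)) - _
    rw [map_sub, LinearMap.map_smul_of_tower, h.one_right]
    abel
  change ‖((b - r • 1 : selfAdjoint B) : B)‖ ≤ _
  rw [h4, add_mul]
  exact norm_sub_le_of_le (h3.trans hr) h2

/-- Quotients of quasi-Leibniz seminorms are not quasi-Leibniz in general, since lifts may be large
in norm. Here the norms grow by at most `2δl` and `2δl'`, which adds `C (2δ l l' + 2δ l' l) = 4Cδ l
l'`. -/
lemma isCD_quotient [FiniteDimensional ℂ B] (h : IsApproxFactorization X φ ψ δ η) (hδ : 0 < δ) (hC : 1 ≤ C)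
    (hX : IsCDQuasiLeibnizQCMS C D X) (μ : State X) :
    IsCDQuasiLeibnizQCMS C (D + η + 4 * C * δ.toNNReal) ⟨B, quotientLip X.lip ψ δ⟩ := by
  have hT := h.isCD_tunnel hδ hC hX μ
  have hL0 := hX.lip_zero
  have hlt := quotientLip_lt_top (ψ := ψ) (δ := δ) hL0
  have hsmul := quotientLip_smul (ψ := ψ) (δ := δ) hL0 hX.lip_smul
  obtain ⟨M, hM0, hM⟩ := h.exists_norm_sub_smul_one_le_quotientLip hδ hX μ
  have hdense : Dense {b : selfAdjoint B | quotientLip X.lip ψ δ b < ∞} := by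
    rw [Set.eq_univ_of_forall (s := {b : selfAdjoint B | quotientLip X.lip ψ δ b < ∞}) hlt]
    exact dense_univ
  have hE := totallyBounded_closedBall (B := B) (M * 2)
  have hLE : ∀ b : selfAdjoint B, quotientLip X.lip ψ δ b ≤ 1 →
      ∃ r : ℝ, b - r • (1 : selfAdjoint B) ∈ Metric.closedBall (0 : selfAdjoint B) (M * 2) := by
    intro b hb
    obtain ⟨r, hr⟩ := hM b 2 (hb.trans_lt (by norm_num))
    exact ⟨r, mem_closedBall_zero_iff.2 (by exact_mod_cast hr)⟩
  have hzero : ∀ b : selfAdjoint B, quotientLip X.lip ψ δ b = 0 ↔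
      ∃ r : ℝ, b = r • (1 : selfAdjoint B) := by
    intro b
    constructor
    · intro hb
      -- The infimum defining the seminorm need not be attained, so `b` is only seen to be a limit
      -- of scalars, which form a closed set.
      have hcl : IsClosed ((Submodule.span ℝ {(1 : selfAdjoint B)} : Submodule ℝ _) :
          Set (selfAdjoint B)) := Submodule.closed_of_finiteDimensional _
      have hmem : b ∈ closure ((Submodule.span ℝ {(1 : selfAdjoint B)} : Submodule ℝ _) :
          Set (selfAdjoint B)) := by
        rw [Metric.mem_closure_iff]
        intro ε hε
        obtain ⟨l, hl, hlε⟩ : ∃ l : ℝ≥0, 0 < l ∧ M * l < ε := by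
          refine ⟨(ε / (M + 1)).toNNReal, by simpa using by positivity, ?_⟩
          rw [Real.coe_toNNReal _ (by positivity), mul_div_assoc', div_lt_iff₀ (by positivity)]
          nlinarith
        obtain ⟨r, hr⟩ := hM b l (by rw [hb]; exact_mod_cast hl)
        refine ⟨r • 1, Submodule.smul_mem _ _ (Submodule.mem_span_singleton_self _), ?_⟩
        rw [dist_eq_norm]
        exact hr.trans_lt hlε
      rw [hcl.closure_eq] at hmem
      obtain ⟨r, hr⟩ := Submodule.mem_span_singleton.1 hmem
      exact ⟨r, hr.symm⟩
    · rintro ⟨r, rfl⟩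
      have h1 := hT.lip_smul_one r
      have h2 := quotientLip_le (L := X.lip) (ψ := ψ) (δ := δ) (r • 1) (r • (1 : selfAdjoint B))
      exact le_antisymm (h2.trans h1.le) zero_le
  have key : ∀ (b b' c : selfAdjoint B), (∀ (a a' : selfAdjoint X),
      tunnelLip X.lip ψ δ (saPair a b) < ∞ → tunnelLip X.lip ψ δ (saPair a' b') < ∞ →
      quotientLip X.lip ψ δ c ≤ cdFun C (D + η) ‖((saPair a b : selfAdjoint (X × B)) : X × B)‖₊
        ‖((saPair a' b' : selfAdjoint (X × B)) : X × B)‖₊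
        (tunnelLip X.lip ψ δ (saPair a b)).toNNReal (tunnelLip X.lip ψ δ (saPair a' b')).toNNReal) →
      quotientLip X.lip ψ δ c ≤ cdFun C (D + η + 4 * C * δ.toNNReal) ‖(b : B)‖₊ ‖(b' : B)‖₊
        (quotientLip X.lip ψ δ b).toNNReal (quotientLip X.lip ψ δ b').toNNReal := by
    intro b b' c hc
    set l := (quotientLip X.lip ψ δ b).toNNReal with hl
    set l' := (quotientLip X.lip ψ δ b').toNNReal with hl'
    -- Almost optimal lifts give the inequality with slack `ε`, removed at the end by continuity.
    have hbound : ∀ ε : ℝ≥0, 0 < ε → quotientLip X.lip ψ δ c ≤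
        cdFun C (D + η + 4 * C * δ.toNNReal) ‖(b : B)‖₊ ‖(b' : B)‖₊ (l + ε) (l' + ε) := by
      intro ε hε
      obtain ⟨a, ha⟩ := exists_tunnelLip_le_add (ψ := ψ) (δ := δ) hL0 b hε
      obtain ⟨a', ha'⟩ := exists_tunnelLip_le_add (ψ := ψ) (δ := δ) hL0 b' hε
      rw [← ENNReal.coe_toNNReal (hlt b).ne, ← ENNReal.coe_add] at ha
      rw [← ENNReal.coe_toNNReal (hlt b').ne, ← ENNReal.coe_add] at ha'
      refine (hc a a' (ha.trans_lt ENNReal.coe_lt_top) (ha'.trans_lt ENNReal.coe_lt_top)).trans ?_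
      have hn : ‖((saPair a b : selfAdjoint (X × B)) : X × B)‖₊ ≤
          ‖(b : B)‖₊ + 2 * δ.toNNReal * (l + ε) := by
        rw [← NNReal.coe_le_coe]
        push_cast [Real.coe_toNNReal _ hδ.le]
        exact_mod_cast h.nnnorm_le hδ ha
      have hn' : ‖((saPair a' b' : selfAdjoint (X × B)) : X × B)‖₊ ≤
          ‖(b' : B)‖₊ + 2 * δ.toNNReal * (l' + ε) := by
        rw [← NNReal.coe_le_coe]
        push_cast [Real.coe_toNNReal _ hδ.le]
        exact_mod_cast h.nnnorm_le hδ ha'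
      have hml : (tunnelLip X.lip ψ δ (saPair a b)).toNNReal ≤ l + ε :=
        ENNReal.toNNReal_mono ENNReal.coe_ne_top ha
      have hml' : (tunnelLip X.lip ψ δ (saPair a' b')).toNNReal ≤ l' + ε :=
        ENNReal.toNNReal_mono ENNReal.coe_ne_top ha'
      refine ENNReal.coe_le_coe.2 (((isPermissible_cdFun hC _).mono hn hn' hml hml').trans (le_of_eq ?_))
      unfold cdFun
      ring
    have hcont : Continuous fun ε : ℝ≥0 => ((cdFun C (D + η + 4 * C * δ.toNNReal) ‖(b : B)‖₊
        ‖(b' : B)‖₊ (l + ε) (l' + ε) : ℝ≥0) : ℝ≥0∞) := by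
      unfold cdFun; fun_prop
    have hlim := (hcont.tendsto 0).mono_left (nhdsWithin_le_nhds (s := Set.Ioi 0))
    simp only [add_zero] at hlim
    exact ge_of_tendsto hlim (by filter_upwards [self_mem_nhdsWithin] with ε hε using hbound ε hε)
  exact
    { permissible := isPermissible_cdFun hC _
      lip_add := quotientLip_add hδ hL0 hX.lip_add
      lip_smul := hsmul
      dense_domain := hdense
      lip_eq_zero := hzero
      closed_ball := isClosed_quotientLip_ball hδ hL0 hX.lip_add
      mk_finite := mkDist_lt_top_of_totallyBounded hE hLE
      mk_topology := mkMetric_topology_of_totallyBounded hsmul hdense hE hLE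
      lip_jordan := fun b b' _ _ => key b b' _ fun a a' ha ha' =>
        (quotientLip_le (saJordan a a') (saJordan b b')).trans (hT.lip_jordan _ _ ha ha')
      lip_lie := fun b b' _ _ => key b b' _ fun a a' ha ha' =>
        (quotientLip_le (saLie a a') (saLie b b')).trans (hT.lip_lie _ _ ha ha') }

end IsApproxFactorization

/-- The Hausdorff distance from the whole state space to a set of states `s` is at most `r` if every
state is within `r` of `s`. -/
lemma mkHausdorff_univ_le {A : Type u} [CStarAlgebra A] {L : selfAdjoint A → ℝ≥0∞}
    {s : Set (State A)} {r : ℝ≥0∞} (h : ∀ φ, ∃ ψ ∈ s, mkDist L φ ψ ≤ r) :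
    mkHausdorff L Set.univ s ≤ r :=
  @Metric.hausdorffEDist_le_of_mem_edist (State A) (mkMetric L) _ _ _ (fun φ _ => h φ)
    (fun φ _ => ⟨φ, Set.mem_univ _, by rw [@edist_self _ (mkMetric L)]; exact zero_le⟩)

lemma isPositiveMap_prod {A B C : Type*} [CStarAlgebra A] [CStarAlgebra B] [CStarAlgebra C]
    {f : C →ₗ[ℂ] A} {g : C →ₗ[ℂ] B} (hf : IsPositiveMap f) (hg : IsPositiveMap g) :
    IsPositiveMap (f.prod g) := by
  intro c
  obtain ⟨a, ha⟩ := hf c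
  obtain ⟨b, hb⟩ := hg c
  exact ⟨(a, b), Prod.ext ha hb⟩

lemma isPositiveMap_id {A : Type*} [CStarAlgebra A] : IsPositiveMap (LinearMap.id : A →ₗ[ℂ] A) :=
  fun a => ⟨a, rfl⟩

/-- The composition of a state with a unital positive map. -/
def State.comp {A B : Type u} [CStarAlgebra A] [CStarAlgebra B] (χ : State B) (f : A →ₗ[ℂ] B)
    (hf : IsPositiveMap f) (h1 : f 1 = 1) : State A :=
  State.ofPositive (χ.toLinearMap ∘ₗ f) (χ.isPositiveMap.comp hf) (by simp [h1, χ.map_one])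

/-! ### The tunnel and its extent. -/

namespace IsApproxFactorization

variable {X : CStarPair.{u}} {B : Type u} [CStarAlgebra B] {φ : B →ₗ[ℂ] X} {ψ : X →ₗ[ℂ] B}
  {δ : ℝ} {η : ℝ≥0} 

/-- The tunnel from `X` to `B` built from the seminorm `tunnelLip`. -/
def tunnel (h : IsApproxFactorization X φ ψ δ η)
    {F : ℝ≥0 → ℝ≥0 → ℝ≥0 → ℝ≥0 → ℝ≥0}
    (hF : IsQuasiLeibnizQCMS F ⟨X × B, tunnelLip X.lip ψ δ⟩) :
    Tunnel F X ⟨B, quotientLip X.lip ψ δ⟩ where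
  space := ⟨X × B, tunnelLip X.lip ψ δ⟩
  isQCMS := hF
  left := StarAlgHom.fst ℂ X B
  right := StarAlgHom.snd ℂ X B
  left_surjective := Prod.fst_surjective
  right_surjective := Prod.snd_surjective
  left_quotient a := by
    refine le_antisymm (le_iInf₂ fun d hd => ?_) ?_
    · have : saFst d = a := Subtype.ext hd
      rw [← this]
      exact lip_le_tunnelLip d
    -- The lift `(a, ψ a)` has seminorm exactly `L a`.
    · let b : selfAdjoint B := ⟨ψ a, h.pos_right.isSelfAdjoint_map a.2⟩
      refine (iInf₂_le (f := fun (d : selfAdjoint (X × B)) (_ : (d : X × B).1 = (a : X)) =>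
        tunnelLip X.lip ψ δ d) (saPair a b) rfl).trans ?_
      simp [tunnelLip, b]
  right_quotient b := rfl

/-- A state `χ` of `X × B` is moved to one factoring through `X` by composing with `a ↦ (a, ψ a)`,
at cost `δ`, and to one factoring through `B` by composing with `b ↦ (φ b, b)`, at cost `2δ`. -/
lemma tunnel_extent_le (h : IsApproxFactorization X φ ψ δ η) (hδ : 0 < δ)
    {F : ℝ≥0 → ℝ≥0 → ℝ≥0 → ℝ≥0 → ℝ≥0}
    (hF : IsQuasiLeibnizQCMS F ⟨X × B, tunnelLip X.lip ψ δ⟩) :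
    (h.tunnel hF).extent ≤ ENNReal.ofReal (2 * δ) := by
  have hle : ∀ (χ : State (X × B)) (d e : selfAdjoint (X × B)) (r : ℝ),
      ‖((d - e : selfAdjoint (X × B)) : X × B)‖ ≤ r → ‖χ.1 (d : X × B) - χ.1 (e : X × B)‖ ≤ r := by
    intro χ d e r hr
    rw [← map_sub]
    exact (χ.norm_apply_le (d - e).2).trans hr
  refine max_le (mkHausdorff_univ_le fun χ => ?_) (mkHausdorff_univ_le fun χ => ?_)
  · refine ⟨_, ⟨State.comp (A := X) (B := X × B) χ (LinearMap.id.prod ψ)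
      (isPositiveMap_prod isPositiveMap_id h.pos_right) (Prod.ext rfl h.one_right), rfl⟩,
      mkDist_le_ofReal fun (d : selfAdjoint (X × B)) hd => ?_⟩
    have hd' := (tunnelLip_le_iff (l := 1) hδ).1 hd
    have h2 := hd'.2
    refine hle χ d (saPair (saFst d) ⟨ψ (saFst d : X), h.pos_right.isSelfAdjoint_map (saFst d).2⟩) _ ?_
    have : ((d - saPair (saFst d) ⟨ψ (saFst d : X), h.pos_right.isSelfAdjoint_map (saFst d).2⟩ :
        selfAdjoint (X × B)) : X × B) = (0, (saSnd d : B) - ψ (saFst d : X)) :=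
      Prod.ext (sub_self (saFst d : X)) rfl
    rw [this, Prod.norm_mk, norm_zero, norm_sub_rev]
    refine max_le (by positivity) ?_
    simp only [NNReal.coe_one, mul_one] at h2
    linarith
  · refine ⟨_, ⟨State.comp (A := B) (B := X × B) χ (φ.prod LinearMap.id)
      (isPositiveMap_prod h.pos_left isPositiveMap_id) (Prod.ext h.one_left rfl), rfl⟩,
      mkDist_le_ofReal fun (d : selfAdjoint (X × B)) hd => ?_⟩
    have h2 := h.norm_sub_le' (l := 1) hδ hd
    refine hle χ d (saPair ⟨φ (saSnd d : B), h.pos_left.isSelfAdjoint_map (saSnd d).2⟩ (saSnd d)) _ ?_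
    have : ((d - saPair ⟨φ (saSnd d : B), h.pos_left.isSelfAdjoint_map (saSnd d).2⟩ (saSnd d) :
        selfAdjoint (X × B)) : X × B) = ((saFst d : X) - φ (saSnd d : B), 0) :=
      Prod.ext rfl (sub_self (saSnd d : B))
    rw [this, Prod.norm_mk, norm_zero]
    refine max_le ?_ (by positivity)
    simpa using h2

end IsApproxFactorization

/-- On a quantum compact metric space over a pseudo-diagonal algebra there are approximate
factorizations through finite dimensional algebras that are uniform with respect to the seminorm. -/
theorem exists_isApproxFactorization {X : CStarPair.{u}} {F : ℝ≥0 → ℝ≥0 → ℝ≥0 → ℝ≥0 → ℝ≥0}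
    (hX : IsQuasiLeibnizQCMS F X) (μ : State X) (hpd : IsPseudoDiagonal X) {δ : ℝ} (hδ : 0 < δ)
    {η : ℝ≥0} (hη : 0 < η) :
    ∃ (B : Type u) (_ : CStarAlgebra B) (_ : FiniteDimensional ℂ B) (φ : B →ₗ[ℂ] X)
      (ψ : X →ₗ[ℂ] B), IsApproxFactorization X φ ψ δ η := by
  set E := {a : selfAdjoint X | X.lip a ≤ 1 ∧ μ.1 (a : X) = 0} with hEdef
  have hE : TotallyBounded E := totallyBounded_lip_ball hX.mk_finite hX.mk_topology μ
  obtain ⟨M', hM'⟩ := isBounded_iff_forall_norm_le.1 hE.isBounded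
  set M := max M' 0
  have hM : ∀ e ∈ E, ‖(e : X)‖ ≤ M := fun e he => (hM' e he).trans (le_max_left _ _)
  have hM0 : 0 ≤ M := le_max_right _ _
  have hηδ : 0 < η * δ := by positivity
  -- The single tolerance `κ` serves the identity error `δ` and the product defect `η δ`. Half of it
  -- is spent on the net; the mesh `ρ` keeps the passage to the net, `2ρ` or `4Mρ`, within the other
  -- half.
  set κ := min δ (η * δ) with hκ
  have hκ0 : 0 < κ := lt_min hδ hηδ
  set ρ := κ / (8 * (M + 1)) with hρ
  have hρ0 : 0 < ρ := by positivity
  have hρM : ρ * (8 * (M + 1)) = κ := div_mul_cancel₀ _ (by positivity)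
  have hρ1 : 8 * ρ ≤ κ := by nlinarith
  have hρ2 : 8 * (M * ρ) ≤ κ := by nlinarith
  obtain ⟨t, htE, ht, hcov⟩ := Metric.finite_approx_of_totallyBounded hE ρ hρ0
  classical
  obtain ⟨B, _, _, φ, ψ, hφ, hφ1, hψ, hψ1, hid, hj, hl⟩ :=
    hpd (κ / 2) (by positivity) ((ht.image ((↑) : selfAdjoint X → X)).toFinset)
  have hmem : ∀ s ∈ t, (s : X) ∈ (ht.image ((↑) : selfAdjoint X → X)).toFinset := fun s hs => by
    simpa using hs
  have hnear : ∀ e ∈ E, ∃ s ∈ t, ‖(e : X) - s‖ ≤ ρ := fun e he => by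
    obtain ⟨s, hs, hes⟩ := Set.mem_iUnion₂.1 (hcov he)
    exact ⟨s, hs, (mem_ball_iff_norm.1 hes).le⟩
  have hψn : ∀ {a : X}, IsSelfAdjoint a → ‖ψ a‖ ≤ ‖a‖ := hψ.norm_le_of_map_one hψ1
  have hφn : ∀ {b : B}, IsSelfAdjoint b → ‖φ b‖ ≤ ‖b‖ := hφ.norm_le_of_map_one hφ1
  have hid' : ∀ e ∈ E, ‖(e : X) - φ (ψ e)‖ ≤ κ := by
    intro e he
    obtain ⟨s, hs, hes⟩ := hnear e he
    have h1 := hid _ (hmem s hs)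
    have hsa : IsSelfAdjoint ((e : X) - s) := (e - s).2
    have h2 := (hφn (hψ.isSelfAdjoint_map hsa)).trans (hψn hsa)
    rw [map_sub, map_sub] at h2
    have h3 : (e : X) - φ (ψ e) = ((e : X) - s) + ((s : X) - φ (ψ s)) - (φ (ψ e) - φ (ψ s)) := by
      abel
    rw [h3]
    refine (norm_sub_le_of_le (norm_add_le_of_le hes h1) (h2.trans hes)).trans ?_
    linarith
  -- The operation `m` is taken over all algebras at once, since it is used both in `X` and in `B`.
  have hop : ∀ (m : ∀ {A : Type u} [CStarAlgebra A], A → A → A),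
      (∀ {A : Type u} [CStarAlgebra A] (u v u' v' : A),
        ‖m u v - m u' v'‖ ≤ ‖u‖ * ‖v - v'‖ + ‖u - u'‖ * ‖v'‖) →
      (∀ {A : Type u} [CStarAlgebra A] (a b : selfAdjoint A), m (a : A) b ∈ selfAdjoint A) →
      (∀ s ∈ t, ∀ s' ∈ t, ‖ψ (m (s : X) s') - m (ψ s) (ψ s')‖ ≤ κ / 2) →
      ∀ e ∈ E, ∀ f ∈ E, ‖ψ (m (e : X) f) - m (ψ e) (ψ f)‖ ≤ κ := by
    intro m hm hmsa hmt e he f hf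
    obtain ⟨s, hs, hes⟩ := hnear e he
    obtain ⟨s', hs', hfs⟩ := hnear f hf
    have hsa : IsSelfAdjoint ((e : X) - s) := (e - s).2
    have hsa' : IsSelfAdjoint ((f : X) - s') := (f - s').2
    have h1 := hψn (AddSubgroup.sub_mem _ (hmsa e f) (hmsa s s'))
    rw [map_sub] at h1
    have h2 := hm (e : X) f s s'
    have h3 := hm (ψ e) (ψ f) (ψ s) (ψ s')
    rw [← map_sub, ← map_sub] at h3
    have h4 := (hψn hsa).trans hes
    have h5 := (hψn hsa').trans hfs
    have h6 := (hψn e.2).trans (hM e he)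
    have h7 := (hψn s'.2).trans (hM s' (htE hs'))
    have h8 : ‖(e : X)‖ * ‖(f : X) - s'‖ + ‖(e : X) - s‖ * ‖(s' : X)‖ ≤ M * ρ + ρ * M := by
      gcongr
      · exact hM e he
      · exact hM s' (htE hs')
    have h9 : ‖ψ e‖ * ‖ψ ((f : X) - s')‖ + ‖ψ ((e : X) - s)‖ * ‖ψ s'‖ ≤ M * ρ + ρ * M := by
      gcongr
    have h10 : ψ (m (e : X) f) - m (ψ e) (ψ f) = (ψ (m (e : X) f) - ψ (m (s : X) s')) +
        (ψ (m (s : X) s') - m (ψ s) (ψ s')) - (m (ψ e) (ψ f) - m (ψ s) (ψ s')) := by abel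
    rw [h10]
    refine (norm_sub_le_of_le (norm_add_le_of_le (h1.trans (h2.trans h8)) (hmt s hs s' hs'))
      (h3.trans h9)).trans ?_
    linarith
  have hj' := hop (fun {_} _ => jordan) norm_jordan_sub_le jordan_mem
    (fun s hs s' hs' => hj _ (hmem s hs) _ (hmem s' hs'))
  have hl' := hop (fun {_} _ => lie) norm_lie_sub_le lie_mem
    (fun s hs s' hs' => hl _ (hmem s hs) _ (hmem s' hs'))
  have hcoe : ∀ (r l : ℝ) (e : selfAdjoint X),
      ((r • (1 : selfAdjoint X) + l • e : selfAdjoint X) : X) = r • (1 : X) + l • (e : X) :=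
    fun _ _ _ => rfl
  have hmul : ∀ {x : B} {l m : ℝ}, ‖x‖ ≤ κ → 0 ≤ l → 0 ≤ m → ‖(l * m) • x‖ ≤ η * δ * l * m := by
    intro x l m hx hl hm
    rw [norm_smul, Real.norm_of_nonneg (by positivity)]
    calc l * m * ‖x‖ ≤ l * m * (η * δ) := by gcongr; exact hx.trans (min_le_right _ _)
      _ = _ := by ring
  refine ⟨B, _, ‹_›, φ, ψ, hφ, hφ1, hψ, hψ1, fun a ha => ?_, fun a b ha hb => ?_,
    fun a b ha hb => ?_⟩
  · obtain ⟨r, e, he, hae⟩ := hX.exists_eq_smul_one_add μ ha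
    have h1 : (a : X) - φ (ψ a) = (X.lip a).toReal • ((e : X) - φ (ψ e)) := by
      nth_rw 1 2 [hae]
      rw [hcoe]
      simp only [map_add, LinearMap.map_smul_of_tower, hψ1, hφ1, smul_sub]
      abel
    rw [h1, norm_smul, Real.norm_of_nonneg ENNReal.toReal_nonneg, mul_comm]
    gcongr
    exact (hid' e he).trans (min_le_left _ _)
  · obtain ⟨r, e, he, hae⟩ := hX.exists_eq_smul_one_add μ ha
    obtain ⟨s, f, hf, hbf⟩ := hX.exists_eq_smul_one_add μ hb
    have h1 : (a : X) = r • (1 : X) + (X.lip a).toReal • (e : X) := congrArg Subtype.val hae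
    have h2 : (b : X) = s • (1 : X) + (X.lip b).toReal • (f : X) := congrArg Subtype.val hbf
    rw [h1, h2, jordan_defect ψ hψ1]
    exact hmul (hj' e he f hf) ENNReal.toReal_nonneg ENNReal.toReal_nonneg
  · obtain ⟨r, e, he, hae⟩ := hX.exists_eq_smul_one_add μ ha
    obtain ⟨s, f, hf, hbf⟩ := hX.exists_eq_smul_one_add μ hb
    have h1 : (a : X) = r • (1 : X) + (X.lip a).toReal • (e : X) := congrArg Subtype.val hae
    have h2 : (b : X) = s • (1 : X) + (X.lip b).toReal • (f : X) := congrArg Subtype.val hbf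
    rw [h1, h2, lie_defect ψ hψ1]
    exact hmul (hl' e he f hf) ENNReal.toReal_nonneg ENNReal.toReal_nonneg

/-- A quantum compact metric space is at distance zero from itself. -/
lemma propinquity_self {F : ℝ≥0 → ℝ≥0 → ℝ≥0 → ℝ≥0 → ℝ≥0} {X : CStarPair.{u}}
    (hX : IsQuasiLeibnizQCMS F X) : propinquity F X X = 0 := by
  have hq : ∀ a : selfAdjoint X, X.lip a =
      ⨅ (d : selfAdjoint X) (_ : StarAlgHom.id ℂ X (d : X) = (a : X)), X.lip d := fun a =>
    le_antisymm (le_iInf₂ fun d hd => by rw [show d = a from Subtype.ext hd])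
      (iInf₂_le (f := fun (d : selfAdjoint X) (_ : StarAlgHom.id ℂ X (d : X) = (a : X)) => X.lip d) a rfl)
  let τ : Tunnel F X X := ⟨X, hX, StarAlgHom.id ℂ X, StarAlgHom.id ℂ X, Function.surjective_id,
    Function.surjective_id, hq, hq⟩
  refine le_antisymm ((iInf_le _ τ).trans (max_le ?_ ?_)) zero_le
  all_goals
    refine mkHausdorff_univ_le fun φ => ⟨φ, ⟨φ, rfl⟩, ?_⟩
    simp [mkDist]

/-- Only `D` has to grow strictly: the slack `D' - D` is shared equally between the defect of `ψ`
and the cost `4Cδ` of the quotient. -/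
theorem isLimitOfFiniteDimensional_of_isPseudoDiagonal {C D : ℝ≥0} (hC : 1 ≤ C)
    {X : CStarPair.{u}} (hX : IsCDQuasiLeibnizQCMS C D X) (hpd : IsPseudoDiagonal X)
    {C' D' : ℝ≥0} (hC' : C ≤ C') (hD' : D < D') : IsLimitOfFiniteDimensional C' D' X := by
  have hX' := hX.mono hC hC' hD'.le
  refine ⟨hX', ?_⟩
  -- The zero algebra has no state to normalize by, but is itself finite dimensional.
  rcases subsingleton_or_nontrivial X with _ | _
  · refine ⟨fun _ => X, fun _ => ⟨hX', inferInstance⟩, ?_⟩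
    simp only [propinquity_self hX']
    exact tendsto_const_nhds
  obtain ⟨μ⟩ : Nonempty (State X) := inferInstance
  obtain ⟨ε, hε⟩ : ∃ ε, D' = D + ε := ⟨D' - D, (add_tsub_cancel_of_le hD'.le).symm⟩
  have hε0 : 0 < ε := by
    rw [hε] at hD'
    exact (lt_add_iff_pos_right D).1 hD'
  have key : ∀ r : ℝ, 0 < r → ∃ Y : CStarPair.{u},
      (IsCDQuasiLeibnizQCMS C' D' Y ∧ FiniteDimensional ℂ Y) ∧
      propinquity (cdFun C' D') X Y ≤ ENNReal.ofReal r := by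
    intro r hr
    -- The first bound makes the extent at most `r`, the second makes `4Cδ ≤ ε / 2`.
    set δ : ℝ := min (r / 2) (ε / 2 / (4 * C)) with hδ
    have hC0 : (0 : ℝ) < C := by exact_mod_cast zero_lt_one.trans_le hC
    have hδ0 : 0 < δ := lt_min (by positivity) (by positivity)
    obtain ⟨B, _, _, φ, ψ, h⟩ := exists_isApproxFactorization hX μ hpd hδ0 (half_pos hε0)
    have h1 : D + ε / 2 + 4 * C * δ.toNNReal ≤ D' := by
      rw [hε, ← NNReal.coe_le_coe]
      push_cast [Real.coe_toNNReal _ hδ0.le]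
      have : 4 * C * δ ≤ ε / 2 := by
        rw [mul_comm, ← le_div_iff₀ (by positivity)]
        exact min_le_right _ _
      linarith
    have h2 := (h.isCD_tunnel hδ0 hC hX μ).mono hC hC' (le_self_add.trans h1)
    refine ⟨⟨B, quotientLip X.lip ψ δ⟩, ⟨(h.isCD_quotient hδ0 hC hX μ).mono hC hC' h1, ‹_›⟩, ?_⟩
    refine (iInf_le _ (h.tunnel h2)).trans ((h.tunnel_extent_le hδ0 h2).trans ?_)
    refine ENNReal.ofReal_le_ofReal ?_
    have := min_le_left (r / 2) (ε / 2 / (4 * C) : ℝ)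
    linarith
  choose Y hY hYr using fun n : ℕ => key (1 / ((n : ℝ) + 1)) (by positivity)
  refine ⟨Y, hY, tendsto_of_tendsto_of_tendsto_of_le_of_le tendsto_const_nhds ?_
    (fun _ => zero_le) hYr⟩
  have := ENNReal.tendsto_ofReal tendsto_one_div_add_atTop_nhds_zero_nat
  simpa using this

/-- An approximately idempotent self-adjoint element is close to a projection. -/
lemma exists_projection_near {M : Type*} [CStarAlgebra M] {h : M} (hh : IsSelfAdjoint h) {ε : ℝ}
    (hε : ε ≤ 1 / 8) (hhε : ‖h - h * h‖ ≤ ε) :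
    ∃ p : M, IsStarProjection p ∧ ‖p - h‖ ≤ 2 * ε := by
  have hcfc : h - h * h = cfc (fun x : ℝ => x - x * x) h := by
    rw [cfc_sub (fun x : ℝ => x) (fun x => x * x) h, cfc_mul (fun x : ℝ => x) (fun x => x) h,
      cfc_id' ℝ h]
  have hspec : ∀ x ∈ spectrum ℝ h, |x - x * x| ≤ ε := fun x hx => by
    have := norm_apply_le_norm_cfc (fun x : ℝ => x - x * x) h hx
    rw [← hcfc, Real.norm_eq_abs] at this
    exact this.trans hhε
  -- On the spectrum `|x - x²| ≤ 1/8`, which excludes the interval `(1/4, 3/4)`; there `f` rises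
  -- continuously from `0` to `1`, so it is an indicator on the spectrum.
  set f : ℝ → ℝ := fun x => max 0 (min 1 (2 * x - 1 / 2)) with hf
  have hfc : Continuous f := by fun_prop
  have hcases : ∀ x ∈ spectrum ℝ h, (x ≤ 1 / 4 ∧ f x = 0) ∨ (3 / 4 ≤ x ∧ f x = 1) := by
    intro x hx
    have h1 := abs_le.1 ((hspec x hx).trans hε)
    rcases le_or_gt x (1 / 4) with h2 | h2
    · exact Or.inl ⟨h2, max_eq_left ((min_le_right _ _).trans (by linarith))⟩
    · right
      have h3 : 3 / 4 ≤ x := by nlinarith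
      refine ⟨h3, ?_⟩
      rw [hf]
      simp only
      rw [min_eq_left (by linarith), max_eq_right zero_le_one]
  refine ⟨cfc f h, ⟨?_, cfc_predicate f h⟩, ?_⟩
  · rw [IsIdempotentElem, ← cfc_mul f f h]
    refine cfc_congr fun x hx => ?_
    rcases hcases x hx with ⟨-, h1⟩ | ⟨-, h1⟩ <;> simp [h1]
  · have : cfc f h - h = cfc (fun x => f x - x) h := by
      rw [cfc_sub f (fun x : ℝ => x) h, cfc_id' ℝ h]
    rw [this]
    have hε0 : 0 ≤ ε := (norm_nonneg _).trans hhε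
    refine norm_cfc_le (by positivity) fun x hx => ?_
    have h0 := hspec x hx
    -- One of the two factors is at least `3/4`, so the other, which is `|f x - x|`, is at most
    -- `4ε/3`.
    have h2 : |x - x * x| = |x| * |1 - x| := by rw [← abs_mul]; ring_nf
    rw [h2] at h0
    rw [Real.norm_eq_abs]
    rcases hcases x hx with ⟨h3, h1⟩ | ⟨h3, h1⟩
    · rw [h1, zero_sub, abs_neg]
      have : 3 / 4 ≤ |1 - x| := (by linarith : 3 / 4 ≤ 1 - x).trans (le_abs_self _)
      nlinarith [abs_nonneg x]
    · rw [h1]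
      have : 3 / 4 ≤ |x| := h3.trans (le_abs_self _)
      nlinarith [abs_nonneg (1 - x)]

lemma exists_eq_star_mul_self_of_nonneg {A : Type*} [CStarAlgebra A] [PartialOrder A]
    [StarOrderedRing A] {a : A} (ha : 0 ≤ a) : ∃ b, a = star b * b :=
  CStarAlgebra.nonneg_iff_eq_star_mul_self.1 ha

/-! ### Making quasi-diagonal approximations unital by compression to a corner. -/

section Compression

open ContinuousLinearMap

variable {H : Type u} [NormedAddCommGroup H] [InnerProductSpace ℂ H] [CompleteSpace H]
  (U : Submodule ℂ H) [CompleteSpace U]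

/-- The compression of operators to a closed subspace. -/
def compression : (H →L[ℂ] H) →ₗ[ℂ] (U →L[ℂ] U) where
  toFun x := adjoint U.subtypeL ∘L x ∘L U.subtypeL
  map_add' x y := by ext; simp
  map_smul' r x := by ext; simp

lemma adjoint_subtypeL_comp : adjoint U.subtypeL ∘L U.subtypeL = 1 := by
  ext v
  rw [U.adjoint_subtypeL]
  simp

lemma subtypeL_comp_adjoint : U.subtypeL ∘L adjoint U.subtypeL = U.starProjection := by
  ext v
  rw [U.adjoint_subtypeL]
  rfl

lemma compression_one : compression U 1 = 1 := adjoint_subtypeL_comp U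

lemma compression_mul (x y : H →L[ℂ] H) :
    compression U x * compression U y = compression U (x * U.starProjection * y) := by
  rw [← subtypeL_comp_adjoint]
  rfl

lemma norm_compression_le (x : H →L[ℂ] H) : ‖compression U x‖ ≤ ‖x‖ := by
  have h1 : ‖U.subtypeL‖ ≤ 1 := U.norm_subtypeL_le
  have h2 : ‖adjoint U.subtypeL‖ ≤ 1 := by rwa [LinearIsometryEquiv.norm_map]
  calc ‖compression U x‖ ≤ ‖adjoint U.subtypeL‖ * (‖x‖ * ‖U.subtypeL‖) :=
        (opNorm_comp_le _ _).trans (by gcongr; exact opNorm_comp_le _ _)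
    _ ≤ 1 * (‖x‖ * 1) := by gcongr
    _ = ‖x‖ := by ring

lemma norm_starProjection_mul_mul_le (x : H →L[ℂ] H) :
    ‖U.starProjection * x * U.starProjection‖ ≤ ‖compression U x‖ := by
  have h1 : ‖U.subtypeL‖ ≤ 1 := U.norm_subtypeL_le
  have h2 : ‖adjoint U.subtypeL‖ ≤ 1 := by rwa [LinearIsometryEquiv.norm_map]
  have h3 : U.starProjection * x * U.starProjection =
      U.subtypeL ∘L compression U x ∘L adjoint U.subtypeL := by
    rw [← subtypeL_comp_adjoint]; rfl
  rw [h3]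
  calc _ ≤ ‖U.subtypeL‖ * (‖compression U x‖ * ‖adjoint U.subtypeL‖) :=
        (opNorm_comp_le _ _).trans (by gcongr; exact opNorm_comp_le _ _)
    _ ≤ 1 * (‖compression U x‖ * 1) := by gcongr
    _ = _ := by ring

lemma isPositiveMap_compression :
    IsPositiveMap (A := H →L[ℂ] H) (B := U →L[ℂ] U) (compression U) := by
  intro x
  refine exists_eq_star_mul_self_of_nonneg (A := U →L[ℂ] U) ((nonneg_iff_isPositive _).2 ?_)
  have := isPositive_adjoint_comp_self (x ∘L U.subtypeL)
  rw [adjoint_comp] at this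
  exact this

end Compression

/-- A unital positive map between C*-algebras behaving like the compression to the corner of a
projection `P`. -/
structure IsCompression {M B : Type*} [CStarAlgebra M] [CStarAlgebra B] (c : M →ₗ[ℂ] B) (P : M) :
    Prop where
  isStarProjection : IsStarProjection P
  pos : IsPositiveMap c
  map_one : c 1 = 1
  norm_le : ∀ x, ‖c x‖ ≤ ‖x‖
  mul : ∀ x y, c x * c y = c (x * P * y)
  norm_ge : ∀ x, ‖P * x * P‖ ≤ ‖c x‖

lemma exists_isCompression {H : Type u} [NormedAddCommGroup H] [InnerProductSpace ℂ H]
    [FiniteDimensional ℂ H] [CompleteSpace H] {P : H →L[ℂ] H} (hP : IsStarProjection P) :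
    ∃ (B : Type u) (_ : CStarAlgebra B) (_ : FiniteDimensional ℂ B) (c : (H →L[ℂ] H) →ₗ[ℂ] B),
      IsCompression c P := by
  obtain ⟨U, _, rfl⟩ := isStarProjection_iff_eq_starProjection.1 hP
  have hUc : CompleteSpace U := FiniteDimensional.complete ℂ U
  exact ⟨U →L[ℂ] U, inferInstance, inferInstance, compression U, hP, isPositiveMap_compression U,
    compression_one U, norm_compression_le U, compression_mul U, norm_starProjection_mul_mul_le U⟩

lemma norm_one_le_one {A : Type*} [CStarAlgebra A] : ‖(1 : A)‖ ≤ 1 := by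
  rcases subsingleton_or_nontrivial A with _ | _
  · simp [Subsingleton.elim (1 : A) 0]
  · exact CStarRing.norm_one.le

/-- A unital positive map into a finite dimensional C*-algebra. -/
structure UnitalPositiveMap (A : Type u) [CStarAlgebra A] : Type (u + 1) where
  target : Type u
  [cstar : CStarAlgebra target]
  [finiteDimensional : FiniteDimensional ℂ target]
  map : A →ₗ[ℂ] target
  pos : IsPositiveMap map
  map_one : map 1 = 1

attribute [instance] UnitalPositiveMap.cstar UnitalPositiveMap.finiteDimensional

lemma IsPositiveMap.of_map_star_mul_self {A B : Type*} [CStarAlgebra A] [CStarAlgebra B]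
    {f : A →ₗ[ℂ] B} (h : ∀ a, f (star a * a) = star (f a) * f a) : IsPositiveMap f :=
  fun a => ⟨f a, h a⟩

lemma IsCompletelyPositive.isPositiveMap {A B : Type*} [CStarAlgebra A] [CStarAlgebra B]
    {φ : A →ₗ[ℂ] B} (hφ : IsCompletelyPositive φ) : IsPositiveMap φ := by
  intro a
  obtain ⟨N, hN⟩ := hφ 1 (CStarMatrix.ofMatrix fun _ _ => a)
  refine ⟨N 0 0, ?_⟩
  have := congrArg (fun M : CStarMatrix (Fin 1) (Fin 1) B => M 0 0) hN
  simp only [CStarMatrix.map_apply, CStarMatrix.mul_apply, CStarMatrix.star_apply,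
    Finset.univ_unique, Fin.default_eq_zero, Finset.sum_singleton] at this
  exact this

/-- The positive map `a ↦ φ a + ω a • k`, for `k` positive. -/
lemma IsPositiveMap.smulRight {A B : Type*} [CStarAlgebra A] [CStarAlgebra B]
    {ω : A →ₗ[ℂ] ℂ} (hω : IsPositiveMap ω) {k : B} (hk : ∃ b, k = star b * b) :
    IsPositiveMap (ω.smulRight k) := by
  intro a
  obtain ⟨z, hz⟩ := hω a
  obtain ⟨b, rfl⟩ := hk
  refine ⟨z • b, ?_⟩
  rw [LinearMap.smulRight_apply, hz, star_smul, smul_mul_smul_comm]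

/-- Because `1 ∈ S`, `ψ 1` is almost idempotent, hence near a projection `p`, and `p` almost acts as
a unit on `ψ(S)`. Compressing to the corner of `p` leaves a positive unit defect `k` of norm at most
`2ε`, repaired by adding `ω(a) k`. The constant `20` is `4 + 1 + 3 + 12`, the sum of the errors in
the multiplicativity estimate. -/
lemma exists_unitalPositiveMap_of_compression {A : Type u} [CStarAlgebra A] (ω : State A)
    {M : Type*} [CStarAlgebra M]
    (hM : ∀ P : M, IsStarProjection P → ∃ (B : Type u) (_ : CStarAlgebra B)
      (_ : FiniteDimensional ℂ B) (c : M →ₗ[ℂ] B), IsCompression c P)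
    {ψ : A →ₗ[ℂ] M} (hψ : IsPositiveMap ψ) (hψn : ∀ a, ‖ψ a‖ ≤ ‖a‖)
    {S : Set A} (h1S : 1 ∈ S) {R ε : ℝ} (hR : 1 ≤ R) (hSR : ∀ a ∈ S, ‖a‖ ≤ R) (hε8 : ε ≤ 1 / 8)
    (hmul : ∀ a ∈ S, ∀ b ∈ S, ‖ψ (a * b) - ψ a * ψ b‖ ≤ ε) (hiso : ∀ a ∈ S, ‖a‖ ≤ ‖ψ a‖ + ε) :
    ∃ τ : UnitalPositiveMap A,
      (∀ a ∈ S, ∀ b ∈ S, ‖τ.map (a * b) - τ.map a * τ.map b‖ ≤ 20 * R ^ 2 * ε) ∧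
      ∀ a ∈ S, ‖a‖ ≤ ‖τ.map a‖ + 20 * R ^ 2 * ε := by
  have hε0 : 0 ≤ ε := (norm_nonneg _).trans (hmul 1 h1S 1 h1S)
  have hsa : IsSelfAdjoint (ψ 1) := hψ.isSelfAdjoint_map (.one A)
  obtain ⟨p, hp, hpε⟩ := exists_projection_near hsa hε8 (by simpa using hmul 1 h1S 1 h1S)
  obtain ⟨B, _, _, c, hc⟩ := hM p hp
  have hcpos := hc.pos
  set k := 1 - c (ψ 1) with hk
  have hknorm : ‖k‖ ≤ 2 * ε := by
    -- The compression sends `p` to `1`, since `c 1 * c 1 = c (1 * p * 1)`.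
    have : k = c (p - ψ 1) := by
      have h1 := hc.mul 1 1
      rw [one_mul, mul_one, hc.map_one, one_mul] at h1
      rw [map_sub, hk, ← h1]
    rw [this]
    exact (hc.norm_le _).trans hpε
  have hkpos : ∃ b, k = star b * b := by
    let _ := CStarAlgebra.spectralOrder M
    have _ := CStarAlgebra.spectralOrderedRing M
    have h1 : 0 ≤ 1 - ψ 1 := by
      rw [sub_nonneg]
      have h2 : 0 ≤ ψ 1 := by
        obtain ⟨b, hb⟩ := hψ 1
        rw [star_one, one_mul] at hb
        exact hb ▸ star_mul_self_nonneg b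
      exact (CStarAlgebra.norm_le_one_iff_of_nonneg _).1 ((hψn 1).trans norm_one_le_one)
    obtain ⟨b, hb⟩ := CStarAlgebra.nonneg_iff_eq_star_mul_self.1 h1
    obtain ⟨d, hd⟩ := hcpos b
    refine ⟨d, ?_⟩
    rw [← hd, ← hb, map_sub, hk, hc.map_one]
  let τ : UnitalPositiveMap A :=
    { target := B
      map := c ∘ₗ ψ + ω.toLinearMap.smulRight k
      pos := (hcpos.comp hψ).add (ω.isPositiveMap.smulRight hkpos)
      map_one := by simp [ω.map_one, hk] }
  have hτ : ∀ a, τ.map a = c (ψ a) + ω.1 a • k := fun a => rfl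
  have hτc : ∀ {a : A} {r : ℝ}, ‖a‖ ≤ r → ‖τ.map a - c (ψ a)‖ ≤ 4 * r * ε := by
    intro a r ha
    rw [hτ, add_sub_cancel_left]
    refine (norm_smul_le _ _).trans ?_
    calc ‖ω.1 a‖ * ‖k‖ ≤ (2 * r) * (2 * ε) := by
          have : ‖ω.1 a‖ ≤ 2 * r := (ω.norm_apply_le_two a).trans (by gcongr)
          have : 0 ≤ r := (norm_nonneg a).trans ha
          gcongr
      _ = 4 * r * ε := by ring
  have hcn : ∀ x, ‖c x‖ ≤ ‖x‖ := hc.norm_le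
  have hτn : ∀ {a : A}, a ∈ S → ‖τ.map a‖ ≤ 2 * R := fun {a} ha => by
    have h1 := τ.pos.norm_le_two a
    have h2 : ‖τ.map 1‖ ≤ 1 := by rw [τ.map_one]; exact norm_one_le_one
    nlinarith [hSR a ha, norm_nonneg a, norm_nonneg (τ.map 1)]
  have hPn : ‖p‖ ≤ 1 := hp.norm_le
  have hxn : ∀ {a : A}, a ∈ S → ‖ψ a‖ ≤ R := fun {a} ha => (hψn a).trans (hSR a ha)
  have hright : ∀ {a : A}, a ∈ S → ‖ψ a - ψ a * p‖ ≤ 3 * R * ε := by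
    intro a ha
    have h1 : ‖ψ a - ψ a * ψ 1‖ ≤ ε := by simpa using hmul a ha 1 h1S
    have h2 : ψ a - ψ a * p = (ψ a - ψ a * ψ 1) - ψ a * (p - ψ 1) := by noncomm_ring
    rw [h2]
    have h3 : ‖ψ a * (p - ψ 1)‖ ≤ R * (2 * ε) :=
      (norm_mul_le _ _).trans (by gcongr; exact hxn ha)
    refine (norm_sub_le_of_le h1 h3).trans ?_
    nlinarith
  have hleft : ∀ {a : A}, a ∈ S → ‖ψ a - p * ψ a‖ ≤ 3 * R * ε := by
    intro a ha
    have h1 : ‖ψ a - ψ 1 * ψ a‖ ≤ ε := by simpa using hmul 1 h1S a ha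
    have h2 : ψ a - p * ψ a = (ψ a - ψ 1 * ψ a) - (p - ψ 1) * ψ a := by noncomm_ring
    rw [h2]
    have h3 : ‖(p - ψ 1) * ψ a‖ ≤ (2 * ε) * R :=
      (norm_mul_le _ _).trans (by gcongr; exact hxn ha)
    refine (norm_sub_le_of_le h1 h3).trans ?_
    nlinarith
  refine ⟨τ, fun a ha b hb => ?_, fun a ha => ?_⟩
  · have hab : ‖a * b‖ ≤ R * R := (norm_mul_le _ _).trans (by
      gcongr; exacts [hSR a ha, hSR b hb])
    have e1 := hτc hab
    have e2 : ‖c (ψ (a * b)) - c (ψ a * ψ b)‖ ≤ ε := by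
      rw [← map_sub]; exact (hcn _).trans (hmul a ha b hb)
    have e3 : ‖c (ψ a * ψ b) - c (ψ a) * c (ψ b)‖ ≤ 3 * R * ε * R := by
      rw [hc.mul, ← map_sub]
      refine (hcn _).trans ?_
      rw [← sub_mul]
      exact (norm_mul_le _ _).trans (by gcongr; exacts [hright ha, hxn hb])
    have e4 : ‖c (ψ a) * c (ψ b) - τ.map a * τ.map b‖ ≤ 12 * R ^ 2 * ε := by
      have : c (ψ a) * c (ψ b) - τ.map a * τ.map b =
          -((τ.map a - c (ψ a)) * c (ψ b)) - τ.map a * (τ.map b - c (ψ b)) := by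
        rw [sub_mul, mul_sub]; abel
      rw [this]
      have f1 : ‖(τ.map a - c (ψ a)) * c (ψ b)‖ ≤ 4 * R * ε * R :=
        (norm_mul_le _ _).trans (by
          gcongr; exacts [hτc (hSR a ha), (hcn _).trans (hxn hb)])
      have f2 : ‖τ.map a * (τ.map b - c (ψ b))‖ ≤ 2 * R * (4 * R * ε) :=
        (norm_mul_le _ _).trans (by gcongr; exacts [hτn ha, hτc (hSR b hb)])
      refine (norm_sub_le_of_le ((norm_neg _).trans_le f1) f2).trans (le_of_eq (by ring))
    have : τ.map (a * b) - τ.map a * τ.map b = (τ.map (a * b) - c (ψ (a * b))) +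
        (c (ψ (a * b)) - c (ψ a * ψ b)) + (c (ψ a * ψ b) - c (ψ a) * c (ψ b)) +
        (c (ψ a) * c (ψ b) - τ.map a * τ.map b) := by abel
    rw [this]
    refine (norm_add_le_of_le (norm_add_le_of_le (norm_add_le_of_le e1 e2) e3) e4).trans ?_
    have : ε ≤ R ^ 2 * ε := le_mul_of_one_le_left hε0 (one_le_pow₀ hR)
    nlinarith
  · have e1 := hτc (hSR a ha)
    have e2 : ‖p * ψ a * p‖ ≤ ‖c (ψ a)‖ := hc.norm_ge _
    have e3 : ‖ψ a - p * ψ a * p‖ ≤ 6 * R * ε := by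
      have : ψ a - p * ψ a * p = (ψ a - ψ a * p) + (ψ a - p * ψ a) * p := by noncomm_ring
      rw [this]
      have f1 : ‖(ψ a - p * ψ a) * p‖ ≤ 3 * R * ε * 1 :=
        (norm_mul_le _ _).trans (by gcongr; exact hleft ha)
      exact (norm_add_le_of_le (hright ha) f1).trans (le_of_eq (by ring))
    have e4 := norm_le_norm_add_norm_sub' (ψ a) (p * ψ a * p)
    have e5 := norm_le_norm_add_norm_sub' (c (ψ a)) (τ.map a)
    rw [norm_sub_rev] at e5
    have e6 := hiso a ha
    have f1 : R * ε ≤ R ^ 2 * ε := by gcongr; nlinarith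
    have f2 : ε ≤ R ^ 2 * ε := le_mul_of_one_le_left hε0 (one_le_pow₀ hR)
    linarith

/-- Full matrix algebras act faithfully on a finite dimensional Hilbert space in any universe. -/
def matrixOperator (n : ℕ) : CStarMatrix (Fin n) (Fin n) ℂ ≃⋆ₐ[ℂ]
    (EuclideanSpace ℂ (ULift.{u} (Fin n)) →L[ℂ] EuclideanSpace ℂ (ULift.{u} (Fin n))) :=
  (CStarMatrix.reindexₐ ℂ ℂ Equiv.ulift.symm).trans
    (CStarMatrix.ofMatrixStarAlgEquiv.symm.trans Matrix.toEuclideanCLM)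

/-- Quasi-diagonality can be witnessed by unital positive maps into finite dimensional
C*-algebras. -/
theorem IsQuasiDiagonal.exists_unitalPositiveMap {A : Type u} [CStarAlgebra A]
    (hA : IsQuasiDiagonal A) (ω : State A) {ε : ℝ} (hε : 0 < ε) (S : Finset A) :
    ∃ τ : UnitalPositiveMap A,
      (∀ a ∈ S, ∀ b ∈ S, ‖τ.map (a * b) - τ.map a * τ.map b‖ ≤ ε) ∧
      ∀ a ∈ S, ‖a‖ ≤ ‖τ.map a‖ + ε := by
  classical
  obtain ⟨R, hR, hSR⟩ : ∃ R : ℝ, 1 ≤ R ∧ ∀ a ∈ insert 1 S, ‖a‖ ≤ R := by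
    refine ⟨1 + ∑ a ∈ insert 1 S, ‖a‖, by simp [Finset.sum_nonneg], fun a ha => ?_⟩
    have := Finset.single_le_sum (f := fun a : A => ‖a‖) (fun _ _ => norm_nonneg _) ha
    linarith
  set κ := min (1 / 8) (ε / (20 * R ^ 2)) with hκ
  have hκ0 : 0 < κ := lt_min (by norm_num) (by positivity)
  have hκε : 20 * R ^ 2 * κ ≤ ε := by
    rw [mul_comm, ← le_div_iff₀ (by positivity)]; exact min_le_right _ _
  obtain ⟨n, ψ, ⟨hcp, hψn⟩, hmul, hiso⟩ := hA κ hκ0 (insert 1 S)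
  -- Transport to operators on a Hilbert space, where projections have ranges to compress to, in the
  -- universe of `A`.
  let ρ := matrixOperator.{u} n
  have hρn : ∀ x, ‖ρ x‖ = ‖x‖ := fun x => NonUnitalStarAlgHom.norm_map ρ ρ.injective x
  let ρl : CStarMatrix (Fin n) (Fin n) ℂ →ₗ[ℂ]
      (EuclideanSpace ℂ (ULift.{u} (Fin n)) →L[ℂ] EuclideanSpace ℂ (ULift.{u} (Fin n))) :=
    { toFun := ρ, map_add' := map_add ρ, map_smul' := fun r x => map_smul ρ r x }
  have hρ : IsPositiveMap ρl :=
    .of_map_star_mul_self fun a => (map_mul ρ _ _).trans (congrArg (· * ρ a) (map_star ρ a))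
  obtain ⟨τ, h1, h2⟩ := exists_unitalPositiveMap_of_compression ω
    (M := EuclideanSpace ℂ (ULift.{u} (Fin n)) →L[ℂ] EuclideanSpace ℂ (ULift.{u} (Fin n)))
    (fun P hP => exists_isCompression hP)
    (hρ.comp hcp.isPositiveMap) (fun a => (hρn _).trans_le (hψn a)) (S := ↑(insert 1 S))
    (by simp) hR (by simpa using hSR) (min_le_left _ _)
    (fun a ha b hb => by
      change ‖ρ _ - ρ _ * ρ _‖ ≤ κ
      rw [← map_mul, ← map_sub, hρn]
      exact hmul a (by simpa using ha) b (by simpa using hb))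
    (fun a ha => by
      change ‖a‖ ≤ ‖ρ _‖ + κ
      rw [hρn]
      exact hiso a (by simpa using ha))
  exact ⟨τ, fun a ha b hb => (h1 a (by simp [ha]) b (by simp [hb])).trans hκε,
    fun a ha => (h2 a (by simp [ha])).trans (by gcongr)⟩

/-! ### Matrix amplifications -/

section MatrixUnits

variable {n : Type*} [DecidableEq n]

/-- The matrix with the single entry `a`. -/
def singleEntry {A : Type*} [AddCommMonoid A] [Module ℂ A] (i j : n) :
    A →ₗ[ℂ] CStarMatrix n n A where
  toFun a := CStarMatrix.ofMatrix (Matrix.single i j a)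
  map_add' a b := Matrix.single_add i j a b
  map_smul' r a := (Matrix.smul_single r i j a).symm

variable {A : Type*} [CStarAlgebra A]

lemma singleEntry_apply (i j : n) (a : A) (k l : n) :
    singleEntry i j a k l = if i = k ∧ j = l then a else 0 := rfl

lemma star_singleEntry (i j : n) (a : A) :
    star (singleEntry i j a) = singleEntry j i (star a) :=
  Matrix.conjTranspose_single i j a

lemma singleEntry_mul_singleEntry [Fintype n] (i j k : n) (a b : A) :
    singleEntry i j a * singleEntry j k b = singleEntry i k (a * b) :=
  by
  ext p q
  exact congrFun (congrFun (Matrix.single_mul_single_same a i j k b) p) q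

lemma sum_singleEntry [Fintype n] (M : CStarMatrix n n A) : ∑ i, ∑ j, singleEntry i j (M i j) = M :=
  (Matrix.matrix_eq_sum_single (CStarMatrix.ofMatrix.symm M)).symm

lemma mapₗ_singleEntry {B : Type*} [CStarAlgebra B] (f : A →ₗ[ℂ] B) (i j : n) (a : A) :
    (singleEntry i j a).mapₗ f = singleEntry i j (f a) := by
  ext k l
  change f (singleEntry i j a k l) = _
  rw [singleEntry_apply, singleEntry_apply, apply_ite f, map_zero]

variable [Fintype n] [PartialOrder A] [StarOrderedRing A]

/-- The C*-identity reduces to the diagonal entry `(j, j)`, where the embedding is a *-homomorphism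
and so contractive. -/
lemma norm_singleEntry_le (i j : n) (a : A) : ‖singleEntry i j a‖ ≤ ‖a‖ := by
  let f : A →⋆ₙₐ[ℂ] CStarMatrix n n A :=
    { singleEntry j j with
      map_zero' := map_zero (singleEntry j j)
      map_mul' := fun a b => (singleEntry_mul_singleEntry j j j a b).symm
      map_star' := fun a => (star_singleEntry j j a).symm }
  have h1 : ‖singleEntry i j a‖ * ‖singleEntry i j a‖ ≤ ‖a‖ * ‖a‖ := by
    rw [← CStarRing.norm_star_mul_self, ← CStarRing.norm_star_mul_self, star_singleEntry,
      singleEntry_mul_singleEntry]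
    exact NonUnitalStarAlgHom.norm_apply_le f _
  exact le_of_sq_le_sq (by simpa only [sq] using h1) (norm_nonneg _)

lemma norm_le_sum_norm_entry (M : CStarMatrix n n A) : ‖M‖ ≤ ∑ i, ∑ j, ‖M i j‖ := by
  conv_lhs => rw [← sum_singleEntry M]
  refine norm_sum_le_of_le _ fun i _ => norm_sum_le_of_le _ fun j _ => norm_singleEntry_le i j _

end MatrixUnits

instance (A : Type u) [CStarAlgebra A] (τ : UnitalPositiveMap A) : PartialOrder τ.target :=
  CStarAlgebra.spectralOrder _

instance (A : Type u) [CStarAlgebra A] (τ : UnitalPositiveMap A) : StarOrderedRing τ.target :=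
  CStarAlgebra.spectralOrderedRing _

/-- Along the filter `l`, unital positive maps are asymptotically multiplicative and
isometric. -/
structure IsAsymptoticEmbedding {A : Type u} [CStarAlgebra A]
    (l : Filter (UnitalPositiveMap A)) : Prop where
  mul : ∀ a b : A, Tendsto (fun τ : UnitalPositiveMap A =>
    ‖τ.map (a * b) - τ.map a * τ.map b‖) l (𝓝 0)
  norm : ∀ a : A, ∀ ε : ℝ, 0 < ε → ∀ᶠ τ : UnitalPositiveMap A in l, ‖a‖ ≤ ‖τ.map a‖ + ε

/-- The filter is the image of the directed set of pairs (finite subset, precision). It permits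
finitely many asymptotic conditions to be imposed together. -/
lemma IsQuasiDiagonal.exists_isAsymptoticEmbedding {A : Type u} [CStarAlgebra A] [Nontrivial A]
    (hA : IsQuasiDiagonal A) :
    ∃ l : Filter (UnitalPositiveMap A), l.NeBot ∧ IsAsymptoticEmbedding l := by
  classical
  obtain ⟨ω⟩ : Nonempty (State A) := inferInstance
  choose T hT1 hT2 using fun v : Finset A × ℕ =>
    hA.exists_unitalPositiveMap ω (Nat.one_div_pos_of_nat (α := ℝ) (n := v.2)) v.1
  have key : ∀ (S : Finset A) (ε : ℝ), 0 < ε → ∀ᶠ v : Finset A × ℕ in atTop,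
      S ⊆ v.1 ∧ 1 / ((v.2 : ℝ) + 1) < ε := by
    intro S ε hε
    obtain ⟨N, hN⟩ := exists_nat_one_div_lt hε
    filter_upwards [eventually_ge_atTop (S, N)] with v hv
    exact ⟨hv.1, (Nat.one_div_le_one_div hv.2).trans_lt hN⟩
  refine ⟨map T atTop, inferInstance, ⟨fun a b => ?_, fun a ε hε => ?_⟩⟩
  · rw [Metric.tendsto_nhds]
    intro ε hε
    rw [eventually_map]
    filter_upwards [key {a, b} ε hε] with v hv
    rw [Real.dist_0_eq_abs, abs_norm]
    exact (hT1 v a (hv.1 (by simp)) b (hv.1 (by simp))).trans_lt hv.2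
  · rw [eventually_map]
    filter_upwards [key {a} ε hε] with v hv
    have := hT2 v a (hv.1 (by simp))
    linarith [hv.2]

namespace UnitalPositiveMap

variable {A : Type u} [CStarAlgebra A] (τ : UnitalPositiveMap A) {n : Type*}

/-- The entrywise extension of a unital positive map to matrices. -/
def amplify (n : Type*) : CStarMatrix n n A →ₗ[ℂ] CStarMatrix n n τ.target :=
  CStarMatrix.mapₗ τ.map

lemma amplify_apply (M : CStarMatrix n n A) (i j : n) :
    τ.amplify n M i j = τ.map (M i j) := rfl

lemma amplify_one [DecidableEq n] : τ.amplify n 1 = 1 := by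
  ext i j
  rw [τ.amplify_apply, CStarMatrix.one_apply, CStarMatrix.one_apply, apply_ite τ.map, τ.map_one,
    _root_.map_zero]

lemma isSelfAdjoint_amplify {M : CStarMatrix n n A} (hM : IsSelfAdjoint M) :
    IsSelfAdjoint (τ.amplify n M) := by
  ext i j
  rw [CStarMatrix.star_apply, τ.amplify_apply, τ.amplify_apply, ← τ.pos.map_star,
    ← CStarMatrix.star_apply, hM.star_eq]

lemma norm_map_le (a : A) : ‖τ.map a‖ ≤ 2 * ‖a‖ := by
  have h1 := τ.pos.norm_le_two a
  have h2 : ‖τ.map 1‖ ≤ 1 := by rw [τ.map_one]; exact norm_one_le_one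
  nlinarith [norm_nonneg a]

/-- Maps in `UnitalPositiveMap` are only positive, so amplifications need not be contractive; what
matters is a bound independent of `τ`. -/
lemma norm_amplify_le [Fintype n] [DecidableEq n] [PartialOrder A] [StarOrderedRing A]
    (M : CStarMatrix n n A) : ‖τ.amplify n M‖ ≤ 2 * Fintype.card n ^ 2 * ‖M‖ := by
  refine (norm_le_sum_norm_entry _).trans ?_
  calc ∑ i, ∑ j, ‖τ.amplify n M i j‖ ≤ ∑ i : n, ∑ j : n, 2 * ‖M‖ := by
        gcongr with i _ j _
        exact (τ.norm_map_le _).trans (by gcongr; exact CStarMatrix.norm_entry_le_norm)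
    _ = _ := by simp; ring

end UnitalPositiveMap

namespace IsAsymptoticEmbedding

variable {A : Type u} [CStarAlgebra A] {l : Filter (UnitalPositiveMap A)}
  {n : Type*} [Fintype n] [DecidableEq n]

lemma tendsto_amplify_mul (hl : IsAsymptoticEmbedding l) (M N : CStarMatrix n n A) :
    Tendsto (fun τ : UnitalPositiveMap A =>
      ‖τ.amplify n (M * N) - τ.amplify n M * τ.amplify n N‖) l (𝓝 0) := by
  have h : Tendsto (fun τ : UnitalPositiveMap A => ∑ i, ∑ j, ∑ k,
      ‖τ.map (M i k * N k j) - τ.map (M i k) * τ.map (N k j)‖) l (𝓝 0) := by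
    have : Tendsto (fun τ : UnitalPositiveMap A => ∑ i, ∑ j, ∑ k,
      ‖τ.map (M i k * N k j) - τ.map (M i k) * τ.map (N k j)‖) l
        (𝓝 (∑ i : n, ∑ j : n, ∑ k : n, 0)) :=
      tendsto_finsetSum _ fun i _ => tendsto_finsetSum _ fun j _ => tendsto_finsetSum _ fun k _ =>
        hl.mul _ _
    simpa using this
  refine squeeze_zero (fun _ => norm_nonneg _) (fun τ => ?_) h
  refine (norm_le_sum_norm_entry _).trans ?_
  gcongr with i _ j _
  rw [CStarMatrix.sub_apply, τ.amplify_apply, CStarMatrix.mul_apply, CStarMatrix.mul_apply,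
    map_sum, ← Finset.sum_sub_distrib]
  exact norm_sum_le _ _

variable [PartialOrder A] [StarOrderedRing A]

lemma tendsto_amplify_pow (hl : IsAsymptoticEmbedding l) (M : CStarMatrix n n A) (m : ℕ) :
    Tendsto (fun τ : UnitalPositiveMap A =>
      ‖τ.amplify n (M ^ m) - τ.amplify n M ^ m‖) l (𝓝 0) := by
  induction m with
  | zero => simp [UnitalPositiveMap.amplify_one, tendsto_const_nhds]
  | succ m ih =>
    have h : Tendsto (fun τ : UnitalPositiveMap A =>
        ‖τ.amplify n (M ^ m * M) - τ.amplify n (M ^ m) * τ.amplify n M‖ +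
          ‖τ.amplify n (M ^ m) - τ.amplify n M ^ m‖ * (2 * Fintype.card n ^ 2 * ‖M‖)) l (𝓝 0) := by
      simpa using (hl.tendsto_amplify_mul (M ^ m) M).add (ih.mul_const _)
    refine squeeze_zero (fun _ => norm_nonneg _) (fun τ => ?_) h
    rw [pow_succ, pow_succ]
    have : τ.amplify n (M ^ m * M) - τ.amplify n M ^ m * τ.amplify n M =
        (τ.amplify n (M ^ m * M) - τ.amplify n (M ^ m) * τ.amplify n M) +
          (τ.amplify n (M ^ m) - τ.amplify n M ^ m) * τ.amplify n M := by
      rw [sub_mul]; abel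
    rw [this]
    refine norm_add_le_of_le le_rfl ((norm_mul_le _ _).trans ?_)
    gcongr
    exact τ.norm_amplify_le M

/-- An entrywise lower bound losing a factor `n²`, which is later removed by applying it to high
powers of `M`. -/
lemma eventually_norm_le_card_sq_mul (hl : IsAsymptoticEmbedding l) (M : CStarMatrix n n A)
    {ε : ℝ} (hε : 0 < ε) :
    ∀ᶠ τ : UnitalPositiveMap A in l, ‖M‖ ≤ Fintype.card n ^ 2 * (‖τ.amplify n M‖ + ε) := by
  have h : ∀ᶠ τ : UnitalPositiveMap A in l, ∀ i j, ‖M i j‖ ≤ ‖τ.map (M i j)‖ + ε :=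
    eventually_all.2 fun i => eventually_all.2 fun j => hl.norm _ ε hε
  filter_upwards [h] with τ hτ
  refine (norm_le_sum_norm_entry M).trans ?_
  calc ∑ i, ∑ j, ‖M i j‖ ≤ ∑ i : n, ∑ j : n, (‖τ.amplify n M‖ + ε) := by
        gcongr with i _ j _
        exact (hτ i j).trans (by
          rw [← τ.amplify_apply]; gcongr; exact CStarMatrix.norm_entry_le_norm)
    _ = _ := by simp; ring

/-- Amplifications are asymptotically isometric. -/
lemma eventually_norm_le (hl : IsAsymptoticEmbedding l) {M : CStarMatrix n n A}
    (hM : IsSelfAdjoint M) {η : ℝ} (hη : 0 < η) :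
    ∀ᶠ τ : UnitalPositiveMap A in l, ‖M‖ ≤ ‖τ.amplify n M‖ + η := by
  rcases le_or_gt ‖M‖ η with h | h
  · exact .of_forall fun τ => h.trans (le_add_of_nonneg_left (norm_nonneg _))
  obtain ⟨r, hr⟩ : ∃ r, r = ‖M‖ - η := ⟨_, rfl⟩
  have hr0 : 0 < r := by linarith
  have hM0 : 1 < ‖M‖ / r := by rw [one_lt_div hr0]; linarith
  -- If the amplified norm were below `r = ‖M‖ - η`, the crude bound for `M ^ 2 ^ m` would give `‖M‖
  -- ^ 2 ^ m ≤ 3 n² r ^ 2 ^ m`, which fails for this `m`. The `3` counts the amplified power, its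
  -- multiplicativity error and the slack. Exponents `2 ^ m` are used because the C*-identity gives
  -- the norms of such powers of self-adjoint elements.
  obtain ⟨m, hm⟩ := pow_unbounded_of_one_lt ((Fintype.card n : ℝ) ^ 2 * 3) hM0
  have hm' : (Fintype.card n : ℝ) ^ 2 * 3 * r ^ 2 ^ m < ‖M‖ ^ 2 ^ m := by
    rw [← lt_div_iff₀ (by positivity), ← div_pow]
    exact hm.trans_le (pow_le_pow_right₀ hM0.le m.lt_two_pow_self.le)
  filter_upwards [hl.eventually_norm_le_card_sq_mul (M ^ 2 ^ m) (pow_pos hr0 (2 ^ m)),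
    (hl.tendsto_amplify_pow M (2 ^ m)).eventually_lt_const (pow_pos hr0 (2 ^ m))] with τ h1 h2
  by_contra! hlt
  have h3 : ‖τ.amplify n M‖ ^ 2 ^ m ≤ r ^ 2 ^ m := by gcongr; linarith
  rw [← (τ.isSelfAdjoint_amplify hM).norm_pow_two_pow] at h3
  have h4 := norm_le_norm_add_norm_sub' (τ.amplify n (M ^ 2 ^ m)) (τ.amplify n M ^ 2 ^ m)
  rw [hM.norm_pow_two_pow] at h1
  have h5 : (Fintype.card n : ℝ) ^ 2 * (‖τ.amplify n (M ^ 2 ^ m)‖ + r ^ 2 ^ m) ≤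
      (Fintype.card n : ℝ) ^ 2 * (3 * r ^ 2 ^ m) := by gcongr; linarith
  linarith

/-- Amplifications are asymptotically isometric, uniformly on compact sets. -/
lemma eventually_forall_norm_le (hl : IsAsymptoticEmbedding l) {K : Set (CStarMatrix n n A)}
    (hK : IsCompact K) (hKsa : ∀ M ∈ K, IsSelfAdjoint M) {η : ℝ} (hη : 0 < η) :
    ∀ᶠ τ : UnitalPositiveMap A in l, ∀ M ∈ K, ‖M‖ ≤ ‖τ.amplify n M‖ + η := by
  refine hK.induction_on (p := fun s => ∀ᶠ τ : UnitalPositiveMap A in l, ∀ M ∈ s,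
    ‖M‖ ≤ ‖τ.amplify n M‖ + η) (by simp) (fun s t hst ht => ht.mono fun τ h M hM => h M (hst hM))
    (fun s t hs ht => ?_) (fun M hM => ?_)
  · filter_upwards [hs, ht] with τ h1 h2 M hM
    exact hM.elim (h1 M) (h2 M)
  -- Moving from `M` to a point of its `κ`-ball costs `κ` before amplification and `2n²κ` after it.
  · obtain ⟨κ, hκ0, hκ⟩ : ∃ κ : ℝ, 0 < κ ∧ κ * (1 + 2 * Fintype.card n ^ 2) = η / 2 :=
      ⟨η / 2 / (1 + 2 * Fintype.card n ^ 2), by positivity, by field_simp⟩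
    refine ⟨Metric.ball M κ, mem_nhdsWithin_of_mem_nhds (Metric.ball_mem_nhds M hκ0), ?_⟩
    filter_upwards [hl.eventually_norm_le (hKsa M hM) (half_pos hη)] with τ hτ N hN
    rw [Metric.mem_ball, dist_eq_norm] at hN
    have h1 := norm_le_norm_add_norm_sub' N M
    have h2 := norm_le_norm_add_norm_sub (τ.amplify n N) (τ.amplify n M)
    rw [← map_sub] at h2
    have h3 : ‖τ.amplify n (N - M)‖ ≤ 2 * Fintype.card n ^ 2 * κ :=
      (τ.norm_amplify_le _).trans (by gcongr)
    linarith

end IsAsymptoticEmbedding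

/-! ### Approximate extension of states along almost isometric maps -/

/-- The values of a state on a finite family of self-adjoint elements. -/
def State.values {N : Type*} [CStarAlgebra N] {ι : Type*} (y : ι → N) (t : State N) :
    EuclideanSpace ℝ ι :=
  WithLp.toLp 2 fun i => (t.1 (y i)).re

lemma State.isCompact_range_values {N : Type*} [CStarAlgebra N] {ι : Type*} [Fintype ι]
    (y : ι → N) : IsCompact (Set.range (State.values y)) := by
  refine isCompact_range ((PiLp.continuous_toLp 2 _).comp (continuous_pi fun i => ?_))
  exact Complex.continuous_re.comp ((WeakDual.eval_continuous (y i)).comp continuous_subtype_val)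

lemma State.convex_range_values {N : Type*} [CStarAlgebra N] {ι : Type*} (y : ι → N) :
    Convex ℝ (Set.range (State.values y)) := by
  rintro _ ⟨s, rfl⟩ _ ⟨t, rfl⟩ a b ha hb hab
  refine ⟨State.ofPositive ((a : ℂ) • s.toLinearMap + (b : ℂ) • t.toLinearMap)
    ((s.isPositiveMap.smul ha).add (t.isPositiveMap.smul hb)) ?_, ?_⟩
  · simp [s.map_one, t.map_one, ← Complex.ofReal_add, hab]
  · ext i
    simp [State.values]

/-- If a unital `*`-preserving map `ψ` is almost isometric on the positive elements
`r + ∑ cᵢ xᵢ`, every state is almost of the form `t ∘ ψ` on the `xᵢ`. -/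
lemma State.exists_near_of_almost_isometric {M N : Type*} [CStarAlgebra M] [CStarAlgebra N]
    [Nontrivial N] {ψ : M →ₗ[ℂ] N} (h1 : ψ 1 = 1)
    (hsa : ∀ x, IsSelfAdjoint x → IsSelfAdjoint (ψ x)) {ι : Type*} [Fintype ι]
    {x : ι → M} (hx : ∀ i, IsSelfAdjoint (x i)) {r δ : ℝ} (hδ : 0 ≤ δ)
    (hr : ∀ c : EuclideanSpace ℝ ι, ‖c‖ ≤ 1 → ‖ψ (∑ i, (c i : ℂ) • x i)‖ ≤ r)
    (hiso : ∀ c : EuclideanSpace ℝ ι, ‖c‖ ≤ 1 → ‖(r : ℂ) • 1 + ∑ i, (c i : ℂ) • x i‖ ≤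
      ‖ψ ((r : ℂ) • 1 + ∑ i, (c i : ℂ) • x i)‖ + δ) (s : State M) :
    ∃ t : State N, ∀ i, ‖t.1 (ψ (x i)) - s.1 (x i)‖ ≤ δ := by
  set u : EuclideanSpace ℝ ι := State.values x s with hu
  -- Choose `t` with values nearest to those of `s` in the compact convex set of values of states of
  -- `N`. The unit vector `c` along the difference `d` then defines a separating hyperplane.
  obtain ⟨_, ⟨t, rfl⟩, ht⟩ := exists_norm_eq_iInf_of_complete_convex
    (Set.range_nonempty (State.values (ψ ∘ x)))
    (State.isCompact_range_values (ψ ∘ x)).isComplete (State.convex_range_values (ψ ∘ x)) u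
  rw [norm_eq_iInf_iff_real_inner_le_zero (State.convex_range_values _) (Set.mem_range_self t)] at ht
  refine ⟨t, fun i => ?_⟩
  set d := u - State.values (ψ ∘ x) t with hd
  have hdi : ‖t.1 (ψ (x i)) - s.1 (x i)‖ ≤ ‖d‖ := by
    rw [norm_sub_rev, ← s.coe_re_apply (hx i), ← t.coe_re_apply (hsa _ (hx i)),
      ← Complex.ofReal_sub, Complex.norm_real]
    exact PiLp.norm_apply_le d i
  refine hdi.trans ?_
  rcases eq_or_ne d 0 with h0 | h0
  · simpa [h0]
  obtain ⟨c, hc⟩ : ∃ c : EuclideanSpace ℝ ι, c = ‖d‖⁻¹ • d := ⟨_, rfl⟩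
  have hdpos : 0 < ‖d‖ := norm_pos_iff.2 h0
  have hcn : ‖c‖ ≤ 1 := by
    rw [hc, norm_smul, norm_inv, norm_norm, inv_mul_cancel₀ hdpos.ne']
  have hcd : inner ℝ c u - inner ℝ c (State.values (ψ ∘ x) t) = ‖d‖ := by
    rw [← inner_sub_right, ← hd, hc, real_inner_smul_left, real_inner_self_eq_norm_sq]
    field_simp
  have hsM : ((s.1 ((r : ℂ) • 1 + ∑ i, (c i : ℂ) • x i)).re) = r + inner ℝ c u := by
    simp [-Complex.coe_smul, PiLp.inner_apply, State.values, map_sum, mul_comm, hu, s.map_one]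
  have hsN : ∀ t : State N, (t.1 (ψ ((r : ℂ) • 1 + ∑ i, (c i : ℂ) • x i))).re =
      r + inner ℝ c (State.values (ψ ∘ x) t) := fun t => by
    simp [-Complex.coe_smul, PiLp.inner_apply, State.values, map_sum, mul_comm, h1, t.map_one]
  have hsum : IsSelfAdjoint (∑ i, (c i : ℂ) • x i) :=
    isSelfAdjoint_sum _ fun i _ => .smul (Complex.conj_ofReal _) (hx i)
  have hr1 : ∀ {M : Type _} [CStarAlgebra M], IsSelfAdjoint ((r : ℂ) • (1 : M)) :=
    .smul (Complex.conj_ofReal _) (.one _)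
  let _ := CStarAlgebra.spectralOrder N
  have _ := CStarAlgebra.spectralOrderedRing N
  -- The shift by `r` makes the image positive, so its norm is itself the value of a state `t'`,
  -- with no sign ambiguity.
  have hz : 0 ≤ ψ ((r : ℂ) • 1 + ∑ i, (c i : ℂ) • x i) := by
    rw [map_add, map_smul, h1]
    have h2 := (hsa _ hsum).neg_algebraMap_norm_le_self
    have h3 : algebraMap ℝ N ‖ψ (∑ i, (c i : ℂ) • x i)‖ ≤ algebraMap ℝ N r :=
      algebraMap_mono N (hr c hcn)
    have h4 : (r : ℂ) • (1 : N) = algebraMap ℝ N r := by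
      rw [Algebra.algebraMap_eq_smul_one]; exact (RCLike.real_smul_eq_coe_smul (K := ℂ) r _).symm
    rw [h4, ← sub_neg_eq_add, sub_nonneg]
    exact (neg_le.1 h2).trans h3
  obtain ⟨t', ht'⟩ := State.exists_apply_eq_of_mem_spectrum (IsSelfAdjoint.of_nonneg hz)
    (CStarAlgebra.norm_mem_spectrum_of_nonneg hz)
  have e1 : r + inner ℝ c u ≤ ‖(r : ℂ) • 1 + ∑ i, (c i : ℂ) • x i‖ := by
    rw [← hsM]
    exact (Complex.re_le_norm _).trans (s.norm_apply_le (hr1.add hsum))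
  have e2 := hsN t'
  rw [ht', Complex.ofReal_re] at e2
  have e3 : inner ℝ c (State.values (ψ ∘ x) t') ≤ inner ℝ c (State.values (ψ ∘ x) t) := by
    rw [← sub_nonpos, ← inner_sub_right, hc, real_inner_smul_left]
    exact mul_nonpos_of_nonneg_of_nonpos (by positivity) (ht _ ⟨t', rfl⟩)
  -- With `y = r + ∑ cᵢ xᵢ`: `s(y) ≤ ‖y‖ ≤ ‖ψ y‖ + δ = t'(ψ y) + δ ≤ t(ψ y) + δ`, and `s(y) - t(ψ y)
  -- = ‖d‖`.
  linarith [hiso c hcn]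

/-! ### Completely positive maps to matrix algebras as functionals -/

section Choi

variable {A : Type*} [CStarAlgebra A] {k : ℕ}

/-- The functional `(xᵢⱼ) ↦ ∑ α(xᵢⱼ)ᵢⱼ` of a map `α` into a matrix algebra. -/
def choiFunctional (α : A →ₗ[ℂ] CStarMatrix (Fin k) (Fin k) ℂ) :
    CStarMatrix (Fin k) (Fin k) A →ₗ[ℂ] ℂ where
  toFun M := ∑ i, ∑ j, α (M i j) i j
  map_add' M N := by simp [Finset.sum_add_distrib]
  map_smul' r M := by simp [Finset.mul_sum]

lemma choiFunctional_singleEntry (α : A →ₗ[ℂ] CStarMatrix (Fin k) (Fin k) ℂ) (i j : Fin k)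
    (a : A) : choiFunctional α (singleEntry i j a) = α a i j := by
  change ∑ p, ∑ q, α (singleEntry i j a p q) p q = _
  rw [Finset.sum_eq_single i, Finset.sum_eq_single j]
  · simp [singleEntry_apply]
  · intro q _ hq; simp [singleEntry_apply, hq.symm]
  · simp
  · intro p _ hp; simp [singleEntry_apply, hp.symm]
  · simp

/-- If `α` sends `M* M` entrywise to `N* N`, the functional takes the value `∑ₗₚ |∑ᵢ (Nₗᵢ)ₚᵢ|²`. -/
lemma IsCompletelyPositive.isPositiveMap_choiFunctional [PartialOrder A] [StarOrderedRing A]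
    {α : A →ₗ[ℂ] CStarMatrix (Fin k) (Fin k) ℂ} (hα : IsCompletelyPositive α) :
    IsPositiveMap (choiFunctional α) := by
  rw [isPositiveMap_complex_iff]
  intro M
  obtain ⟨N, hN⟩ := hα k M
  have h1 : ∀ i j, α ((star M * M) i j) i j = ∑ l, ∑ p, star (N l i p i) * N l j p j := by
    intro i j
    have := congrFun (congrFun (congrFun (congrFun hN i) j) i) j
    rw [CStarMatrix.map_apply] at this
    rw [this, CStarMatrix.mul_apply]
    have e : ∀ (v : Finset (Fin k)) (f : Fin k → CStarMatrix (Fin k) (Fin k) ℂ),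
        (∑ l ∈ v, f l) i j = ∑ l ∈ v, f l i j := fun v f => by
      induction v using Finset.cons_induction <;> simp_all
    rw [e]
    exact Finset.sum_congr rfl fun l _ => CStarMatrix.mul_apply
  have h2 : choiFunctional α (star M * M) =
      ∑ l, ∑ p, star (∑ i, N l i p i) * ∑ j, N l j p j := by
    change ∑ i, ∑ j, α ((star M * M) i j) i j = _
    simp only [h1, star_sum, Finset.sum_mul_sum]
    calc _ = ∑ i, ∑ l, ∑ j, ∑ p, star (N l i p i) * N l j p j :=
          Finset.sum_congr rfl fun i _ => Finset.sum_comm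
      _ = ∑ l, ∑ i, ∑ j, ∑ p, star (N l i p i) * N l j p j := Finset.sum_comm
      _ = ∑ l, ∑ i, ∑ p, ∑ j, star (N l i p i) * N l j p j :=
          Finset.sum_congr rfl fun l _ => Finset.sum_congr rfl fun i _ => Finset.sum_comm
      _ = _ := Finset.sum_congr rfl fun l _ => Finset.sum_comm
  rw [h2]
  exact Finset.sum_nonneg fun l _ => Finset.sum_nonneg fun p _ => star_mul_self_nonneg _

/-- The map into a matrix algebra given by a functional on matrices. -/
def choiMap (t : CStarMatrix (Fin k) (Fin k) A →ₗ[ℂ] ℂ) :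
    A →ₗ[ℂ] CStarMatrix (Fin k) (Fin k) ℂ where
  toFun a := CStarMatrix.ofMatrix fun i j => t (singleEntry i j a)
  map_add' a b := by
    ext i j
    change t (singleEntry i j (a + b)) = t (singleEntry i j a) + t (singleEntry i j b)
    rw [map_add, map_add]
  map_smul' r a := by
    ext i j
    change t (singleEntry i j (r • a)) = r • t (singleEntry i j a)
    rw [map_smul, map_smul]

open scoped MatrixOrder in
-- The quadratic form of the matrix at a vector `c` is `t (v* v)`, where `v` has the single nonzero
-- row `(cⱼ a)ⱼ`.
lemma IsPositiveMap.choiMap [PartialOrder A] [StarOrderedRing A]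
    {t : CStarMatrix (Fin k) (Fin k) A →ₗ[ℂ] ℂ} (ht : IsPositiveMap t) :
    IsPositiveMap (choiMap t) := by
  intro a
  have h : Matrix.PosSemidef (Matrix.of fun i j => t (singleEntry i j (star a * a))) := by
    refine .of_dotProduct_mulVec_nonneg ?_ fun c => ?_
    · ext i j
      rw [Matrix.conjTranspose_apply, Matrix.of_apply, Matrix.of_apply]
      refine (ht.map_star _).symm.trans ?_
      rw [star_singleEntry, star_mul, star_star]
    -- The row carrying `v` must exist, so `k = 0` is separate.
    · have hk : 0 < k ∨ k = 0 := by omega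
      rcases hk with hk | rfl
      · let v : CStarMatrix (Fin k) (Fin k) A := ∑ j, c j • singleEntry ⟨0, hk⟩ j a
        have hv : star v * v =
            ∑ i, ∑ j, (star (c i) * c j) • singleEntry i j (star a * a) := by
          simp only [v, star_sum, Finset.sum_mul_sum, star_smul, star_singleEntry,
            smul_mul_smul_comm, singleEntry_mul_singleEntry]
        have h2 : 0 ≤ t (star v * v) := isPositiveMap_complex_iff.1 ht v
        rw [hv] at h2
        refine h2.trans_eq ?_
        simp only [map_sum, map_smul, smul_eq_mul, dotProduct, Matrix.mulVec, Finset.mul_sum,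
          Matrix.of_apply, Pi.star_apply]
        exact Finset.sum_congr rfl fun i _ => Finset.sum_congr rfl fun j _ => by ring
      · simp
  obtain ⟨N, hN⟩ := CStarAlgebra.nonneg_iff_eq_star_mul_self.1 h.nonneg
  exact ⟨CStarMatrix.ofMatrix N, hN⟩

end Choi

namespace IsAsymptoticEmbedding

variable {A : Type u} [CStarAlgebra A] {l : Filter (UnitalPositiveMap A)}

/-- After normalization to a state this is the separation argument, whose almost isometry hypothesis
holds eventually, uniformly on the compact set of elements `r + ∑ cᵢ xᵢ`. -/
lemma eventually_exists_functional [PartialOrder A] [StarOrderedRing A]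
    (hl : IsAsymptoticEmbedding l) {n : Type*} [Fintype n] [DecidableEq n]
    {s : CStarMatrix n n A →ₗ[ℂ] ℂ} (hs : IsPositiveMap s) {ι : Type*} [Fintype ι]
    {x : ι → CStarMatrix n n A} (hx : ∀ i, IsSelfAdjoint (x i)) {δ : ℝ} (hδ : 0 < δ) :
    ∀ᶠ τ : UnitalPositiveMap A in l, ∃ t : CStarMatrix n n τ.target →ₗ[ℂ] ℂ, IsPositiveMap t ∧
      ∀ i, ‖t (τ.amplify n (x i)) - s (x i)‖ ≤ δ := by
  by_cases hs0 : s 1 = 0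
  · have h0 : ∀ y, s y = 0 := fun y => by
      have := hs.norm_le_two y
      rwa [hs0, norm_zero, mul_zero, zero_mul, norm_le_zero_iff] at this
    exact .of_forall fun τ => ⟨0, fun a => ⟨0, by simp⟩, fun i => by simp [h0, hδ.le]⟩
  obtain ⟨σ, hσ0, hσ⟩ : ∃ σ : ℝ, 0 < σ ∧ s 1 = σ := by
    have h1 : 0 ≤ s 1 := by simpa using isPositiveMap_complex_iff.1 hs 1
    obtain ⟨h2, h3⟩ := Complex.le_def.1 h1
    refine ⟨(s 1).re, lt_of_le_of_ne h2 fun h => hs0 (Complex.ext h.symm h3.symm),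
      Complex.ext rfl h3.symm⟩
  have : Nontrivial (CStarMatrix n n A) := ⟨1, 0, fun h => hs0 (by rw [h, map_zero])⟩
  let s' : State (CStarMatrix n n A) := .ofPositive ((σ⁻¹ : ℝ) • s)
    (hs.smul (inv_nonneg.2 hσ0.le)) (by simp [hσ, hσ0.ne'])
  -- This shift dominates every amplification of `∑ cᵢ xᵢ` with `‖c‖ ≤ 1`, so the compact set can be
  -- fixed before `τ`.
  obtain ⟨r, hr⟩ : ∃ r : ℝ, r = 2 * Fintype.card n ^ 2 * ∑ i, ‖x i‖ := ⟨_, rfl⟩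
  let y : EuclideanSpace ℝ ι → CStarMatrix n n A := fun c =>
    (r : ℂ) • 1 + ∑ i, (c i : ℂ) • x i
  have hK : IsCompact (y '' Metric.closedBall 0 1) :=
    (isCompact_closedBall _ _).image (by fun_prop)
  have hysa : ∀ M ∈ y '' Metric.closedBall 0 1, IsSelfAdjoint M := by
    rintro _ ⟨c, -, rfl⟩
    exact (IsSelfAdjoint.smul (Complex.conj_ofReal _) (.one _)).add
      (isSelfAdjoint_sum _ fun i _ => .smul (Complex.conj_ofReal _) (hx i))
  filter_upwards [hl.eventually_forall_norm_le hK hysa (div_pos hδ hσ0),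
    hl.eventually_norm_le (M := (1 : CStarMatrix n n A)) (.one _) one_half_pos] with τ hτ hτ1
  have : Nontrivial (CStarMatrix n n τ.target) := by
    refine ⟨1, 0, fun h => ?_⟩
    rw [τ.amplify_one, h, norm_zero, CStarRing.norm_one] at hτ1
    norm_num at hτ1
  obtain ⟨t, ht⟩ := s'.exists_near_of_almost_isometric (ψ := τ.amplify n) (r := r) τ.amplify_one
    (fun _ => τ.isSelfAdjoint_amplify) hx (div_pos hδ hσ0).le (fun c hc => by
      refine (τ.norm_amplify_le _).trans ?_
      rw [hr]
      gcongr
      refine norm_sum_le_of_le _ fun i _ => ?_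
      rw [norm_smul, Complex.norm_real]
      exact mul_le_of_le_one_left (norm_nonneg _) ((PiLp.norm_apply_le c i).trans hc))
    (fun c hc => hτ _ ⟨c, by simpa using hc, rfl⟩)
  refine ⟨(σ : ℂ) • t.toLinearMap, t.isPositiveMap.smul hσ0.le, fun i => ?_⟩
  have h1 : s (x i) = σ * s'.1 (x i) := by
    simp [s', hσ0.ne']
  rw [h1, LinearMap.smul_apply, smul_eq_mul, ← mul_sub, norm_mul, Complex.norm_real,
    Real.norm_of_nonneg hσ0.le, mul_comm, ← le_div_iff₀ hσ0]
  exact ht i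

/-- A completely positive map into a matrix algebra almost factors, on a finite set, through
each sufficiently good unital positive map. -/
lemma eventually_exists_isPositiveMap (hl : IsAsymptoticEmbedding l) {k : ℕ}
    {α : A →ₗ[ℂ] CStarMatrix (Fin k) (Fin k) ℂ} (hα : IsCompletelyPositive α) (F : Finset A)
    {δ : ℝ} (hδ : 0 < δ) :
    ∀ᶠ τ : UnitalPositiveMap A in l, ∃ γ : τ.target →ₗ[ℂ] CStarMatrix (Fin k) (Fin k) ℂ,
      IsPositiveMap γ ∧ ∀ a ∈ F, ‖γ (τ.map a) - α a‖ ≤ δ := by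
  let _ := CStarAlgebra.spectralOrder A
  have _ := CStarAlgebra.spectralOrderedRing A
  -- Functionals are matched on self-adjoint elements only, so each single-entry matrix is split
  -- into real and imaginary parts, giving `2κ` per entry of `γ (τ a) - α a`.
  let x : (F × Fin k × Fin k) × Bool → CStarMatrix (Fin k) (Fin k) A := fun p =>
    if p.2 then (ℜ (singleEntry p.1.2.1 p.1.2.2 (p.1.1 : A)) : CStarMatrix (Fin k) (Fin k) A)
    else ℑ (singleEntry p.1.2.1 p.1.2.2 (p.1.1 : A))
  have hx : ∀ p, IsSelfAdjoint (x p) := by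
    rintro ⟨p, _ | _⟩
    exacts [(ℑ (singleEntry p.2.1 p.2.2 (p.1 : A))).2, (ℜ (singleEntry p.2.1 p.2.2 (p.1 : A))).2]
  obtain ⟨κ, hκ0, hκ⟩ : ∃ κ : ℝ, 0 < κ ∧ k ^ 2 * (2 * κ) ≤ δ :=
    ⟨δ / (2 * (k ^ 2 + 1)), by positivity, by
      rw [mul_div_assoc', mul_div_mul_left _ _ two_ne_zero, mul_div_assoc',
        div_le_iff₀ (by positivity)]
      nlinarith⟩
  filter_upwards [hl.eventually_exists_functional hα.isPositiveMap_choiFunctional hx hκ0]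
    with τ ⟨t, ht, h⟩
  refine ⟨choiMap t, ht.choiMap, fun a ha => (norm_le_sum_norm_entry _).trans ?_⟩
  have key : ∀ i j, ‖(choiMap t (τ.map a) - α a) i j‖ ≤ 2 * κ := by
    intro i j
    set e : CStarMatrix (Fin k) (Fin k) A := singleEntry i j a with he
    have h1 := h ((⟨a, ha⟩, i, j), true)
    have h2 := h ((⟨a, ha⟩, i, j), false)
    change ‖t (τ.amplify _ (ℜ e : CStarMatrix (Fin k) (Fin k) A)) -
      choiFunctional α (ℜ e : CStarMatrix (Fin k) (Fin k) A)‖ ≤ κ at h1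
    change ‖t (τ.amplify _ (ℑ e : CStarMatrix (Fin k) (Fin k) A)) -
      choiFunctional α (ℑ e : CStarMatrix (Fin k) (Fin k) A)‖ ≤ κ at h2
    have h3 : (choiMap t (τ.map a) - α a) i j = t (τ.amplify _ e) - choiFunctional α e := by
      rw [he, choiFunctional_singleEntry, UnitalPositiveMap.amplify, mapₗ_singleEntry]
      rfl
    have h4 : t (τ.amplify _ e) - choiFunctional α e =
        (t (τ.amplify _ (ℜ e : CStarMatrix (Fin k) (Fin k) A)) -
          choiFunctional α (ℜ e : CStarMatrix (Fin k) (Fin k) A)) +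
        Complex.I • (t (τ.amplify _ (ℑ e : CStarMatrix (Fin k) (Fin k) A)) -
          choiFunctional α (ℑ e : CStarMatrix (Fin k) (Fin k) A)) := by
      conv_lhs => rw [← realPart_add_I_smul_imaginaryPart e]
      simp only [map_add, map_smul, smul_sub]
      abel
    rw [h3, h4, two_mul]
    refine norm_add_le_of_le h1 ?_
    rwa [norm_smul, Complex.norm_I, one_mul]
  calc _ ≤ ∑ i : Fin k, ∑ j : Fin k, 2 * κ := by gcongr; exact key _ _
    _ = k ^ 2 * (2 * κ) := by simp; ring
    _ ≤ δ := hκ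

end IsAsymptoticEmbedding

/-! ### Nuclear quasi-diagonal C*-algebras are pseudo-diagonal -/

/-- An almost unital positive map can be made unital at a small cost. -/
lemma IsPositiveMap.exists_unital_near {A B : Type*} [CStarAlgebra A] [CStarAlgebra B]
    {θ : B →ₗ[ℂ] A} (hθ : IsPositiveMap θ) (ω : State B) {δ : ℝ} (hδ : 0 ≤ δ)
    (h1 : ‖θ 1 - 1‖ ≤ δ) :
    ∃ φ : B →ₗ[ℂ] A, IsPositiveMap φ ∧ φ 1 = 1 ∧
      ∀ b, ‖φ b - θ b‖ ≤ δ * (‖θ b‖ + 4 * ‖b‖) := by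
  let _ := CStarAlgebra.spectralOrder A
  have _ := CStarAlgebra.spectralOrderedRing A
  -- Shrinking `θ` by `κ` ensures `κ θ(1) ≤ 1`, so the unit defect `k` is positive and can be filled
  -- by `ω(b) k`.
  set κ : ℝ := (1 + δ)⁻¹ with hκ
  have hκ0 : 0 < κ := by positivity
  have hκ1 : κ * (1 + δ) = 1 := inv_mul_cancel₀ (by positivity)
  have hκ2 : 1 - κ ≤ δ := by nlinarith
  have hκ3 : 0 ≤ 1 - κ := by nlinarith
  have hκ4 : κ ≤ 1 := by linarith
  have hθ1 : ‖θ 1‖ ≤ 1 + δ := by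
    have := norm_le_norm_add_norm_sub' (θ 1) 1
    linarith [norm_one_le_one (A := A)]
  set k : A := 1 - (κ : ℂ) • θ 1 with hk
  have hkpos : ∃ b, k = star b * b := by
    rw [← CStarAlgebra.nonneg_iff_eq_star_mul_self, hk, sub_nonneg]
    have h2 : 0 ≤ (κ : ℂ) • θ 1 := by
      obtain ⟨b, hb⟩ := hθ.smul hκ0.le 1
      rw [star_one, one_mul, LinearMap.smul_apply] at hb
      exact hb ▸ star_mul_self_nonneg b
    refine (CStarAlgebra.norm_le_one_iff_of_nonneg _).1 ?_
    rw [norm_smul, Complex.norm_real, Real.norm_of_nonneg hκ0.le, ← hκ1]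
    gcongr
  have hkn : ‖k‖ ≤ 2 * δ := by
    have : k = -((κ : ℂ) • (θ 1 - 1)) + ((1 - κ : ℝ) : ℂ) • 1 := by
      rw [hk]; push_cast; module
    rw [this, two_mul]
    refine norm_add_le_of_le ?_ ?_
    · rw [norm_neg, norm_smul, Complex.norm_real, Real.norm_of_nonneg hκ0.le]
      exact (mul_le_of_le_one_left (norm_nonneg _) hκ4).trans h1
    · rw [norm_smul, Complex.norm_real, Real.norm_of_nonneg hκ3]
      exact (mul_le_of_le_one_right hκ3 norm_one_le_one).trans hκ2
  refine ⟨(κ : ℂ) • θ + ω.toLinearMap.smulRight k,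
    (hθ.smul hκ0.le).add (ω.isPositiveMap.smulRight hkpos), ?_, fun b => ?_⟩
  · simp [ω.map_one, hk]
  · have : ((κ : ℂ) • θ + ω.toLinearMap.smulRight k) b - θ b =
        -(((1 - κ : ℝ) : ℂ) • θ b) + ω.1 b • k := by
      simp only [LinearMap.add_apply, LinearMap.smul_apply, LinearMap.smulRight_apply,
        State.toLinearMap_apply]
      push_cast; module
    rw [this, mul_add]
    refine norm_add_le_of_le ?_ ?_
    · rw [norm_neg, norm_smul, Complex.norm_real, Real.norm_of_nonneg hκ3]
      gcongr
    · rw [norm_smul]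
      calc ‖ω.1 b‖ * ‖k‖ ≤ 2 * ‖b‖ * (2 * δ) := by gcongr; exact ω.norm_apply_le_two b
        _ = δ * (4 * ‖b‖) := by ring

lemma norm_map_jordan_sub_le {A B : Type*} [CStarAlgebra A] [CStarAlgebra B] (ψ : A →ₗ[ℂ] B)
    {a b : A} {ε : ℝ} (h1 : ‖ψ (a * b) - ψ a * ψ b‖ ≤ ε) (h2 : ‖ψ (b * a) - ψ b * ψ a‖ ≤ ε) :
    ‖ψ (jordan a b) - jordan (ψ a) (ψ b)‖ ≤ ε := by
  have : ψ (jordan a b) - jordan (ψ a) (ψ b) =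
      (2⁻¹ : ℂ) • ((ψ (a * b) - ψ a * ψ b) + (ψ (b * a) - ψ b * ψ a)) := by
    rw [jordan, jordan, map_smul, map_add]; module
  rw [this, norm_smul, norm_inv, Complex.norm_ofNat]
  linarith [norm_add_le_of_le h1 h2]

lemma norm_map_lie_sub_le {A B : Type*} [CStarAlgebra A] [CStarAlgebra B] (ψ : A →ₗ[ℂ] B)
    {a b : A} {ε : ℝ} (h1 : ‖ψ (a * b) - ψ a * ψ b‖ ≤ ε) (h2 : ‖ψ (b * a) - ψ b * ψ a‖ ≤ ε) :
    ‖ψ (lie a b) - lie (ψ a) (ψ b)‖ ≤ ε := by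
  have : ψ (lie a b) - lie (ψ a) (ψ b) =
      ((2 * Complex.I)⁻¹ : ℂ) • ((ψ (a * b) - ψ a * ψ b) - (ψ (b * a) - ψ b * ψ a)) := by
    rw [lie, lie, map_smul, map_sub]; module
  rw [this, norm_smul, norm_inv, norm_mul, Complex.norm_ofNat, Complex.norm_I]
  linarith [norm_sub_le_of_le h1 h2]

/-- Nuclear quasi-diagonal C*-algebras are pseudo-diagonal. -/
theorem IsNuclear.isPseudoDiagonal {A : Type u} [CStarAlgebra A] (hn : IsNuclear A)
    (hq : IsQuasiDiagonal A) : IsPseudoDiagonal A := by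
  classical
  intro ε hε S
  rcases subsingleton_or_nontrivial A with _ | _
  · have h0 : ∀ a : A, ‖a‖ ≤ ε := fun a => by rw [Subsingleton.elim a 0, norm_zero]; exact hε.le
    exact ⟨A, inferInstance, Module.Finite.of_finite, .id, .id, isPositiveMap_id, rfl,
      isPositiveMap_id, rfl, fun _ _ => h0 _, fun _ _ _ _ => h0 _, fun _ _ _ _ => h0 _⟩
  obtain ⟨l, hl0, hl⟩ := hq.exists_isAsymptoticEmbedding
  obtain ⟨R, hR, hSR⟩ : ∃ R : ℝ, 1 ≤ R ∧ ∀ a ∈ S, ‖a‖ ≤ R := by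
    refine ⟨1 + ∑ a ∈ S, ‖a‖, by simp [Finset.sum_nonneg], fun a ha => ?_⟩
    have := Finset.single_le_sum (f := fun a : A => ‖a‖) (fun _ _ => norm_nonneg _) ha
    linarith
  -- The final error is at most `2δ · 11R + 2δ ≤ 24Rδ`. The bound `1/4` keeps `β (γ 1)` within `1/2`
  -- of `1`, so that the target of `τ` is nontrivial and has a state.
  obtain ⟨δ, hδ0, hδ4, hδε⟩ : ∃ δ : ℝ, 0 < δ ∧ δ ≤ 1 / 4 ∧ 30 * R * δ ≤ ε :=
    ⟨min (1 / 4) (ε / (30 * R)), by positivity, min_le_left _ _, by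
      rw [mul_comm, ← le_div_iff₀ (by positivity)]; exact min_le_right _ _⟩
  obtain ⟨k, α, β, hα, hβ, hαβ⟩ := hn δ hδ0 (insert 1 S)
  have hmul : ∀ᶠ τ : UnitalPositiveMap A in l, ∀ a ∈ S, ∀ b ∈ S,
      ‖τ.map (a * b) - τ.map a * τ.map b‖ ≤ ε := by
    rw [Finset.eventually_all]
    intro a _
    rw [Finset.eventually_all]
    intro b _
    exact ((hl.mul a b).eventually_lt_const hε).mono fun _ h => h.le
  -- One `τ` is both almost multiplicative on `S` and admits `γ` with `γ ∘ τ` near `α`; then `β ∘ γ`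
  -- is the way back.
  obtain ⟨τ, ⟨γ, hγ, hγα⟩, hτ⟩ :=
    ((hl.eventually_exists_isPositiveMap hα.1 (insert 1 S) hδ0).and hmul).exists
  have hθ : IsPositiveMap (β ∘ₗ γ) := hβ.1.isPositiveMap.comp hγ
  have hθa : ∀ a ∈ insert 1 S, ‖(β ∘ₗ γ) (τ.map a) - a‖ ≤ 2 * δ := by
    intro a ha
    have : (β ∘ₗ γ) (τ.map a) - a = β (γ (τ.map a) - α a) - (a - β (α a)) := by
      rw [map_sub, LinearMap.comp_apply]; abel
    rw [this, two_mul]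
    exact norm_sub_le_of_le ((hβ.2 _).trans (hγα a ha)) (hαβ a ha)
  have hθ1 : ‖(β ∘ₗ γ) 1 - 1‖ ≤ 2 * δ := by
    simpa only [τ.map_one] using hθa 1 (by simp)
  have : Nontrivial τ.target := by
    refine ⟨1, 0, fun h => ?_⟩
    rw [h, map_zero, zero_sub, norm_neg, CStarRing.norm_one] at hθ1
    linarith
  obtain ⟨ω⟩ : Nonempty (State τ.target) := inferInstance
  obtain ⟨φ, hφ, hφ1, hφθ⟩ := hθ.exists_unital_near ω (by positivity) hθ1
  refine ⟨τ.target, τ.cstar, τ.finiteDimensional, φ, τ.map, hφ, hφ1, τ.pos, τ.map_one,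
    fun a ha => ?_, fun a ha b hb => norm_map_jordan_sub_le _ (hτ a ha b hb) (hτ b hb a ha),
    fun a ha b hb => norm_map_lie_sub_le _ (hτ a ha b hb) (hτ b hb a ha)⟩
  have e1 := hθa a (by simp [ha])
  have e2 := hφθ (τ.map a)
  have e3 := τ.norm_map_le a
  have e4 := hSR a ha
  have e5 := norm_le_norm_add_norm_sub' ((β ∘ₗ γ) (τ.map a)) a
  rw [norm_sub_rev, ← sub_add_sub_cancel _ ((β ∘ₗ γ) (τ.map a)) a]
  refine (norm_add_le_of_le e2 e1).trans (le_trans ?_ hδε)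
  have e6 : ‖(β ∘ₗ γ) (τ.map a)‖ + 4 * ‖τ.map a‖ ≤ 11 * R := by linarith
  nlinarith

end QuantumMetric

end

/-- The factor `1 + ε` on `C` is pure slack, and the Leibniz case is `C = 1`, `D = 0`. -/
theorem mainTheorem4 :
    (∀ (C D : ℝ≥0), 1 ≤ C → ∀ X : CStarPair.{u}, IsCDQuasiLeibnizQCMS C D X →
      IsPseudoDiagonal X →
      ∀ ε : ℝ≥0, 0 < ε → IsLimitOfFiniteDimensional (C * (1 + ε)) (D + ε) X) ∧
    (∀ (C D : ℝ≥0), 1 ≤ C → ∀ X : CStarPair.{u}, IsCDQuasiLeibnizQCMS C D X →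
      IsNuclear X → IsQuasiDiagonal X →
      ∀ ε : ℝ≥0, 0 < ε → IsLimitOfFiniteDimensional (C * (1 + ε)) (D + ε) X) ∧
    (∀ X : CStarPair.{u}, IsLeibnizQCMS X →
      IsNuclear X → IsQuasiDiagonal X →
      ∀ ε : ℝ≥0, 0 < ε → IsLimitOfFiniteDimensional (1 + ε) ε X) := by
  have h1 : ∀ (C D : ℝ≥0), 1 ≤ C → ∀ X : CStarPair.{u}, IsCDQuasiLeibnizQCMS C D X →
      IsPseudoDiagonal X →
      ∀ ε : ℝ≥0, 0 < ε → IsLimitOfFiniteDimensional (C * (1 + ε)) (D + ε) X :=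
    fun C D hC X hX hpd ε hε => isLimitOfFiniteDimensional_of_isPseudoDiagonal hC hX hpd
      (le_mul_of_one_le_right' (le_add_of_nonneg_right ε.2)) (lt_add_of_pos_right D hε)
  refine ⟨h1, fun C D hC X hX hn hq => h1 C D hC X hX (hn.isPseudoDiagonal hq),
    fun X hX hn hq ε hε => ?_⟩
  rw [IsLeibnizQCMS, leibnizFun_eq_cdFun] at hX
  simpa using h1 1 0 le_rfl X hX (hn.isPseudoDiagonal hq) ε hε
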